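/- A \emph{pasting scheme} $\mathcal P$ is a finite connected directed graph embedded in the plane $\mathbb C$ (multiple edges are allowed; edges are continuous arcs having a tangent direction at some point, e.g. piecewise smooth arcs) such that: (1) the edges with the exterior face on their left, and those with it on their right, form non-empty directed paths $\mathrm{dom}_{\mathcal P}$ and $\mathrm{cod}_{\mathcal P}$ with a common source $s_{\mathcal P}$ and a common target $t_{\mathcal P}$; (2) for each interior face $F$, the edges with $F$ on their right, and those with $F$ on their left, form non-empty directed paths $\mathrm{dom}_F$ and $\mathrm{cod}_F$ with the same source and the same target that share no edge and no interior vertex; (3) $s_{\mathcal P}$ is the only vertex without incoming edges and $t_{\mathcal P}$ is the only vertex without outgoing edges. (Directed paths in (1) and (2) do not repeat vertices.) Let $\mathfrak F\mathcal P$ be the free 2-category generated by the vertices, the edges and the interior faces $F:\mathrm{dom}_F\Rightarrow\mathrm{cod}_F$ of $\mathcal P$. Let $x\neq y$ be vertices of a pasting scheme $\mathcal P$, and let $q$ be a subpath of $\mathrm{cod}_{\mathcal P}$ from $x$ to $y$. Let $\mathcal P\cup\alpha$ be a pasting scheme obtained by attaching an atomic 2-cell $\alpha$ at the bottom of $\mathcal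 P$ from $x$ to $y$: its plane graph is that of $\mathcal P$ together with a new directed path $c$ from $x$ to $y$ that meets $\mathcal P$ only in $x$ and $y$; its interior faces are those of $\mathcal P$, with the same source and target paths, and one further face $\alpha$, with $\mathrm{dom}_\alpha=q$ and $\mathrm{cod}_\alpha=c$. Let $a,z$ be vertices of $\mathcal P$. Then $\mathfrak F\mathcal P(a,z)$ and $\mathfrak F(\mathcal P\cup\alpha)(a,z)$ are posets, and $$\begin{array}{ccc}\mathfrak F\mathcal P(y,z)\times\mathfrak F\mathcal P(x,y)\times\mathfrak F\mathcal P(a,x)&\xrightarrow{\ \circ\ }&\mathfrak F\mathcal P(a,z)\\ \downarrow&&\downarrow\\ \mathfrak F\mathcal P(y,z)\times\mathfrak F(\mathcal P\cup\alpha)(x,y)\times\mathfrak F\mathcal P(a,x)&\xrightarrow{\ \circ\ }&\mathfrak F(\mathcal P\cup\alpha)(a,z)\end{array}$$ is a pushout square in the category of small categories (hence also of posets), in which the vertical maps are induced by the inclusion $\mathcal P\subset\mathcal P\cup\alpha$ and the horizontal maps are given by composition and are injective on objects. Moreover $I:\mathfrak F\mathcal P(a,z)\hookrightarrow\mathfrak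 F(\mathcal P\cup\alpha)(a,z)$ is a Dwyer map: it is a full subcategory inclusion, its image is $\chi^{-1}(0)$ for a functor $\chi$ to $\{0\to1\}$, and, as a functor into the full subcategory of those objects that receive a morphism from its image, it has a right adjoint for which the unit is an identity. -/

import Mathlib

open CategoryTheory Topology

universe u v w

/-! ## Globes, computads and the hom-categories of free 2-categories -/

/-- A parallel pair of directed paths in a quiver. -/
structure Globe (V : Type u) [Quiver.{v} V] where
  src : V
  tgt : V
  dom : Quiver.Path src tgt
  cod : Quiver.Path src tgt

/-- The image of a parallel pair of paths under a morphism of quivers. -/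
abbrev Globe.map {V : Type u} [Quiver.{v} V] {W : Type u} [Quiver.{v} W]
    (φ : V ⥤q W) (g : Globe V) : Globe W where
  src := φ.obj g.src
  tgt := φ.obj g.tgt
  dom := φ.mapPath g.dom
  cod := φ.mapPath g.cod

/-- A 2-computad on a quiver `V`: a collection of atomic 2-cells, each of them with a source path
and a target path. -/
structure Computad (V : Type u) [Quiver.{v} V] where
  Cell : Type w
  bd : Cell → Globe V

namespace Computad

variable {V : Type u} [Quiver.{v} V] (K : Computad.{u, v, w} V)

/-- A whiskered atomic 2-cell from the path `p` to the path `q`: an atomic 2-cell together with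
a path `pre` before it and a path `post` after it. -/
structure Step {a b : V} (p q : Quiver.Path a b) : Type (max u v w) where
  cell : K.Cell
  pre : Quiver.Path a (K.bd cell).src
  post : Quiver.Path (K.bd cell).tgt b
  src_eq : p = pre.comp ((K.bd cell).dom.comp post)
  tgt_eq : q = pre.comp ((K.bd cell).cod.comp post)

/-- Formal vertical composites of whiskered atomic 2-cells. -/
inductive Derivation {a b : V} : Quiver.Path a b → Quiver.Path a b → Type (max u v w)
  | nil (p : Quiver.Path a b) : Derivation p p
  | cons {p q r : Quiver.Path a b} (s : K.Step p q) (d : Derivation q r) : Derivation p r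

namespace Derivation

variable {K} {a b : V}

def append {p q r : Quiver.Path a b} :
    K.Derivation p q → K.Derivation q r → K.Derivation p r
  | nil _, e => e
  | cons s d, e => cons s (append d e)

theorem append_nil {p q : Quiver.Path a b} (d : K.Derivation p q) : d.append (nil q) = d := by
  induction d with
  | nil => rfl
  | cons s d ih => exact congrArg (cons s) ih

theorem append_assoc {p q r t : Quiver.Path a b} (d : K.Derivation p q) (e : K.Derivation q r)
    (f : K.Derivation r t) : (d.append e).append f = d.append (e.append f) := by
  induction d with
  | nil => rfl
  | cons s d ih => exact congrArg (cons s) (ih e)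

end Derivation

/-- Two consecutive whiskered atomic 2-cells `s₁ : p → p₁`, `s₂ : p₁ → q` and two consecutive
whiskered atomic 2-cells `s₃ : p → p₂`, `s₄ : p₂ → q` apply the same two atomic 2-cells `F` and `G`
in disjoint positions `r ⬝ F ⬝ m ⬝ G ⬝ t`, the former first `F`, then `G`, and the latter first `G`,
then `F`. -/
inductive Interchange {a b : V} : ∀ {p p₁ p₂ q : Quiver.Path a b},
    K.Step p p₁ → K.Step p₁ q → K.Step p p₂ → K.Step p₂ q → Prop
  | mk (F G : K.Cell) (r : Quiver.Path a (K.bd F).src)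
      (m : Quiver.Path (K.bd F).tgt (K.bd G).src) (t : Quiver.Path (K.bd G).tgt b)
      (p p₁ p₂ q : Quiver.Path a b)
      (hp : p = r.comp ((K.bd F).dom.comp (m.comp ((K.bd G).dom.comp t))))
      (hp₁ : p₁ = r.comp ((K.bd F).cod.comp (m.comp ((K.bd G).dom.comp t))))
      (hp₂ : p₂ = r.comp ((K.bd F).dom.comp (m.comp ((K.bd G).cod.comp t))))
      (hq : q = r.comp ((K.bd F).cod.comp (m.comp ((K.bd G).cod.comp t)))) :
      Interchange (p := p) (p₁ := p₁) (p₂ := p₂) (q := q)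
        ⟨F, r, m.comp ((K.bd G).dom.comp t), hp, hp₁⟩
        ⟨G, r.comp ((K.bd F).cod.comp m), t, by simp [hp₁], by simp [hq]⟩
        ⟨G, r.comp ((K.bd F).dom.comp m), t, by simp [hp], by simp [hp₂]⟩
        ⟨F, r, m.comp ((K.bd G).cod.comp t), hp₂, hq⟩

/-- One application of the interchange relation inside a vertical composite. -/
inductive Rel {a b : V} : ∀ {p q : Quiver.Path a b},
    K.Derivation p q → K.Derivation p q → Prop
  | swap {p p₁ p₂ q r : Quiver.Path a b} {s₁ : K.Step p p₁} {s₂ : K.Step p₁ q}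
      {s₃ : K.Step p p₂} {s₄ : K.Step p₂ q} (_ : K.Interchange s₁ s₂ s₃ s₄)
      (d : K.Derivation q r) : Rel (.cons s₁ (.cons s₂ d)) (.cons s₃ (.cons s₄ d))
  | cons {p q r : Quiver.Path a b} (s : K.Step p q) {d d' : K.Derivation q r} (_ : Rel d d') :
      Rel (.cons s d) (.cons s d')

variable {K} in
theorem Rel.append_right {a b : V} {p q r : Quiver.Path a b} {d d' : K.Derivation p q}
    (h : K.Rel d d') (e : K.Derivation q r) : K.Rel (d.append e) (d'.append e) := by
  induction h with
  | swap h d => exact Rel.swap h _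
  | cons s _ ih => exact Rel.cons s (ih e)

variable {K} in
theorem Rel.append_left {a b : V} {p q r : Quiver.Path a b} (d : K.Derivation p q)
    {e e' : K.Derivation q r} (h : K.Rel e e') : K.Rel (d.append e) (d.append e') := by
  induction d with
  | nil => exact h
  | cons s d ih => exact Rel.cons s (ih h)

/-- The hom-category from `a` to `b` of the free 2-category on the computad `K`. Its objects are
the 1-cells from `a` to `b`, that is, the directed paths. Its morphisms are the 2-cells: vertical
composites of whiskered atomic 2-cells modulo interchange. -/
@[ext]
structure FreeHom {V : Type u} [Quiver.{v} V] (_K : Computad.{u, v, w} V) (a b : V) :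
    Type (max u v) where
  path : Quiver.Path a b

instance (a b : V) : Category.{max u v w} (K.FreeHom a b) where
  Hom p q := Quot (K.Rel (p := p.path) (q := q.path))
  id p := Quot.mk _ (.nil p.path)
  comp := Quot.map₂ Derivation.append (fun d _ _ h => h.append_left d)
    (fun _ _ e h => h.append_right e)
  id_comp := by rintro _ _ ⟨d⟩; rfl
  comp_id := by rintro _ _ ⟨d⟩; exact congrArg (Quot.mk _) d.append_nil
  assoc := by rintro _ _ _ _ ⟨d⟩ ⟨e⟩ ⟨f⟩; exact congrArg (Quot.mk _) (d.append_assoc e f)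

/-- A whiskered atomic 2-cell as a 2-cell. -/
def cell {a b : V} {p q : Quiver.Path a b} (s : K.Step p q) :
    (⟨p⟩ : K.FreeHom a b) ⟶ ⟨q⟩ :=
  Quot.mk _ (.cons s (.nil q))

theorem mk_cons {a b : V} {p q r : Quiver.Path a b} (s : K.Step p q) (d : K.Derivation q r) :
    (show (⟨p⟩ : K.FreeHom a b) ⟶ ⟨r⟩ from Quot.mk _ (.cons s d)) =
      K.cell s ≫ (show (⟨q⟩ : K.FreeHom a b) ⟶ ⟨r⟩ from Quot.mk _ d) := rfl

theorem cell_interchange {a b : V} {p p₁ p₂ q : Quiver.Path a b} {s₁ : K.Step p p₁}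
    {s₂ : K.Step p₁ q} {s₃ : K.Step p p₂} {s₄ : K.Step p₂ q} (h : K.Interchange s₁ s₂ s₃ s₄) :
    K.cell s₁ ≫ K.cell s₂ = K.cell s₃ ≫ K.cell s₄ :=
  Quot.sound (Rel.swap h _)

/-- To prove a property of all 2-cells, it suffices to treat identities and composites with
a whiskered atomic 2-cell. -/
theorem hom_induction {a b : V} (P : ∀ {p q : K.FreeHom a b}, (p ⟶ q) → Prop)
    (nil : ∀ p : K.FreeHom a b, P (𝟙 p))
    (cons : ∀ {p q : Quiver.Path a b} {r : K.FreeHom a b} (s : K.Step p q)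
      (f : (⟨q⟩ : K.FreeHom a b) ⟶ r), P f → P (K.cell s ≫ f))
    {p q : K.FreeHom a b} (f : p ⟶ q) : P f := by
  have key : ∀ {p q : Quiver.Path a b} (d : K.Derivation p q),
      P (p := ⟨p⟩) (q := ⟨q⟩) (Quot.mk _ d) := by
    intro p q d
    induction d with
    | nil p => exact nil ⟨p⟩
    | cons s d ih => exact cons s _ ih
  obtain ⟨p⟩ := p
  obtain ⟨q⟩ := q
  obtain ⟨d⟩ := f
  exact key d

/-- The value of a functor on a formal vertical composite. -/
def Derivation.eval {a b : V} {D : Type*} [Category D] (obj : Quiver.Path a b → D)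
    (map : ∀ {p q : Quiver.Path a b}, K.Step p q → (obj p ⟶ obj q)) :
    ∀ {p q : Quiver.Path a b}, K.Derivation p q → (obj p ⟶ obj q)
  | _, _, .nil p => 𝟙 (obj p)
  | _, _, .cons s d => map s ≫ Derivation.eval obj map d

theorem Derivation.eval_append {a b : V} {D : Type*} [Category D] (obj : Quiver.Path a b → D)
    (map : ∀ {p q : Quiver.Path a b}, K.Step p q → (obj p ⟶ obj q)) {p q r : Quiver.Path a b}
    (d : K.Derivation p q) (e : K.Derivation q r) :
    Derivation.eval K obj map (d.append e) =
      Derivation.eval K obj map d ≫ Derivation.eval K obj map e := by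
  induction d with
  | nil => exact (Category.id_comp _).symm
  | cons s d ih => simp only [Derivation.append, Derivation.eval, ih e, Category.assoc]

theorem Derivation.eval_rel {a b : V} {D : Type*} [Category D] (obj : Quiver.Path a b → D)
    (map : ∀ {p q : Quiver.Path a b}, K.Step p q → (obj p ⟶ obj q))
    (H : ∀ {p p₁ p₂ q : Quiver.Path a b} {s₁ : K.Step p p₁} {s₂ : K.Step p₁ q}
      {s₃ : K.Step p p₂} {s₄ : K.Step p₂ q}, K.Interchange s₁ s₂ s₃ s₄ →
      map s₁ ≫ map s₂ = map s₃ ≫ map s₄) {p q : Quiver.Path a b}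
    {d d' : K.Derivation p q} (h : K.Rel d d') :
    Derivation.eval K obj map d = Derivation.eval K obj map d' := by
  induction h with
  | swap h d => simp only [Derivation.eval, ← Category.assoc, H h]
  | cons s _ ih => simp only [Derivation.eval, ih]

/-- A functor out of a hom-category is given by its values on paths and on whiskered atomic
2-cells, provided that these respect interchange. -/
def lift {a b : V} {D : Type*} [Category D] (obj : Quiver.Path a b → D)
    (map : ∀ {p q : Quiver.Path a b}, K.Step p q → (obj p ⟶ obj q))
    (H : ∀ {p p₁ p₂ q : Quiver.Path a b} {s₁ : K.Step p p₁} {s₂ : K.Step p₁ q}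
      {s₃ : K.Step p p₂} {s₄ : K.Step p₂ q}, K.Interchange s₁ s₂ s₃ s₄ →
      map s₁ ≫ map s₂ = map s₃ ≫ map s₄) :
    K.FreeHom a b ⥤ D where
  obj p := obj p.path
  map := Quot.lift (Derivation.eval K obj map) (fun _ _ h => Derivation.eval_rel K obj map H h)
  map_id p := rfl
  map_comp := by
    rintro _ _ _ ⟨d⟩ ⟨e⟩
    exact Derivation.eval_append K obj map d e

theorem lift_map_cell {a b : V} {D : Type*} [Category D] (obj : Quiver.Path a b → D)
    (map : ∀ {p q : Quiver.Path a b}, K.Step p q → (obj p ⟶ obj q))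
    (H : ∀ {p p₁ p₂ q : Quiver.Path a b} {s₁ : K.Step p p₁} {s₂ : K.Step p₁ q}
      {s₃ : K.Step p p₂} {s₄ : K.Step p₂ q}, K.Interchange s₁ s₂ s₃ s₄ →
      map s₁ ≫ map s₂ = map s₃ ≫ map s₄) {p q : Quiver.Path a b} (s : K.Step p q) :
    (K.lift obj map H).map (K.cell s) = map s :=
  Category.comp_id _

/-! ### Horizontal composition -/

/-- Whiskering of a whiskered atomic 2-cell with a path before it. -/
def Step.left {x a b : V} (l : Quiver.Path x a) {p q : Quiver.Path a b} (s : K.Step p q) :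
    K.Step (l.comp p) (l.comp q) :=
  ⟨s.cell, l.comp s.pre, s.post, by simp [s.src_eq], by simp [s.tgt_eq]⟩

/-- Whiskering of a whiskered atomic 2-cell with a path after it. -/
def Step.right {a b y : V} {p q : Quiver.Path a b} (s : K.Step p q) (l : Quiver.Path b y) :
    K.Step (p.comp l) (q.comp l) :=
  ⟨s.cell, s.pre, s.post.comp l, (congrArg (·.comp l) s.src_eq).trans (by simp),
    (congrArg (·.comp l) s.tgt_eq).trans (by simp)⟩

theorem Interchange.of_eq {a b : V} (F G : K.Cell) (r : Quiver.Path a (K.bd F).src)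
    (m : Quiver.Path (K.bd F).tgt (K.bd G).src) (t : Quiver.Path (K.bd G).tgt b)
    {p p₁ p₂ q : Quiver.Path a b}
    {r₁ r₄ : Quiver.Path a (K.bd F).src} {r₂ r₃ : Quiver.Path a (K.bd G).src}
    {t₁ t₄ : Quiver.Path (K.bd F).tgt b} {t₂ t₃ : Quiver.Path (K.bd G).tgt b}
    (h₁ : p = r₁.comp ((K.bd F).dom.comp t₁)) (h₁' : p₁ = r₁.comp ((K.bd F).cod.comp t₁))
    (h₂ : p₁ = r₂.comp ((K.bd G).dom.comp t₂)) (h₂' : q = r₂.comp ((K.bd G).cod.comp t₂))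
    (h₃ : p = r₃.comp ((K.bd G).dom.comp t₃)) (h₃' : p₂ = r₃.comp ((K.bd G).cod.comp t₃))
    (h₄ : p₂ = r₄.comp ((K.bd F).dom.comp t₄)) (h₄' : q = r₄.comp ((K.bd F).cod.comp t₄))
    (e₁ : r₁ = r) (f₁ : t₁ = m.comp ((K.bd G).dom.comp t))
    (e₂ : r₂ = r.comp ((K.bd F).cod.comp m)) (f₂ : t₂ = t)
    (e₃ : r₃ = r.comp ((K.bd F).dom.comp m)) (f₃ : t₃ = t)
    (e₄ : r₄ = r) (f₄ : t₄ = m.comp ((K.bd G).cod.comp t)) :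
    K.Interchange (p := p) (p₁ := p₁) (p₂ := p₂) (q := q) ⟨F, r₁, t₁, h₁, h₁'⟩
      ⟨G, r₂, t₂, h₂, h₂'⟩ ⟨G, r₃, t₃, h₃, h₃'⟩ ⟨F, r₄, t₄, h₄, h₄'⟩ := by
  subst e₁ f₁ e₂ f₂ e₃ f₃ e₄ f₄
  exact Interchange.mk F G _ m _ p p₁ p₂ q h₁ h₁' h₄ h₄'

/-- Whiskering with a path before. -/
def whiskerL {x a : V} (l : Quiver.Path x a) (b : V) : K.FreeHom a b ⥤ K.FreeHom x b :=
  K.lift (fun p => ⟨l.comp p⟩) (fun s => K.cell (Step.left K l s)) (by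
    rintro _ _ _ _ _ _ _ _ ⟨F, G, r, m, t, p, p₁, p₂, q, hp, hp₁, hp₂, hq⟩
    exact K.cell_interchange (Interchange.of_eq K F G (l.comp r) m t _ _ _ _ _ _ _ _
      rfl rfl (by simp) rfl (by simp) rfl rfl rfl))

/-- Whiskering with a path after. -/
def whiskerR (a : V) {b y : V} (l : Quiver.Path b y) : K.FreeHom a b ⥤ K.FreeHom a y :=
  K.lift (fun p => ⟨p.comp l⟩) (fun s => K.cell (Step.right K s l)) (by
    rintro _ _ _ _ _ _ _ _ ⟨F, G, r, m, t, p, p₁, p₂, q, hp, hp₁, hp₂, hq⟩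
    exact K.cell_interchange (Interchange.of_eq K F G r m (t.comp l) _ _ _ _ _ _ _ _
      rfl (by simp) rfl rfl rfl rfl rfl (by simp)))

/-- The 2-cell `f ⬝ q`. -/
def mapR {a b c : V} {p p' : K.FreeHom a b} (f : p ⟶ p') (q : K.FreeHom b c) :
    (⟨p.path.comp q.path⟩ : K.FreeHom a c) ⟶ ⟨p'.path.comp q.path⟩ :=
  (K.whiskerR a q.path).map f

/-- The 2-cell `p ⬝ g`. -/
def mapL {a b c : V} (p : K.FreeHom a b) {q q' : K.FreeHom b c} (g : q ⟶ q') :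
    (⟨p.path.comp q.path⟩ : K.FreeHom a c) ⟶ ⟨p.path.comp q'.path⟩ :=
  (K.whiskerL p.path c).map g

theorem mapR_id {a b c : V} (p : K.FreeHom a b) (q : K.FreeHom b c) :
    K.mapR (𝟙 p) q = 𝟙 _ :=
  (K.whiskerR a q.path).map_id p

theorem mapL_id {a b c : V} (p : K.FreeHom a b) (q : K.FreeHom b c) :
    K.mapL p (𝟙 q) = 𝟙 _ :=
  (K.whiskerL p.path c).map_id q

theorem mapR_comp {a b c : V} {p p' p'' : K.FreeHom a b} (f : p ⟶ p') (f' : p' ⟶ p'')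
    (q : K.FreeHom b c) : K.mapR (f ≫ f') q = K.mapR f q ≫ K.mapR f' q :=
  (K.whiskerR a q.path).map_comp f f'

theorem mapL_comp {a b c : V} (p : K.FreeHom a b) {q q' q'' : K.FreeHom b c} (g : q ⟶ q')
    (g' : q' ⟶ q'') : K.mapL p (g ≫ g') = K.mapL p g ≫ K.mapL p g' :=
  (K.whiskerL p.path c).map_comp g g'

theorem mapR_cell {a b c : V} {p p' : Quiver.Path a b} (s : K.Step p p') (q : K.FreeHom b c) :
    K.mapR (K.cell s) q = K.cell (Step.right K s q.path) :=
  Category.comp_id _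

theorem mapL_cell {a b c : V} (p : K.FreeHom a b) {q q' : Quiver.Path b c} (t : K.Step q q') :
    K.mapL p (K.cell t) = K.cell (Step.left K p.path t) :=
  Category.comp_id _

theorem exchange_cell {a b c : V} {p p' : Quiver.Path a b} {q q' : Quiver.Path b c}
    (s : K.Step p p') (t : K.Step q q') :
    K.mapR (K.cell s) ⟨q⟩ ≫ K.mapL ⟨p'⟩ (K.cell t) =
      K.mapL ⟨p⟩ (K.cell t) ≫ K.mapR (K.cell s) ⟨q'⟩ := by
  rw [mapR_cell, mapR_cell, mapL_cell, mapL_cell]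
  exact K.cell_interchange (Interchange.of_eq K s.cell t.cell s.pre (s.post.comp t.pre) t.post
    _ _ _ _ _ _ _ _ rfl ((congrArg s.post.comp t.src_eq).trans (by simp))
    ((congrArg (·.comp t.pre) s.tgt_eq).trans (by simp)) rfl
    ((congrArg (·.comp t.pre) s.src_eq).trans (by simp)) rfl
    rfl ((congrArg s.post.comp t.tgt_eq).trans (by simp)))

theorem exchange {a b c : V} {p p' : K.FreeHom a b} {q q' : K.FreeHom b c}
    (f : p ⟶ p') (g : q ⟶ q') :
    K.mapR f q ≫ K.mapL p' g = K.mapL p g ≫ K.mapR f q' := by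
  induction f using K.hom_induction with
  | nil p => rw [mapR_id, mapR_id, Category.id_comp, Category.comp_id]
  | cons s f ih =>
    rw [mapR_comp, mapR_comp, Category.assoc, ih, ← Category.assoc, ← Category.assoc]
    congr 1
    clear ih f
    induction g using K.hom_induction with
    | nil q => rw [mapL_id, mapL_id, Category.id_comp, Category.comp_id]
    | cons t g ih =>
      rw [mapL_comp, mapL_comp, Category.assoc, ← ih, ← Category.assoc, ← Category.assoc,
        exchange_cell]

/-- The composition functor of the free 2-category. On 1-cells it is concatenation of paths; on
2-cells it is horizontal composition. -/
def hcomp (a b c : V) : K.FreeHom b c × K.FreeHom a b ⥤ K.FreeHom a c where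
  obj x := ⟨x.2.path.comp x.1.path⟩
  map {x x'} f := K.mapR f.2 x.1 ≫ K.mapL x'.2 f.1
  map_id x := by
    change K.mapR (𝟙 x.2) x.1 ≫ K.mapL x.2 (𝟙 x.1) = _
    rw [mapR_id, mapL_id, Category.comp_id]
  map_comp {x y z} f g := by
    change K.mapR (f.2 ≫ g.2) x.1 ≫ K.mapL z.2 (f.1 ≫ g.1) = _
    rw [mapR_comp, mapL_comp, Category.assoc, Category.assoc, ← Category.assoc (K.mapR g.2 x.1),
      exchange, Category.assoc]

/-- The ternary composition functor of the free 2-category. -/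
def hcomp₃ (a x y z : V) :
    K.FreeHom y z × (K.FreeHom x y × K.FreeHom a x) ⥤ K.FreeHom a z :=
  (𝟭 (K.FreeHom y z)).prod (K.hcomp a x y) ⋙ K.hcomp a y z

/-! ### Morphisms of computads -/

/-- A morphism of computads, which sends atomic 1-cells to atomic 1-cells and atomic 2-cells to
atomic 2-cells, compatibly with source and target paths. -/
structure Morphism {W : Type u} [Quiver.{v} W] (K : Computad.{u, v, w} V)
    (L : Computad.{u, v, w} W) where
  quiver : V ⥤q W
  onCell : K.Cell → L.Cell
  bd_onCell : ∀ c, L.bd (onCell c) = (K.bd c).map quiver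

variable {K} {W : Type u} [Quiver.{v} W] {L : Computad.{u, v, w} W}

/-- A whiskered atomic 2-cell, from its boundary. -/
def Step.ofGlobe {a b : V} {p q : Quiver.Path a b} (c : K.Cell) (g : Globe V) (hg : K.bd c = g)
    (pre : Quiver.Path a g.src) (post : Quiver.Path g.tgt b)
    (hp : p = pre.comp (g.dom.comp post)) (hq : q = pre.comp (g.cod.comp post)) : K.Step p q :=
  ⟨c, hg ▸ pre, hg ▸ post, by subst hg; exact hp, by subst hg; exact hq⟩

/-- The action of a morphism of computads on whiskered atomic 2-cells. -/
def Morphism.onStep (φ : Morphism K L) {a b : V} {p q : Quiver.Path a b} (s : K.Step p q) :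
    L.Step (φ.quiver.mapPath p) (φ.quiver.mapPath q) :=
  Step.ofGlobe (φ.onCell s.cell) _ (φ.bd_onCell s.cell)
    (φ.quiver.mapPath s.pre) (φ.quiver.mapPath s.post)
    ((congrArg φ.quiver.mapPath s.src_eq).trans (by simp))
    ((congrArg φ.quiver.mapPath s.tgt_eq).trans (by simp))

theorem Interchange.ofGlobe {a b : V} (F G : K.Cell) (gF gG : Globe V) (hF : K.bd F = gF)
    (hG : K.bd G = gG) (r : Quiver.Path a gF.src)
    (m : Quiver.Path gF.tgt gG.src) (t : Quiver.Path gG.tgt b)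
    {p p₁ p₂ q : Quiver.Path a b}
    {r₁ r₄ : Quiver.Path a gF.src} {r₂ r₃ : Quiver.Path a gG.src}
    {t₁ t₄ : Quiver.Path gF.tgt b} {t₂ t₃ : Quiver.Path gG.tgt b}
    (h₁ : p = r₁.comp (gF.dom.comp t₁)) (h₁' : p₁ = r₁.comp (gF.cod.comp t₁))
    (h₂ : p₁ = r₂.comp (gG.dom.comp t₂)) (h₂' : q = r₂.comp (gG.cod.comp t₂))
    (h₃ : p = r₃.comp (gG.dom.comp t₃)) (h₃' : p₂ = r₃.comp (gG.cod.comp t₃))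
    (h₄ : p₂ = r₄.comp (gF.dom.comp t₄)) (h₄' : q = r₄.comp (gF.cod.comp t₄))
    (e₁ : r₁ = r) (f₁ : t₁ = m.comp (gG.dom.comp t))
    (e₂ : r₂ = r.comp (gF.cod.comp m)) (f₂ : t₂ = t)
    (e₃ : r₃ = r.comp (gF.dom.comp m)) (f₃ : t₃ = t)
    (e₄ : r₄ = r) (f₄ : t₄ = m.comp (gG.cod.comp t)) :
    K.Interchange (p := p) (p₁ := p₁) (p₂ := p₂) (q := q) (Step.ofGlobe F gF hF r₁ t₁ h₁ h₁')
      (Step.ofGlobe G gG hG r₂ t₂ h₂ h₂') (Step.ofGlobe G gG hG r₃ t₃ h₃ h₃')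
      (Step.ofGlobe F gF hF r₄ t₄ h₄ h₄') := by
  subst hF hG
  exact Interchange.of_eq K F G r m t _ _ _ _ _ _ _ _ e₁ f₁ e₂ f₂ e₃ f₃ e₄ f₄

/-- The functor that the 2-functor induced by a morphism of computads gives on hom-categories. -/
def Morphism.onHom (φ : Morphism K L) (a b : V) :
    K.FreeHom a b ⥤ L.FreeHom (φ.quiver.obj a) (φ.quiver.obj b) :=
  K.lift (fun p => ⟨φ.quiver.mapPath p⟩) (fun s => L.cell (φ.onStep s)) (by
    rintro _ _ _ _ _ _ _ _ ⟨F, G, r, m, t, p, p₁, p₂, q, hp, hp₁, hp₂, hq⟩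
    exact L.cell_interchange (Interchange.ofGlobe (φ.onCell F) (φ.onCell G) _ _ _ _
      (φ.quiver.mapPath r) (φ.quiver.mapPath m) (φ.quiver.mapPath t) _ _ _ _ _ _ _ _
      rfl (by simp) (by simp) rfl (by simp) rfl rfl
      (by simp)))

end Computad

/-! ## Plane graphs and pasting schemes -/

/-- The set of edges that a path traverses. -/
def Quiver.Path.edgeSet {V : Type u} [Quiver.{v} V] {a : V} :
    ∀ {b : V}, Quiver.Path a b → Set (Quiver.Total V)
  | _, .nil => ∅
  | _, .cons p e => insert ⟨_, _, e⟩ p.edgeSet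

/-- A finite directed (multi)graph with vertex set `V`, drawn in the plane: vertices are distinct
points, the edges are arcs between their end points which meet each other and the vertices only at
end points. The arcs are arbitrary continuous arcs, except that each of them is asked to have
a tangent direction somewhere, so that its left-hand and its right-hand side can be told apart;
polygonal and piecewise smooth drawings qualify. -/
structure PlaneGraph (V : Type u) [Quiver.{v} V] where
  finite_vertices : Finite V
  finite_edges : Finite (Quiver.Total V)
  pos : V → ℂ
  curve : Quiver.Total V → ℝ → ℂ
  pos_injective : Function.Injective pos
  curve_continuous : ∀ e, ContinuousOn (curve e) (Set.Icc 0 1)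
  curve_zero : ∀ e, curve e 0 = pos e.left
  curve_one : ∀ e, curve e 1 = pos e.right
  curve_ne_pos : ∀ e, ∀ t ∈ Set.Ioo (0 : ℝ) 1, ∀ a, curve e t ≠ pos a
  curve_inj : ∀ e e', ∀ t ∈ Set.Ioo (0 : ℝ) 1, ∀ t' ∈ Set.Ioo (0 : ℝ) 1,
    curve e t = curve e' t' → e = e' ∧ t = t'
  exists_tangent : ∀ e, ∃ t ∈ Set.Ioo (0 : ℝ) 1, ∃ d : ℂ, d ≠ 0 ∧ HasDerivAt (curve e) d t

namespace PlaneGraph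

variable {V : Type u} [Quiver.{v} V] (G : PlaneGraph V)

/-- The subset of the plane occupied by the graph. -/
def carrier : Set ℂ := Set.range G.pos ∪ ⋃ e, G.curve e '' Set.Icc 0 1

/-- The (open) faces: the connected components of the complement of the graph. -/
def IsFace (F : Set ℂ) : Prop := ∃ z ∈ G.carrierᶜ, F = connectedComponentIn G.carrierᶜ z

/-- The interior faces: the bounded faces. -/
def IsInteriorFace (F : Set ℂ) : Prop := G.IsFace F ∧ Bornology.IsBounded F

/-- The exterior face: the unbounded component of the complement of the graph. -/
def exteriorFace : Set ℂ :=
  {z | z ∈ G.carrierᶜ ∧ ¬ Bornology.IsBounded (connectedComponentIn G.carrierᶜ z)}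

/-- The edge `e` is incident to the face `F` on its left: the points immediately to the left of `e`,
seen in the direction of travel, belong to `F`. -/
def OnLeft (e : Quiver.Total V) (F : Set ℂ) : Prop :=
  ∀ t ∈ Set.Ioo (0 : ℝ) 1, ∀ d : ℂ, d ≠ 0 → HasDerivAt (G.curve e) d t →
    ∀ᶠ δ : ℝ in 𝓝[>] 0, G.curve e t + δ * (Complex.I * d) ∈ F

/-- The edge `e` is incident to the face `F` on its right: the points immediately to the right of
`e`, seen in the direction of travel, belong to `F`. -/
def OnRight (e : Quiver.Total V) (F : Set ℂ) : Prop :=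
  ∀ t ∈ Set.Ioo (0 : ℝ) 1, ∀ d : ℂ, d ≠ 0 → HasDerivAt (G.curve e) d t →
    ∀ᶠ δ : ℝ in 𝓝[>] 0, G.curve e t - δ * (Complex.I * d) ∈ F

/-- The set `S` of edges forms the non-empty directed path `p`, which visits no vertex twice. -/
def Forms (S : Set (Quiver.Total V)) {a b : V} (p : Quiver.Path a b) : Prop :=
  S = p.edgeSet ∧ p.length ≠ 0 ∧ p.vertices.Nodup

/-- The exterior face is anchored by the source path `g.dom` and the target path `g.cod`. -/
structure AnchorsExterior (g : Globe V) : Prop where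
  dom : Forms {e | G.OnLeft e G.exteriorFace} g.dom
  cod : Forms {e | G.OnRight e G.exteriorFace} g.cod

/-- The interior face `F` is anchored by the source path `g.dom` and the target path `g.cod`,
which are internally disjoint. -/
structure AnchorsInterior (F : Set ℂ) (g : Globe V) : Prop where
  dom : Forms {e | G.OnRight e F} g.dom
  cod : Forms {e | G.OnLeft e F} g.cod
  disjoint_edges : Disjoint g.dom.edgeSet g.cod.edgeSet
  disjoint_vertices : ∀ a ∈ g.dom.vertices, a ∈ g.cod.vertices → a = g.src ∨ a = g.tgt

end PlaneGraph

/-- A pasting scheme: a finite connected plane graph, all of whose faces are anchored, in which the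
source of the exterior face is the only local source and the target of the exterior face is the
only local sink. -/
structure PastingScheme (V : Type u) [Quiver.{v} V] extends PlaneGraph V where
  connected : ∀ a b : V, Relation.EqvGen (fun a b : V => Nonempty (a ⟶ b)) a b
  exterior : Globe V
  anchors_exterior : toPlaneGraph.AnchorsExterior exterior
  interior : {F : Set ℂ // toPlaneGraph.IsInteriorFace F} → Globe V
  anchors_interior : ∀ F, toPlaneGraph.AnchorsInterior F.1 (interior F)
  local_source : ∀ a : V, (∀ b : V, IsEmpty (b ⟶ a)) ↔ a = exterior.src
  local_sink : ∀ a : V, (∀ b : V, IsEmpty (a ⟶ b)) ↔ a = exterior.tgt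

namespace PastingScheme

variable {V : Type u} [Quiver.{v} V]

/-- The 2-computad of a pasting scheme: the atomic 2-cells are the interior faces. -/
def computad (P : PastingScheme V) : Computad.{u, v, 0} V where
  Cell := {F : Set ℂ // P.toPlaneGraph.IsInteriorFace F}
  bd := P.interior

/-- The hom-category from `a` to `b` of the free 2-category generated by a pasting scheme. -/
abbrev FreeHom (P : PastingScheme V) (a b : V) : Type (max u v) := P.computad.FreeHom a b

variable {W : Type u} [Quiver.{v} W]

/-- `Q` is obtained by attaching a new atomic 2-cell `face` at the bottom of `P` from `x` to `y`:

* the plane graph of `Q` consists of that of `P` and a new path `newPath` from `x` to `y`, which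
  meets `P` in `x` and `y` only;
* the atomic 2-cells of `Q` are those of `P`, with their source and target paths, and `face`;
* the source path of `face` is a path `bottom` of `P` from `x` to `y` that is a subpath of the
  target path of `P`, and the target path of `face` is `newPath`. -/
structure BottomAttachment (P : PastingScheme V) (Q : PastingScheme W) (x y : V) where
  incl : V ⥤q W
  obj_injective : Function.Injective incl.obj
  map_injective : ∀ a b : V, Function.Injective (incl.map : (a ⟶ b) → _)
  pos_incl : ∀ a, Q.pos (incl.obj a) = P.pos a
  curve_incl : ∀ (a b : V) (e : a ⟶ b),
    Set.EqOn (Q.curve ⟨_, _, incl.map e⟩) (P.curve ⟨_, _, e⟩) (Set.Icc 0 1)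
  ne : x ≠ y
  bottom : Quiver.Path x y
  bottom_subpath : ∃ (r : Quiver.Path P.exterior.src x) (t : Quiver.Path y P.exterior.tgt),
    P.exterior.cod = r.comp (bottom.comp t)
  newPath : Quiver.Path (incl.obj x) (incl.obj y)
  new_edges : newPath.edgeSet =
    (Set.range fun e : Quiver.Total V => (⟨_, _, incl.map e.hom⟩ : Quiver.Total W))ᶜ
  new_vertices : {c | c ∈ newPath.vertices} \ {incl.obj x, incl.obj y} = (Set.range incl.obj)ᶜ
  face : Set ℂ
  face_new : ¬ P.IsInteriorFace face
  interior_iff : ∀ F, Q.IsInteriorFace F ↔ P.IsInteriorFace F ∨ F = face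
  interior_old : ∀ (F : Set ℂ) (hP : P.IsInteriorFace F) (hQ : Q.IsInteriorFace F),
    Q.interior ⟨F, hQ⟩ = (P.interior ⟨F, hP⟩).map incl
  interior_new : ∀ hQ : Q.IsInteriorFace face,
    Q.interior ⟨face, hQ⟩ = ⟨incl.obj x, incl.obj y, incl.mapPath bottom, newPath⟩

namespace BottomAttachment

variable {P : PastingScheme V} {Q : PastingScheme W} {x y : V} (A : P.BottomAttachment Q x y)

/-- The inclusion of the computad of `P` into the computad of `P ∪ α`. -/
def morphism : P.computad.Morphism Q.computad where
  quiver := A.incl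
  onCell F := ⟨F.1, (A.interior_iff F.1).2 (Or.inl F.2)⟩
  bd_onCell F := A.interior_old F.1 F.2 _

/-- The inclusion of hom-categories `FP(a, z) → F(P ∪ α)(a, z)`. -/
def inclHom (a z : V) : P.FreeHom a z ⥤ Q.FreeHom (A.incl.obj a) (A.incl.obj z) :=
  A.morphism.onHom a z

/-- The functor `FP(y, z) × FP(x, y) × FP(a, x) → FP(y, z) × F(P ∪ α)(x, y) × FP(a, x)`. -/
def spanLeft (a z : V) :
    P.FreeHom y z × (P.FreeHom x y × P.FreeHom a x) ⥤
      P.FreeHom y z × (Q.FreeHom (A.incl.obj x) (A.incl.obj y) × P.FreeHom a x) :=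
  (𝟭 (P.FreeHom y z)).prod ((A.inclHom x y).prod (𝟭 (P.FreeHom a x)))

/-- The functor `FP(y, z) × F(P ∪ α)(x, y) × FP(a, x) → F(P ∪ α)(a, z)`: inclusion into
`F(P ∪ α)` followed by composition. -/
def composeNew (a z : V) :
    P.FreeHom y z × (Q.FreeHom (A.incl.obj x) (A.incl.obj y) × P.FreeHom a x) ⥤
      Q.FreeHom (A.incl.obj a) (A.incl.obj z) :=
  (A.inclHom y z).prod ((𝟭 (Q.FreeHom (A.incl.obj x) (A.incl.obj y))).prod (A.inclHom a x)) ⋙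
    Q.computad.hcomp₃ (A.incl.obj a) (A.incl.obj x) (A.incl.obj y) (A.incl.obj z)

end BottomAttachment

end PastingScheme

/-! ## Posets as categories and Dwyer maps -/

/-- A category is a poset: there is at most one morphism between any two objects, and isomorphic
objects are equal. -/
def IsPosetCategory (C : Type*) [Category C] : Prop := Quiver.IsThin C ∧ Skeletal C

/-- The objects of the minimal cosieve containing the image of a functor. -/
def cosieveProperty {A B : Type*} [Category A] [Category B] (I : A ⥤ B) : ObjectProperty B :=
  fun b => ∃ a, Nonempty (I.obj a ⟶ b)

/-- The corestriction of a functor to the minimal cosieve containing its image. -/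
def toCosieve {A B : Type*} [Category A] [Category B] (I : A ⥤ B) :
    A ⥤ (cosieveProperty I).FullSubcategory :=
  (cosieveProperty I).lift I fun a => ⟨a, ⟨𝟙 _⟩⟩

/-- Dwyer maps: full subcategory inclusions `I : A ⥤ B` such that `A` is a sieve in `B`, that is,
the fibre over `0` of a functor from `B` to the walking arrow, and such that the inclusion of `A`
into the minimal cosieve containing it has a right adjoint for which the unit is an identity. -/
structure IsDwyerMap {A B : Type*} [Category A] [Category B] (I : A ⥤ B) : Prop where
  full : I.Full
  faithful : I.Faithful
  obj_injective : Function.Injective I.obj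
  sieve : ∃ χ : B ⥤ Fin 2, ∀ b, χ.obj b = 0 ↔ b ∈ Set.range I.obj
  retract : ∃ (R : (cosieveProperty I).FullSubcategory ⥤ A) (adj : toCosieve I ⊣ R)
    (h : 𝟭 A = toCosieve I ⋙ R), adj.unit = eqToHom h

/-! ## Continuous logarithms and winding numbers -/

/-! Plane topology enters only through winding numbers; the rest is combinatorics of paths.

For an integral circulation `c`, weight the variation of a continuous logarithm of `curve e - z` by
`c e`, sum over the edges and divide by `2πi`. Off the graph this is an integer, constant on each
face, zero on the exterior one, and it jumps by `c e` across `e` (`winding_jump`). The resulting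
linear forms, one for each bounded face, are independent (`faceWinding_independent`): a relation
with coefficients `n F` would give `∏ (z - p_F) ^ n F` a continuous logarithm on the graph, and such
a logarithm on the frontier of a face forces the order inside that face to vanish
(`order_eq_zero_of_log_on_frontier`). Comparing ranks, every function on the faces that is zero on
the exterior is rationally a winding function. Hence every edge has one left and one right face, the
jumps of a function on the faces form a circulation, and only constants have no jumps
(`exists_side_functions`).

There are no directed cycles (`eq_zero_of_nonneg_circulation`). A cycle would enclose a region; take
a minimal one. From an edge with the region on both sides one can walk forwards and backwards inside
it until a cycle closes, and minimality makes both cycles use the whole boundary. Recombining them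
yields a cycle that misses a boundary edge, a contradiction. So all edges at the region are boundary
edges with the region on the same side, although each of its faces has edges on both sides.

With acyclicity, edge-disjoint source paths and independent face boundaries
(`PastingScheme.isPlanar`), a 2-cell is determined by its source and target: the boundary fixes how
often each atomic 2-cell occurs, and any atomic 2-cell that occurs and is applicable at once can be
moved to the front by interchange (`exists_front`). The same count gives antisymmetry.

After attaching `α : q ⇒ c`, a path between old vertices is either old or of the form `r ⬝ c ⬝ t`
with unique old `r`, `t`. From `r ⬝ c ⬝ t` only `r` and `t` can still be rewritten, and an old `p`
lies above `r ⬝ c ⬝ t` exactly if it lies above `r ⬝ q ⬝ t` (`nonempty_hom_through_iff`). Thus the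
new hom-poset is the collage of `(t, r) ↦ r ⬝ q ⬝ t` (`isCollage_inclHom`). The left vertical map of
the square is a collage inclusion over the same source, so the square is a pushout
(`IsCollage.isPushout`); inclusions of the target of a collage are Dwyer maps
(`IsCollage.isDwyerMap`). -/

open Complex in
theorem exists_continuous_log {X : Type*} [TopologicalSpace X] [SimplyConnectedSpace X]
    [LocallyPathConnectedSpace X] (f : C(X, ℂ)) (hf : ∀ x, f x ≠ 0) :
    ∃ g : C(X, ℂ), ∀ x, exp (g x) = f x := by
  obtain ⟨x₀⟩ : Nonempty X := inferInstance
  obtain ⟨g, ⟨-, hg⟩, -⟩ := Complex.isCoveringMapOn_exp.existsUnique_continuousMap_lifts f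
    (a₀ := x₀) (e₀ := log (f x₀)) (exp_log (hf x₀)) (fun x => by simpa using hf x)
  exact ⟨g, fun x => congrFun hg x⟩

/-- Two continuous logarithms of the same function on a preconnected set differ by a constant. -/
theorem sub_eq_sub_of_exp_eq {X : Type*} [TopologicalSpace X] {s : Set X} (hs : IsPreconnected s)
    {f g : X → ℂ} (hf : ContinuousOn f s) (hg : ContinuousOn g s)
    (h : ∀ x ∈ s, Complex.exp (f x) = Complex.exp (g x)) {x y : X} (hx : x ∈ s) (hy : y ∈ s) :
    f x - g x = f y - g y := by
  -- The difference is a lift along the covering `exp` of the constant map 1, hence constant on a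
  -- preconnected set.
  refine Complex.isCoveringMap_exp.constOn_of_comp (g := fun x => f x - g x) hs (hf.sub hg)
    (fun a ha b hb => ?_) hx hy
  simp only [Subtype.mk.injEq]
  rw [Complex.exp_sub, Complex.exp_sub, h a ha, h b hb, div_self (Complex.exp_ne_zero _),
    div_self (Complex.exp_ne_zero _)]

/-- `l` is a continuous logarithm of `γ` on the unit interval. -/
def IsLogLift (γ l : ℝ → ℂ) : Prop :=
  ContinuousOn l (Set.Icc 0 1) ∧ ∀ t ∈ Set.Icc (0 : ℝ) 1, Complex.exp (l t) = γ t

theorem exists_isLogLift {γ : ℝ → ℂ} (hγ : ContinuousOn γ (Set.Icc 0 1))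
    (h0 : ∀ t ∈ Set.Icc (0 : ℝ) 1, γ t ≠ 0) : ∃ l, IsLogLift γ l := by
  obtain ⟨g, hg⟩ := exists_continuous_log
    (⟨fun t => γ (Set.projIcc (0 : ℝ) 1 zero_le_one t), hγ.comp_continuous
      (continuous_subtype_val.comp continuous_projIcc) (fun t => Subtype.coe_prop _)⟩ : C(ℝ, ℂ))
    (fun t => h0 _ (Subtype.coe_prop _))
  refine ⟨g, g.continuous.continuousOn, fun t ht => ?_⟩
  simpa [Set.projIcc_of_mem zero_le_one ht] using hg t

open Classical in
/-- The variation of a continuous logarithm of `γ` along the unit interval. -/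
noncomputable def logVar (γ : ℝ → ℂ) : ℂ :=
  if h : ∃ l, IsLogLift γ l then h.choose 1 - h.choose 0 else 0

/-- Two lifts differ by a constant, so the choice made in `logVar` does not matter. -/
theorem IsLogLift.logVar_eq {γ l : ℝ → ℂ} (h : IsLogLift γ l) : logVar γ = l 1 - l 0 := by
  have hex : ∃ l, IsLogLift γ l := ⟨l, h⟩
  have hc := hex.choose_spec
  rw [logVar, dif_pos hex]
  have := sub_eq_sub_of_exp_eq isPreconnected_Icc hc.1 h.1
    (fun t ht => (hc.2 t ht).trans (h.2 t ht).symm) (x := (1 : ℝ)) (y := 0) (by simp) (by simp)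
  linear_combination this

theorem IsLogLift.mul {γ l γ' l' : ℝ → ℂ} (h : IsLogLift γ l) (h' : IsLogLift γ' l') :
    IsLogLift (fun t => γ t * γ' t) (fun t => l t + l' t) :=
  ⟨h.1.add h'.1, fun t ht => by rw [Complex.exp_add, h.2 t ht, h'.2 t ht]⟩

theorem IsLogLift.of_slitPlane {γ : ℝ → ℂ} (hγ : ContinuousOn γ (Set.Icc 0 1))
    (h0 : ∀ t ∈ Set.Icc (0 : ℝ) 1, γ t ∈ Complex.slitPlane) :
    IsLogLift γ (fun t => Complex.log (γ t)) :=
  ⟨hγ.clog h0, fun t ht => Complex.exp_log (Complex.slitPlane_ne_zero (h0 t ht))⟩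

theorem IsLogLift.congr {γ γ' l : ℝ → ℂ} (h : IsLogLift γ l)
    (hγ : ∀ t ∈ Set.Icc (0 : ℝ) 1, γ t = γ' t) : IsLogLift γ' l :=
  ⟨h.1, fun t ht => (h.2 t ht).trans (hγ t ht)⟩

/-- If the quotient of two curves has a known logarithm, so has the difference of their variations. -/
theorem logVar_eq_add_of_div {γ γ' l : ℝ → ℂ} (hγ : ContinuousOn γ (Set.Icc 0 1))
    (h0 : ∀ t ∈ Set.Icc (0 : ℝ) 1, γ t ≠ 0)
    (h : IsLogLift (fun t => γ' t / γ t) l) : logVar γ' = logVar γ + (l 1 - l 0) := by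
  obtain ⟨k, hk⟩ := exists_isLogLift hγ h0
  have := (hk.mul h).congr (γ' := γ') (fun t ht => mul_div_cancel₀ _ (h0 t ht))
  rw [this.logVar_eq, hk.logVar_eq]
  ring

/-- A point close to a base point in comparison with the distance from the base point to `a`. -/
theorem sub_div_sub_mem_slitPlane {a z z' : ℂ} (h : ‖z' - z‖ < ‖a - z‖) :
    (a - z') / (a - z) ∈ Complex.slitPlane := by
  have hne : a - z ≠ 0 := by
    rintro h0
    rw [h0, norm_zero] at h
    exact absurd h (norm_nonneg _).not_gt
  have h1 : (a - z') / (a - z) = 1 + -((z' - z) / (a - z)) := by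
    field_simp
    ring
  rw [h1]
  apply Complex.mem_slitPlane_of_norm_lt_one
  rw [norm_neg, norm_div, div_lt_one (norm_pos_iff.2 hne)]
  exact h

/-- The quotient of the two shifted curves stays in the slit plane, so its principal logarithm is a
lift. The correction depends only on the end points of the curve; this is what makes it cancel over
a circulation. -/
theorem logVar_sub_of_close {γ : ℝ → ℂ} (hγ : ContinuousOn γ (Set.Icc 0 1)) {z z' : ℂ}
    (h : ∀ t ∈ Set.Icc (0 : ℝ) 1, ‖z' - z‖ < ‖γ t - z‖) :
    logVar (fun t => γ t - z') = logVar (fun t => γ t - z) +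
      (Complex.log ((γ 1 - z') / (γ 1 - z)) - Complex.log ((γ 0 - z') / (γ 0 - z))) := by
  have h0 : ∀ t ∈ Set.Icc (0 : ℝ) 1, γ t - z ≠ 0 := fun t ht h0 => by
    have := h t ht
    rw [h0, norm_zero] at this
    exact absurd this (norm_nonneg _).not_gt
  exact logVar_eq_add_of_div (hγ.sub continuousOn_const) h0
    (IsLogLift.of_slitPlane ((hγ.sub continuousOn_const).div (hγ.sub continuousOn_const) h0)
      (fun t ht => sub_div_sub_mem_slitPlane (h t ht)))

/-- Far away points see no winding. -/
theorem logVar_sub_of_far {γ : ℝ → ℂ} (hγ : ContinuousOn γ (Set.Icc 0 1)) {z : ℂ}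
    (h : ∀ t ∈ Set.Icc (0 : ℝ) 1, ‖γ t‖ < ‖z‖) :
    logVar (fun t => γ t - z) =
      Complex.log ((γ 1 - z) / (-z)) - Complex.log ((γ 0 - z) / (-z)) := by
  have hz : -z ≠ 0 := fun h0 => by
    have := h 0 (by simp)
    rw [neg_eq_zero.1 h0, norm_zero] at this
    exact absurd this (norm_nonneg _).not_gt
  have hs : ∀ t ∈ Set.Icc (0 : ℝ) 1, (γ t - z) / (-z) ∈ Complex.slitPlane := fun t ht => by
    have h1 : (γ t - z) / (-z) = 1 + -(γ t / z) := by
      have : z ≠ 0 := neg_ne_zero.1 hz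
      field_simp
      ring
    rw [h1]
    apply Complex.mem_slitPlane_of_norm_lt_one
    rw [norm_neg, norm_div, div_lt_one (norm_pos_iff.2 (neg_ne_zero.1 hz))]
    exact h t ht
  have hc : IsLogLift (fun _ => -z) (fun _ => Complex.log (-z)) :=
    ⟨continuousOn_const, fun _ _ => Complex.exp_log hz⟩
  rw [logVar_eq_add_of_div (γ := fun _ => -z) (γ' := fun t => γ t - z) continuousOn_const
    (fun _ _ => hz)
    (IsLogLift.of_slitPlane ((hγ.sub continuousOn_const).div continuousOn_const
      (fun _ _ => hz)) hs), hc.logVar_eq]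
  ring

theorem exp_logVar {γ : ℝ → ℂ} (hγ : ContinuousOn γ (Set.Icc 0 1))
    (h0 : ∀ t ∈ Set.Icc (0 : ℝ) 1, γ t ≠ 0) : Complex.exp (logVar γ) = γ 1 / γ 0 := by
  obtain ⟨l, hl⟩ := exists_isLogLift hγ h0
  rw [hl.logVar_eq, Complex.exp_sub, hl.2 1 (by simp), hl.2 0 (by simp)]

/-! ### Crossing a curve at a point with a tangent -/

section Crossing

variable {g : ℝ → ℂ} {t₀ : ℝ}

/-- Near a point with derivative `1`, a curve runs from the left to the right, and the rest of the
curve keeps its distance. -/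
theorem exists_crossing_bounds (hg : ContinuousOn g (Set.Icc 0 1)) (hd : HasDerivAt g 1 t₀)
    (h0 : g t₀ = 0) (hinj : ∀ t ∈ Set.Icc (0 : ℝ) 1, t ≠ t₀ → g t ≠ 0) :
    ∃ η > 0, ∃ m > 0, (∀ t, t ≠ t₀ → |t - t₀| < η → 0 < (t - t₀) * (g t).re) ∧
      ∀ t ∈ Set.Icc (0 : ℝ) 1, η ≤ |t - t₀| → m ≤ ‖g t‖ := by
  -- Any constant below 1 would do: an error of at most `|t - t₀| / 2` leaves `re (g t)` with the
  -- sign of `t - t₀`.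
  have h1 := (hasDerivAt_iff_isLittleO.1 hd).def (c := 1 / 2) (by norm_num)
  obtain ⟨η, hη, h1⟩ := Metric.eventually_nhds_iff.1 h1
  have hK : IsCompact (Set.Icc (0 : ℝ) 1 ∩ {t | η ≤ |t - t₀|}) :=
    isCompact_Icc.inter_right (isClosed_le continuous_const (by fun_prop))
  have hm : ∃ m > 0, ∀ t ∈ Set.Icc (0 : ℝ) 1, η ≤ |t - t₀| → m ≤ ‖g t‖ := by
    rcases (Set.Icc (0 : ℝ) 1 ∩ {t | η ≤ |t - t₀|}).eq_empty_or_nonempty with he | hne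
    · refine ⟨1, one_pos, fun t ht ht' => ?_⟩
      exact absurd (show t ∈ Set.Icc (0 : ℝ) 1 ∩ {t | η ≤ |t - t₀|} from ⟨ht, ht'⟩) (by simp [he])
    · obtain ⟨s, hs, hmin⟩ := hK.exists_isMinOn hne
        ((hg.mono Set.inter_subset_left).norm)
      refine ⟨‖g s‖, norm_pos_iff.2 (hinj s hs.1 ?_), fun t ht ht' => hmin ⟨ht, ht'⟩⟩
      rintro rfl
      have := hs.2
      simp only [Set.mem_ofPred_eq, sub_self, abs_zero] at this
      exact absurd this hη.not_ge
  obtain ⟨m, hm, hm'⟩ := hm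
  refine ⟨η, hη, m, hm, fun t ht ht' => ?_, hm'⟩
  have h2 := h1 (y := t) (by rwa [Real.dist_eq])
  rw [h0, sub_zero] at h2
  have h3 : |(g t).re - (t - t₀)| ≤ 1 / 2 * |t - t₀| := by
    have := (Complex.abs_re_le_norm (g t - (t - t₀) • (1 : ℂ))).trans h2
    simpa using this
  have h4 : 0 < |t - t₀| := abs_pos.2 (sub_ne_zero.2 ht)
  rcases lt_or_gt_of_ne (sub_ne_zero.2 ht) with h5 | h5
  · rw [abs_of_neg h5] at h3
    have := (abs_le.1 h3).2
    nlinarith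
  · rw [abs_of_pos h5] at h3
    have := (abs_le.1 h3).1
    nlinarith

theorem re_add_mul_I_ne_zero {a : ℂ} {δ : ℝ} (h : a.re ≠ 0 ∨ δ < ‖a‖) (hδ : 0 < δ) :
    a - δ * Complex.I ≠ 0 ∧ a + δ * Complex.I ≠ 0 := by
  constructor
  · intro h0
    obtain rfl := sub_eq_zero.1 h0
    rcases h with h | h
    · simp at h
    · simp [abs_of_pos hδ] at h
  · intro h0
    obtain rfl := eq_neg_of_add_eq_zero_left h0
    rcases h with h | h
    · simp at h
    · simp [abs_of_pos hδ] at h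

theorem div_im_eq (a : ℂ) (δ : ℝ) : ((a - δ * Complex.I) / (a + δ * Complex.I)).im =
    -(2 * δ * a.re) / Complex.normSq (a + δ * Complex.I) := by
  rw [Complex.div_im]
  simp
  ring

theorem div_re_eq (a : ℂ) (δ : ℝ) : ((a - δ * Complex.I) / (a + δ * Complex.I)).re =
    (Complex.normSq a - δ ^ 2) / Complex.normSq (a + δ * Complex.I) := by
  rw [Complex.div_re, Complex.normSq_apply a]
  simp
  ring

/-- The quotient is real only for purely imaginary `a`, and then it is positive as soon as `a` lies
beyond `±δI`. -/
theorem div_mem_slitPlane {a : ℂ} {δ : ℝ} (h : a.re ≠ 0 ∨ δ < ‖a‖) (hδ : 0 < δ) :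
    (a - δ * Complex.I) / (a + δ * Complex.I) ∈ Complex.slitPlane := by
  have hN := Complex.normSq_pos.2 (re_add_mul_I_ne_zero h hδ).2
  rw [Complex.mem_slitPlane_iff, div_im_eq, div_re_eq]
  rcases h with h | h
  · right
    exact div_ne_zero (neg_ne_zero.2 (mul_ne_zero (mul_ne_zero two_ne_zero hδ.ne') h)) hN.ne'
  · left
    refine div_pos ?_ hN
    rw [Complex.normSq_eq_norm_sq]
    nlinarith

theorem log_eq_log_neg_add {a : ℂ} (h : 0 < a.im) :
    Complex.log a = Complex.log (-a) + Real.pi * Complex.I := by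
  rw [Complex.log, Complex.log, Complex.arg_neg_eq_arg_sub_pi_of_im_pos h, norm_neg]
  push_cast
  ring

theorem log_eq_log_neg_sub {a : ℂ} (h : a.im < 0) :
    Complex.log a = Complex.log (-a) - Real.pi * Complex.I := by
  rw [Complex.log, Complex.log, Complex.arg_neg_eq_arg_add_pi_of_im_neg h, norm_neg]
  push_cast
  ring

-- The curve meets the segment from `-δI` to `δI` only at `t₀`, going from negative to positive real
-- part. There the quotient passes through `-1` with its imaginary part turning from positive to
-- negative, so the principal logarithm loses `2πI` at the cut; adding `2πI` after `t₀` restores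
-- continuity.
open Classical in
theorem exists_isLogLift_crossing (hg : ContinuousOn g (Set.Icc 0 1)) (ht₀ : t₀ ∈ Set.Ioo (0 : ℝ) 1)
    (h0 : g t₀ = 0) {δ : ℝ} (hδ : 0 < δ) {η m : ℝ} (hη : 0 < η) (hδm : δ < m)
    (h1 : ∀ t, t ≠ t₀ → |t - t₀| < η → 0 < (t - t₀) * (g t).re)
    (h2 : ∀ t ∈ Set.Icc (0 : ℝ) 1, η ≤ |t - t₀| → m ≤ ‖g t‖) :
    ∃ l, IsLogLift (fun t => (g t - δ * Complex.I) / (g t + δ * Complex.I)) l ∧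
      l 1 - l 0 = Complex.log ((g 1 - δ * Complex.I) / (g 1 + δ * Complex.I)) -
        Complex.log ((g 0 - δ * Complex.I) / (g 0 + δ * Complex.I)) + 2 * Real.pi * Complex.I := by
  set ρ : ℝ → ℂ := fun t => (g t - δ * Complex.I) / (g t + δ * Complex.I) with hρ
  have hδ' : (δ : ℂ) ≠ 0 := by exact_mod_cast hδ.ne'
  have hcond : ∀ t ∈ Set.Icc (0 : ℝ) 1, t ≠ t₀ → (g t).re ≠ 0 ∨ δ < ‖g t‖ := by
    intro t ht htt
    rcases lt_or_ge (|t - t₀|) η with h | h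
    · left
      intro h3
      have := h1 t htt h
      rw [h3, mul_zero] at this
      exact lt_irrefl _ this
    · right
      exact hδm.trans_le (h2 t ht h)
  have hne : ∀ t ∈ Set.Icc (0 : ℝ) 1, g t + δ * Complex.I ≠ 0 := by
    intro t ht
    by_cases htt : t = t₀
    · rw [htt, h0, zero_add]
      exact mul_ne_zero hδ' Complex.I_ne_zero
    · exact (re_add_mul_I_ne_zero (hcond t ht htt) hδ).2
  have hρc : ContinuousOn ρ (Set.Icc 0 1) :=
    (hg.sub continuousOn_const).div (hg.add continuousOn_const) hne
  have hρ0 : ρ t₀ = -1 := by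
    simp only [hρ, h0, zero_sub, zero_add]
    rw [neg_div, div_self (mul_ne_zero hδ' Complex.I_ne_zero)]
  have hslit : ∀ t ∈ Set.Icc (0 : ℝ) 1, t ≠ t₀ → ρ t ∈ Complex.slitPlane :=
    fun t ht htt => div_mem_slitPlane (hcond t ht htt) hδ
  have him : ∀ t ∈ Set.Icc (0 : ℝ) 1, t ≠ t₀ → |t - t₀| < η → (t - t₀) * (ρ t).im < 0 := by
    intro t ht htt hlt
    simp only [hρ]
    rw [div_im_eq, mul_div_assoc']
    have := h1 t htt hlt
    refine div_neg_of_neg_of_pos ?_ (Complex.normSq_pos.2 (hne t ht))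
    nlinarith
  let l : ℝ → ℂ := fun t => if t < t₀ then Complex.log (ρ t) else
    if t₀ < t then Complex.log (ρ t) + 2 * Real.pi * Complex.I else Real.pi * Complex.I
  refine ⟨l, ⟨?_, ?_⟩, ?_⟩
  · intro t ht
    rcases lt_trichotomy t t₀ with h | rfl | h
    · have hc : ContinuousWithinAt (fun t => Complex.log (ρ t)) (Set.Icc 0 1) t :=
        (hρc t ht).clog (hslit t ht h.ne)
      refine hc.congr_of_eventuallyEq ?_ (by simp [l, h])
      filter_upwards [mem_nhdsWithin_of_mem_nhds (Iio_mem_nhds h)] with s hs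
      simp only [l, if_pos (Set.mem_Iio.1 hs)]
    · have hc : ContinuousWithinAt (fun t => Complex.log (-ρ t) + Real.pi * Complex.I)
          (Set.Icc 0 1) t :=
        ((hρc t ht).neg.clog (by rw [Pi.neg_apply, hρ0, neg_neg]; exact Complex.one_mem_slitPlane)).add
          continuousWithinAt_const
      refine hc.congr_of_eventuallyEq ?_ (by simp [l, hρ0])
      filter_upwards [mem_nhdsWithin_of_mem_nhds (Metric.ball_mem_nhds t hη),
        self_mem_nhdsWithin] with s hs hs'
      rw [Metric.mem_ball, Real.dist_eq] at hs
      rcases lt_trichotomy s t with h | rfl | h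
      · have := him s hs' h.ne hs
        simp only [l, if_pos h]
        exact log_eq_log_neg_add (by nlinarith)
      · simp [l, hρ0]
      · have := him s hs' h.ne' hs
        simp only [l, if_pos h, if_neg h.not_gt]
        rw [log_eq_log_neg_sub (by nlinarith)]
        ring
    · have hc : ContinuousWithinAt (fun t => Complex.log (ρ t) + 2 * Real.pi * Complex.I)
          (Set.Icc 0 1) t :=
        ((hρc t ht).clog (hslit t ht h.ne')).add continuousWithinAt_const
      refine hc.congr_of_eventuallyEq ?_ (by simp [l, h, h.not_gt])
      filter_upwards [mem_nhdsWithin_of_mem_nhds (Ioi_mem_nhds h)] with s hs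
      simp only [l, if_pos (Set.mem_Ioi.1 hs), if_neg (Set.mem_Ioi.1 hs).not_gt]
  · intro t ht
    rcases lt_trichotomy t t₀ with h | rfl | h
    · simp only [l, if_pos h]
      exact Complex.exp_log (Complex.slitPlane_ne_zero (hslit t ht h.ne))
    · simp only [l, lt_irrefl, if_false]
      exact Complex.exp_pi_mul_I.trans hρ0.symm
    · simp only [l, if_pos h, if_neg h.not_gt]
      rw [Complex.exp_add, Complex.exp_two_pi_mul_I, mul_one]
      exact Complex.exp_log (Complex.slitPlane_ne_zero (hslit t ht h.ne'))
  · simp only [l, if_pos ht₀.1, if_pos ht₀.2, if_neg ht₀.2.not_gt]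
    simp only [hρ]
    ring

end Crossing

/-- The jump of the variation of the logarithm when the base point crosses the curve. -/
theorem logVar_jump {γ : ℝ → ℂ} (hγ : ContinuousOn γ (Set.Icc 0 1)) {t₀ : ℝ}
    (ht₀ : t₀ ∈ Set.Ioo (0 : ℝ) 1) {d : ℂ} (hd0 : d ≠ 0) (hd : HasDerivAt γ d t₀)
    (hinj : ∀ t ∈ Set.Icc (0 : ℝ) 1, t ≠ t₀ → γ t ≠ γ t₀) :
    ∀ᶠ δ : ℝ in 𝓝[>] 0, (∀ t ∈ Set.Icc (0 : ℝ) 1, γ t ≠ γ t₀ + δ * (Complex.I * d)) ∧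
      (∀ t ∈ Set.Icc (0 : ℝ) 1, γ t ≠ γ t₀ - δ * (Complex.I * d)) ∧
      logVar (fun t => γ t - (γ t₀ + δ * (Complex.I * d))) =
        logVar (fun t => γ t - (γ t₀ - δ * (Complex.I * d))) +
        (Complex.log ((γ 1 - (γ t₀ + δ * (Complex.I * d))) / (γ 1 - (γ t₀ - δ * (Complex.I * d)))) -
          Complex.log ((γ 0 - (γ t₀ + δ * (Complex.I * d))) / (γ 0 - (γ t₀ - δ * (Complex.I * d))))
          + 2 * Real.pi * Complex.I) := by
  -- Normalising the tangent to 1 and the crossing point to 0 turns the two base points into `±δI`.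
  set g : ℝ → ℂ := fun t => (γ t - γ t₀) / d with hg
  have hgc : ContinuousOn g (Set.Icc 0 1) := (hγ.sub continuousOn_const).div_const d
  have hgd : HasDerivAt g 1 t₀ := by
    have := (hd.sub_const (γ t₀)).div_const d
    rwa [div_self hd0] at this
  have hg0 : g t₀ = 0 := by simp [hg]
  obtain ⟨η, hη, m, hm, h1, h2⟩ := exists_crossing_bounds hgc hgd hg0 (fun t ht htt => by
    simp only [hg]
    exact div_ne_zero (sub_ne_zero.2 (hinj t ht htt)) hd0)
  filter_upwards [self_mem_nhdsWithin, mem_nhdsWithin_of_mem_nhds (Iio_mem_nhds hm)] with δ hδ hδm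
  have hδ' : (δ : ℂ) ≠ 0 := by exact_mod_cast (ne_of_gt hδ)
  have hnum : ∀ t, γ t - (γ t₀ + δ * (Complex.I * d)) = d * (g t - δ * Complex.I) := fun t => by
    simp only [hg]
    field_simp
    ring
  have hden : ∀ t, γ t - (γ t₀ - δ * (Complex.I * d)) = d * (g t + δ * Complex.I) := fun t => by
    simp only [hg]
    field_simp
    ring
  have hne : ∀ t ∈ Set.Icc (0 : ℝ) 1, g t - δ * Complex.I ≠ 0 ∧ g t + δ * Complex.I ≠ 0 := by
    intro t ht
    by_cases htt : t = t₀
    · rw [htt, hg0, zero_add, zero_sub]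
      exact ⟨neg_ne_zero.2 (mul_ne_zero hδ' Complex.I_ne_zero),
        mul_ne_zero hδ' Complex.I_ne_zero⟩
    · refine re_add_mul_I_ne_zero ?_ hδ
      rcases lt_or_ge (|t - t₀|) η with h | h
      · left
        intro h3
        have := h1 t htt h
        rw [h3, mul_zero] at this
        exact lt_irrefl _ this
      · right
        exact lt_of_lt_of_le hδm (h2 t ht h)
  have hratio : ∀ t, (γ t - (γ t₀ + δ * (Complex.I * d))) / (γ t - (γ t₀ - δ * (Complex.I * d))) =
      (g t - δ * Complex.I) / (g t + δ * Complex.I) := fun t => by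
    rw [hnum, hden, mul_div_mul_left _ _ hd0]
  refine ⟨fun t ht h => (hne t ht).1 ?_, fun t ht h => (hne t ht).2 ?_, ?_⟩
  · have := hnum t
    rw [h, sub_self] at this
    exact (mul_eq_zero.1 this.symm).resolve_left hd0
  · have := hden t
    rw [h, sub_self] at this
    exact (mul_eq_zero.1 this.symm).resolve_left hd0
  · obtain ⟨l, hl, hl'⟩ := exists_isLogLift_crossing hgc ht₀ hg0 hδ hη hδm h1 h2
    rw [hratio, hratio, ← hl']
    refine logVar_eq_add_of_div (hγ.sub continuousOn_const) (fun t ht => ?_)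
      (hl.congr fun t _ => (hratio t).symm)
    rw [hden]
    exact mul_ne_zero hd0 (hne t ht).2

/-! ## Circulations on plane graphs and their winding numbers -/

/-- A circulation on a finite directed graph: an integral 1-cycle. It is expressed by duality with
functions on vertices. -/
def IsCirculation {E V : Type*} [Fintype E] (l r : E → V) (c : E → ℤ) : Prop :=
  ∀ φ : V → ℂ, ∑ e, (c e : ℂ) * (φ (r e) - φ (l e)) = 0

theorem IsCompact.exists_pos_le_norm_sub {K : Set ℂ} (hK : IsCompact K) {p : ℂ} (hp : p ∉ K) :
    ∃ m > 0, ∀ x ∈ K, m ≤ ‖x - p‖ := by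
  obtain ⟨m, hm, h⟩ := Metric.isOpen_iff.1 hK.isClosed.isOpen_compl p hp
  refine ⟨m, hm, fun x hx => ?_⟩
  by_contra! hlt
  exact h (Metric.mem_ball.2 (by rwa [dist_eq_norm])) hx

namespace PlaneGraph

variable {V : Type u} [Quiver.{v} V] (G : PlaneGraph V)

theorem isCompact_curve (e : Quiver.Total V) : IsCompact (G.curve e '' Set.Icc 0 1) :=
  isCompact_Icc.image_of_continuousOn (G.curve_continuous e)

theorem isCompact_carrier : IsCompact G.carrier := by
  have := G.finite_vertices
  have := G.finite_edges
  exact (Set.finite_range _).isCompact.union (isCompact_iUnion G.isCompact_curve)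

theorem curve_mem_carrier (e : Quiver.Total V) {t : ℝ} (ht : t ∈ Set.Icc (0 : ℝ) 1) :
    G.curve e t ∈ G.carrier :=
  Or.inr (Set.mem_iUnion.2 ⟨e, t, ht, rfl⟩)

theorem pos_mem_carrier (a : V) : G.pos a ∈ G.carrier := Or.inl ⟨a, rfl⟩

/-- A point of an arc is an interior point or an end point. -/
theorem curve_cases (e : Quiver.Total V) {t : ℝ} (ht : t ∈ Set.Icc (0 : ℝ) 1) :
    t ∈ Set.Ioo (0 : ℝ) 1 ∨ (t = 0 ∧ G.curve e t = G.pos e.left) ∨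
      (t = 1 ∧ G.curve e t = G.pos e.right) := by
  rcases ht.1.eq_or_lt with rfl | h0
  · exact Or.inr (Or.inl ⟨rfl, G.curve_zero e⟩)
  · rcases ht.2.eq_or_lt with rfl | h1
    · exact Or.inr (Or.inr ⟨rfl, G.curve_one e⟩)
    · exact Or.inl ⟨h0, h1⟩

theorem curve_interior_eq {e e' : Quiver.Total V} {t t' : ℝ} (ht : t ∈ Set.Ioo (0 : ℝ) 1)
    (ht' : t' ∈ Set.Icc (0 : ℝ) 1) (h : G.curve e' t' = G.curve e t) : e' = e ∧ t' = t := by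
  rcases G.curve_cases e' ht' with h' | ⟨-, h'⟩ | ⟨-, h'⟩
  · exact G.curve_inj e' e t' h' t ht h
  · exact absurd (h.symm.trans h') (G.curve_ne_pos e t ht _)
  · exact absurd (h.symm.trans h') (G.curve_ne_pos e t ht _)

theorem curve_interior_notMem {e e' : Quiver.Total V} {t : ℝ} (ht : t ∈ Set.Ioo (0 : ℝ) 1)
    (h : e' ≠ e) : G.curve e t ∉ G.curve e' '' Set.Icc 0 1 := by
  rintro ⟨t', ht', h'⟩
  exact h (G.curve_interior_eq ht ht' h').1

/-- The part of the plane occupied by the edges of a circulation. -/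
def trace (c : Quiver.Total V → ℤ) : Set ℂ := ⋃ e ∈ {e | c e ≠ 0}, G.curve e '' Set.Icc 0 1

theorem trace_subset_carrier (c : Quiver.Total V → ℤ) : G.trace c ⊆ G.carrier :=
  Set.iUnion₂_subset fun e _ => by
    rintro _ ⟨t, ht, rfl⟩
    exact G.curve_mem_carrier e ht

theorem notMem_trace {c : Quiver.Total V → ℤ} {z : ℂ} :
    z ∉ G.trace c ↔ ∀ e, c e ≠ 0 → z ∉ G.curve e '' Set.Icc 0 1 := by
  simp only [trace, Set.mem_iUnion, not_exists]
  exact Iff.rfl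

/-- The variation of the logarithm of `curve e - z`. -/
noncomputable def edgeVar (e : Quiver.Total V) (z : ℂ) : ℂ := logVar fun t => G.curve e t - z

/-- The points next to an edge do not lie on the graph. -/
theorem side_notMem_carrier (e : Quiver.Total V) {t : ℝ} (ht : t ∈ Set.Ioo (0 : ℝ) 1)
    {d : ℂ} (hd0 : d ≠ 0) (hd : HasDerivAt (G.curve e) d t) :
    ∀ᶠ δ : ℝ in 𝓝[>] 0, G.curve e t + δ * (Complex.I * d) ∉ G.carrier ∧
      G.curve e t - δ * (Complex.I * d) ∉ G.carrier := by
  have := G.finite_vertices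
  have := G.finite_edges
  have hj := logVar_jump (G.curve_continuous e) ht hd0 hd
    (fun s hs hst h => hst (G.curve_interior_eq ht hs h).2)
  have hK : IsCompact (Set.range G.pos ∪ ⋃ e' ∈ {e' | e' ≠ e}, G.curve e' '' Set.Icc 0 1) :=
    (Set.finite_range _).isCompact.union
      ((Set.toFinite _).isCompact_biUnion fun e' _ => G.isCompact_curve e')
  have hp : G.curve e t ∉ Set.range G.pos ∪ ⋃ e' ∈ {e' | e' ≠ e}, G.curve e' '' Set.Icc 0 1 := by
    rintro (⟨a, ha⟩ | h)
    · exact G.curve_ne_pos e t ht a ha.symm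
    · obtain ⟨e', he', h⟩ := Set.mem_iUnion₂.1 h
      exact G.curve_interior_notMem ht he' h
  have hlim : ∀ s : ℂ, Filter.Tendsto (fun δ : ℝ => G.curve e t + δ * s) (𝓝[>] 0)
      (𝓝 (G.curve e t)) := by
    intro s
    have : Continuous fun δ : ℝ => G.curve e t + δ * s := by fun_prop
    simpa using (this.tendsto 0).mono_left nhdsWithin_le_nhds
  have hK' := hK.isClosed.isOpen_compl.mem_nhds hp
  have key : ∀ z, (∀ s ∈ Set.Icc (0 : ℝ) 1, G.curve e s ≠ z) →
      z ∉ Set.range G.pos ∪ ⋃ e' ∈ {e' | e' ≠ e}, G.curve e' '' Set.Icc 0 1 →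
      z ∉ G.carrier := by
    rintro z hz hz' (h | h)
    · exact hz' (Or.inl h)
    · obtain ⟨e', h⟩ := Set.mem_iUnion.1 h
      by_cases he : e' = e
      · subst he
        obtain ⟨s, hs, h⟩ := h
        exact hz s hs h
      · exact hz' (Or.inr (Set.mem_iUnion₂.2 ⟨e', he, h⟩))
  filter_upwards [hj, (hlim (Complex.I * d)).eventually hK',
    (hlim (-(Complex.I * d))).eventually hK'] with δ h1 h2 h3
  refine ⟨key _ h1.1 h2, key _ h1.2.1 ?_⟩
  rwa [mul_neg, ← sub_eq_add_neg] at h3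

/-! ### Winding numbers of circulations. -/

variable [Fintype (Quiver.Total V)]

/-- The winding number of a circulation around a point. -/
noncomputable def winding (c : Quiver.Total V → ℤ) (z : ℂ) : ℂ :=
  (∑ e, (c e : ℂ) * G.edgeVar e z) / (2 * Real.pi * Complex.I)

abbrev IsCirc (c : Quiver.Total V → ℤ) : Prop :=
  IsCirculation (Quiver.Total.left (V := V)) Quiver.Total.right c

variable {G} {c : Quiver.Total V → ℤ}

/-- The coboundary of `φ` pairs to zero with a circulation, so only the part `k` of the change
survives. Local constancy uses `k = 0`; the jump uses `k = 2πI` on the edge that is crossed. -/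
theorem winding_eq_of_edgeVar (hc : IsCirc c) (φ : V → ℂ) (k : Quiver.Total V → ℂ) {z z' : ℂ}
    (h : ∀ e, c e ≠ 0 → G.edgeVar e z' = G.edgeVar e z + (φ e.right - φ e.left + k e)) :
    G.winding c z' = G.winding c z + (∑ e, (c e : ℂ) * k e) / (2 * Real.pi * Complex.I) := by
  rw [winding, winding, ← add_div]
  congr 1
  have h' : ∀ e, (c e : ℂ) * G.edgeVar e z' =
      (c e : ℂ) * G.edgeVar e z + (c e : ℂ) * (φ e.right - φ e.left) + (c e : ℂ) * k e := by
    intro e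
    by_cases hce : c e = 0
    · simp [hce]
    · rw [h e hce]
      ring
  rw [Finset.sum_congr rfl fun e _ => h' e, Finset.sum_add_distrib, Finset.sum_add_distrib, hc φ,
    add_zero]

theorem winding_eventually_eq (hc : IsCirc c) {z : ℂ} (hz : z ∉ G.trace c) :
    ∀ᶠ z' in 𝓝 z, G.winding c z' = G.winding c z := by
  have h : ∀ e, ∀ᶠ z' in 𝓝 z, c e ≠ 0 →
      ∀ t ∈ Set.Icc (0 : ℝ) 1, ‖z' - z‖ < ‖G.curve e t - z‖ := by
    intro e
    by_cases hce : c e = 0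
    · simp [hce]
    obtain ⟨m, hm, hm'⟩ := (G.isCompact_curve e).exists_pos_le_norm_sub
      (G.notMem_trace.1 hz e hce)
    filter_upwards [Metric.ball_mem_nhds z hm] with z' hz' _ t ht
    rw [Metric.mem_ball, dist_eq_norm] at hz'
    exact hz'.trans_le (hm' _ ⟨t, ht, rfl⟩)
  filter_upwards [Filter.eventually_all.2 h] with z' hz'
  have := winding_eq_of_edgeVar (G := G) hc (fun a => Complex.log ((G.pos a - z') / (G.pos a - z)))
    (fun _ => 0) (z := z) (z' := z') (fun e hce => by
      rw [edgeVar, edgeVar, logVar_sub_of_close (G.curve_continuous e) (hz' e hce),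
        G.curve_one, G.curve_zero, add_zero])
  simpa using this

theorem winding_eq_of_isPreconnected (hc : IsCirc c) {s : Set ℂ} (hs : IsPreconnected s)
    (hsc : Disjoint s (G.trace c)) {z z' : ℂ} (hz : z ∈ s) (hz' : z' ∈ s) :
    G.winding c z = G.winding c z' := by
  have : PreconnectedSpace s := isPreconnected_iff_preconnectedSpace.1 hs
  have : IsLocallyConstant (fun x : s => G.winding c x) := by
    rw [IsLocallyConstant.iff_eventually_eq]
    intro x
    exact continuous_subtype_val.continuousAt.eventually
      (winding_eventually_eq hc (Set.disjoint_left.1 hsc x.2))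
  exact this.apply_eq_of_preconnectedSpace ⟨z, hz⟩ ⟨z', hz'⟩

/-- Along each edge the variation differs from the coboundary of a principal logarithm by an
integral multiple of `2πI`. -/
theorem winding_integral (hc : IsCirc c) {z : ℂ} (hz : z ∉ G.carrier) :
    ∃ n : ℤ, G.winding c z = n := by
  have h : ∀ e, ∃ k : ℤ, G.edgeVar e z = Complex.log (G.pos e.right - z) -
      Complex.log (G.pos e.left - z) + k * (2 * Real.pi * Complex.I) := by
    intro e
    rw [← Complex.exp_eq_exp_iff_exists_int, edgeVar, exp_logVar
      (γ := fun t => G.curve e t - z) ((G.curve_continuous e).sub continuousOn_const), Complex.exp_sub, G.curve_one, G.curve_zero,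
      Complex.exp_log, Complex.exp_log]
    · exact fun h => hz (sub_eq_zero.1 h ▸ G.pos_mem_carrier _)
    · exact fun h => hz (sub_eq_zero.1 h ▸ G.pos_mem_carrier _)
    · exact fun t ht h => hz (sub_eq_zero.1 h ▸ G.curve_mem_carrier e ht)
  choose k hk using h
  refine ⟨∑ e, c e * k e, ?_⟩
  rw [winding, div_eq_iff Complex.two_pi_I_ne_zero]
  have h' : ∀ e, (c e : ℂ) * G.edgeVar e z = (c e : ℂ) * (Complex.log (G.pos e.right - z) -
      Complex.log (G.pos e.left - z)) + (c e : ℂ) * k e * (2 * Real.pi * Complex.I) := by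
    intro e
    rw [hk]
    ring
  rw [Finset.sum_congr rfl fun e _ => h' e, Finset.sum_add_distrib,
    hc (fun a => Complex.log (G.pos a - z)), zero_add, ← Finset.sum_mul]
  push_cast
  rfl

theorem winding_eq_zero_of_far (hc : IsCirc c) {z : ℂ} (h : ∀ x ∈ G.carrier, ‖x‖ < ‖z‖) :
    G.winding c z = 0 := by
  have h' : ∀ e, G.edgeVar e z = Complex.log ((G.pos e.right - z) / (-z)) -
      Complex.log ((G.pos e.left - z) / (-z)) := by
    intro e
    rw [edgeVar, logVar_sub_of_far (G.curve_continuous e)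
      (fun t ht => h _ (G.curve_mem_carrier e ht)), G.curve_one, G.curve_zero]
  rw [winding, Finset.sum_congr rfl fun e _ => by rw [h' e],
    hc (fun a => Complex.log ((G.pos a - z) / (-z))), zero_div]

/-- Crossing an edge from the right to the left changes the winding number by the multiplicity of
the edge. -/
theorem winding_jump (hc : IsCirc c) (e : Quiver.Total V) {t : ℝ} (ht : t ∈ Set.Ioo (0 : ℝ) 1)
    {d : ℂ} (hd0 : d ≠ 0) (hd : HasDerivAt (G.curve e) d t) :
    ∀ᶠ δ : ℝ in 𝓝[>] 0, G.winding c (G.curve e t + δ * (Complex.I * d)) =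
      G.winding c (G.curve e t - δ * (Complex.I * d)) + c e := by
  classical
  have h : ∀ e', ∀ᶠ δ : ℝ in 𝓝[>] 0, e' ≠ e → ∀ s ∈ Set.Icc (0 : ℝ) 1,
      ‖(G.curve e t + δ * (Complex.I * d)) - (G.curve e t - δ * (Complex.I * d))‖ <
        ‖G.curve e' s - (G.curve e t - δ * (Complex.I * d))‖ := by
    intro e'
    by_cases he : e' = e
    · simp [he]
    obtain ⟨m, hm, hm'⟩ := (G.isCompact_curve e').exists_pos_le_norm_sub
      (G.curve_interior_notMem ht he)
    -- The two points are `2δ‖d‖` apart, and measuring distances from one of them instead of the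
    -- crossing point costs another `δ‖d‖`; hence the factor 3.
    have hlim : Filter.Tendsto (fun δ : ℝ => 3 * (δ * ‖d‖)) (𝓝[>] 0) (𝓝 0) := by
      have : Continuous fun δ : ℝ => 3 * (δ * ‖d‖) := by fun_prop
      simpa using (this.tendsto 0).mono_left nhdsWithin_le_nhds
    filter_upwards [hlim.eventually_lt_const hm, self_mem_nhdsWithin] with δ hδ hδ0 _ s hs
    have h1 := hm' _ ⟨s, hs, rfl⟩
    have hn : ‖(δ : ℂ) * (Complex.I * d)‖ = δ * ‖d‖ := by
      rw [norm_mul, norm_mul, Complex.norm_I, one_mul, Complex.norm_real, Real.norm_eq_abs,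
        abs_of_pos hδ0]
    have h2 : ‖G.curve e' s - G.curve e t‖ ≤
        ‖G.curve e' s - (G.curve e t - δ * (Complex.I * d))‖ + δ * ‖d‖ := by
      rw [← hn]
      refine le_trans (le_of_eq ?_) (norm_sub_le _ _)
      congr 1
      ring
    have h3 : ‖(G.curve e t + δ * (Complex.I * d)) - (G.curve e t - δ * (Complex.I * d))‖ ≤
        δ * ‖d‖ + δ * ‖d‖ := by
      rw [← hn]
      refine le_trans (le_of_eq ?_) (norm_add_le _ _)
      congr 1
      ring
    linarith
  have hj := logVar_jump (G.curve_continuous e) ht hd0 hd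
    (fun s hs hst h => hst (G.curve_interior_eq ht hs h).2)
  filter_upwards [Filter.eventually_all.2 h, hj] with δ hδ hδ'
  rw [winding_eq_of_edgeVar (G := G) hc
    (fun a => Complex.log ((G.pos a - (G.curve e t + δ * (Complex.I * d))) /
      (G.pos a - (G.curve e t - δ * (Complex.I * d)))))
    (fun e' => if e' = e then 2 * Real.pi * Complex.I else 0)
    (z := G.curve e t - δ * (Complex.I * d))]
  · congr 1
    rw [div_eq_iff Complex.two_pi_I_ne_zero]
    simp
  · intro e' _
    by_cases he : e' = e
    · subst he
      rw [if_pos rfl, edgeVar, edgeVar, hδ'.2.2, G.curve_one, G.curve_zero]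
    · rw [if_neg he, add_zero, edgeVar, edgeVar, logVar_sub_of_close (G.curve_continuous e')
        (hδ e' he), G.curve_one, G.curve_zero]

end PlaneGraph

/-! ### Faces -/

namespace PlaneGraph

variable {V : Type u} [Quiver.{v} V] (G : PlaneGraph V)

/-- The bounded faces. -/
abbrev InteriorFace : Type := {F : Set ℂ // G.IsInteriorFace F}

/-- The faces, the exterior one being `none`. -/
def faceSet : Option G.InteriorFace → Set ℂ
  | none => G.exteriorFace
  | some F => F.1

theorem mem_faceSet_some {F : G.InteriorFace} {z : ℂ} (hz : z ∈ F.1) :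
    z ∈ G.carrierᶜ ∧ F.1 = connectedComponentIn G.carrierᶜ z := by
  obtain ⟨⟨w, hw, hF⟩, -⟩ := F.2
  rw [hF] at hz ⊢
  exact ⟨connectedComponentIn_subset _ _ hz, connectedComponentIn_eq hz⟩

theorem mem_faceSet_iff {X : Option G.InteriorFace} {z : ℂ} :
    z ∈ G.faceSet X ↔ z ∈ G.carrierᶜ ∧
      (∀ F ∈ X, F.1 = connectedComponentIn G.carrierᶜ z) ∧
      (X = none → ¬ Bornology.IsBounded (connectedComponentIn G.carrierᶜ z)) := by
  cases X with
  | none => simp [faceSet, exteriorFace]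
  | some F =>
    simp only [faceSet, Option.mem_def, Option.some.injEq, forall_eq', reduceCtorEq,
      false_implies, and_true]
    refine ⟨G.mem_faceSet_some, fun h => ?_⟩
    rw [h.2]
    exact mem_connectedComponentIn h.1

theorem faceSet_subset (X : Option G.InteriorFace) : G.faceSet X ⊆ G.carrierᶜ :=
  fun _ hz => (G.mem_faceSet_iff.1 hz).1

theorem exists_mem_faceSet {z : ℂ} (hz : z ∉ G.carrier) : ∃ X, z ∈ G.faceSet X := by
  by_cases h : Bornology.IsBounded (connectedComponentIn G.carrierᶜ z)
  · exact ⟨some ⟨connectedComponentIn G.carrierᶜ z, ⟨z, hz, rfl⟩, h⟩,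
      mem_connectedComponentIn hz⟩
  · exact ⟨none, hz, h⟩

theorem eq_of_mem_faceSet {X Y : Option G.InteriorFace} {z : ℂ} (hX : z ∈ G.faceSet X)
    (hY : z ∈ G.faceSet Y) : X = Y := by
  rw [mem_faceSet_iff] at hX hY
  cases X with
  | none =>
    cases Y with
    | none => rfl
    | some F => exact absurd (hY.2.1 F rfl ▸ F.2.2) (hX.2.2 rfl)
  | some F =>
    cases Y with
    | none => exact absurd (hX.2.1 F rfl ▸ F.2.2) (hY.2.2 rfl)
    | some F' => exact congrArg some (Subtype.ext ((hX.2.1 F rfl).trans (hY.2.1 F' rfl).symm))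

theorem subset_faceSet {X : Option G.InteriorFace} {s : Set ℂ} (hs : IsPreconnected s)
    (hsG : s ⊆ G.carrierᶜ) {z : ℂ} (hz : z ∈ s) (hX : z ∈ G.faceSet X) : s ⊆ G.faceSet X := by
  intro w hw
  have := connectedComponentIn_eq (hs.subset_connectedComponentIn hz hsG hw)
  rw [mem_faceSet_iff] at hX ⊢
  exact ⟨hsG hw, this ▸ hX.2⟩

theorem isOpen_face (F : G.InteriorFace) : IsOpen F.1 := by
  obtain ⟨⟨w, hw, hF⟩, -⟩ := F.2
  rw [hF]
  exact G.isCompact_carrier.isClosed.isOpen_compl.connectedComponentIn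

/-- A point of a bounded face. -/
noncomputable def facePt (F : G.InteriorFace) : ℂ := F.2.1.choose

theorem facePt_mem (F : G.InteriorFace) : G.facePt F ∈ F.1 := by
  have h := F.2.1.choose_spec
  exact (congrArg (G.facePt F ∈ ·) h.2).mpr (mem_connectedComponentIn h.1)

theorem facePt_notMem (F : G.InteriorFace) : G.facePt F ∉ G.carrier :=
  (G.mem_faceSet_some (G.facePt_mem F)).1

/-! ### The faces beside an edge, seen at one tangent. -/

/-- The points immediately to the left of `e` at the tangent `d` at time `t` lie in the face. -/
def LeftAt (e : Quiver.Total V) (t : ℝ) (d : ℂ) (X : Option G.InteriorFace) : Prop :=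
  ∀ᶠ δ : ℝ in 𝓝[>] 0, G.curve e t + δ * (Complex.I * d) ∈ G.faceSet X

/-- The points immediately to the right of `e` at the tangent `d` at time `t` lie in the face. -/
def RightAt (e : Quiver.Total V) (t : ℝ) (d : ℂ) (X : Option G.InteriorFace) : Prop :=
  ∀ᶠ δ : ℝ in 𝓝[>] 0, G.curve e t - δ * (Complex.I * d) ∈ G.faceSet X

variable {G}

/-- A short open segment that avoids the graph is connected, so it stays in a single face. -/
theorem exists_eventually_mem_faceSet {p s : ℂ} (h : ∀ᶠ δ : ℝ in 𝓝[>] 0, p + δ * s ∉ G.carrier) :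
    ∃ X, ∀ᶠ δ : ℝ in 𝓝[>] 0, p + δ * s ∈ G.faceSet X := by
  obtain ⟨ε, hε, hs⟩ := mem_nhdsGT_iff_exists_Ioo_subset.1 h
  have hε' : (0 : ℝ) < ε := hε
  have hpre : IsPreconnected ((fun δ : ℝ => p + δ * s) '' Set.Ioo 0 ε) :=
    isPreconnected_Ioo.image _ (by fun_prop)
  have hsub : (fun δ : ℝ => p + δ * s) '' Set.Ioo 0 ε ⊆ G.carrierᶜ := by
    rintro _ ⟨δ, hδ, rfl⟩
    exact hs hδ
  have hmem : ε / 2 ∈ Set.Ioo 0 ε := ⟨by linarith, by linarith⟩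
  obtain ⟨X, hX⟩ := G.exists_mem_faceSet (hs hmem)
  refine ⟨X, ?_⟩
  filter_upwards [Ioo_mem_nhdsGT hε'] with δ hδ
  exact G.subset_faceSet hpre hsub ⟨_, hmem, rfl⟩ hX ⟨δ, hδ, rfl⟩

theorem exists_leftAt (e : Quiver.Total V) {t : ℝ} (ht : t ∈ Set.Ioo (0 : ℝ) 1)
    {d : ℂ} (hd0 : d ≠ 0) (hd : HasDerivAt (G.curve e) d t) : ∃ X, G.LeftAt e t d X :=
  exists_eventually_mem_faceSet ((G.side_notMem_carrier e ht hd0 hd).mono fun _ h => h.1)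

theorem exists_rightAt (e : Quiver.Total V) {t : ℝ} (ht : t ∈ Set.Ioo (0 : ℝ) 1)
    {d : ℂ} (hd0 : d ≠ 0) (hd : HasDerivAt (G.curve e) d t) : ∃ X, G.RightAt e t d X := by
  obtain ⟨X, hX⟩ := exists_eventually_mem_faceSet (G := G) (p := G.curve e t)
    (s := -(Complex.I * d)) ((G.side_notMem_carrier e ht hd0 hd).mono fun δ h => by
      rw [mul_neg, ← sub_eq_add_neg]
      exact h.2)
  refine ⟨X, hX.mono fun δ h => ?_⟩
  rwa [mul_neg, ← sub_eq_add_neg] at h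

theorem LeftAt.unique {e : Quiver.Total V} {t : ℝ} {d : ℂ} {X Y : Option G.InteriorFace}
    (hX : G.LeftAt e t d X) (hY : G.LeftAt e t d Y) : X = Y := by
  obtain ⟨δ, h1, h2⟩ := (hX.and hY).exists
  exact G.eq_of_mem_faceSet h1 h2

theorem RightAt.unique {e : Quiver.Total V} {t : ℝ} {d : ℂ} {X Y : Option G.InteriorFace}
    (hX : G.RightAt e t d X) (hY : G.RightAt e t d Y) : X = Y := by
  obtain ⟨δ, h1, h2⟩ := (hX.and hY).exists
  exact G.eq_of_mem_faceSet h1 h2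

variable [Fintype (Quiver.Total V)] {c : Quiver.Total V → ℤ}

variable (G) in
open Classical in
/-- The winding number of a circulation around a face. -/
noncomputable def faceWinding (c : Quiver.Total V → ℤ) (X : Option G.InteriorFace) : ℤ :=
  X.elim 0 fun F => if h : ∃ n : ℤ, G.winding c (G.facePt F) = n then h.choose else 0

theorem faceWinding_none : G.faceWinding c none = 0 := rfl

theorem winding_facePt (hc : IsCirc c) (F : G.InteriorFace) :
    G.winding c (G.facePt F) = G.faceWinding c (some F) := by
  have h := winding_integral (G := G) hc (G.facePt_notMem F)
  simp only [faceWinding, Option.elim_some, dif_pos h]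
  exact h.choose_spec

/-- The component of `z` is connected and avoids the trace. For `none` no uniqueness of the
unbounded component is needed: each such component contains points farther out than the whole graph,
where nothing winds. -/
theorem winding_eq_faceWinding (hc : IsCirc c) {X : Option G.InteriorFace} {z : ℂ}
    (hz : z ∈ G.faceSet X) : G.winding c z = G.faceWinding c X := by
  have hdisj : ∀ w, Disjoint (connectedComponentIn G.carrierᶜ w) (G.trace c) := fun w =>
    (disjoint_compl_left.mono_left (connectedComponentIn_subset _ _)).mono_right
      (G.trace_subset_carrier c)
  cases X with
  | some F =>
    have hF := (G.mem_faceSet_some hz).2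
    rw [← winding_facePt hc]
    refine winding_eq_of_isPreconnected hc isPreconnected_connectedComponentIn (hdisj z) ?_ ?_
    · exact mem_connectedComponentIn (G.faceSet_subset _ hz)
    · rw [← hF]
      exact G.facePt_mem F
  | none =>
    rw [faceWinding_none, Int.cast_zero]
    obtain ⟨R, hR⟩ := G.isCompact_carrier.isBounded.exists_norm_le
    obtain ⟨w, hw, hwR⟩ : ∃ w ∈ connectedComponentIn G.carrierᶜ z, R < ‖w‖ := by
      by_contra! hcon
      exact hz.2 (isBounded_iff_forall_norm_le.2 ⟨R, hcon⟩)
    rw [winding_eq_of_isPreconnected hc isPreconnected_connectedComponentIn (hdisj z)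
      (mem_connectedComponentIn hz.1) hw]
    exact winding_eq_zero_of_far hc fun x hx => (hR x hx).trans_lt hwR

theorem faceWinding_jump (hc : IsCirc c) {e : Quiver.Total V} {t : ℝ}
    (ht : t ∈ Set.Ioo (0 : ℝ) 1) {d : ℂ} (hd0 : d ≠ 0) (hd : HasDerivAt (G.curve e) d t)
    {X Y : Option G.InteriorFace} (hX : G.LeftAt e t d X) (hY : G.RightAt e t d Y) :
    G.faceWinding c X = G.faceWinding c Y + c e := by
  obtain ⟨δ, h1, h2, h3⟩ := (hX.and (hY.and (winding_jump (G := G) hc e ht hd0 hd))).exists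
  rw [winding_eq_faceWinding hc h1, winding_eq_faceWinding hc h2] at h3
  exact_mod_cast h3

/-- Next to an edge outside a circulation, the winding number is that of the points of the edge. -/
theorem winding_curve_eq (hc : IsCirc c) {e : Quiver.Total V} (hce : c e = 0) {t : ℝ}
    (ht : t ∈ Set.Ioo (0 : ℝ) 1) {d : ℂ} {X : Option G.InteriorFace} (hX : G.LeftAt e t d X) :
    G.winding c (G.curve e t) = G.faceWinding c X := by
  have hlim : Filter.Tendsto (fun δ : ℝ => G.curve e t + δ * (Complex.I * d)) (𝓝[>] 0)
      (𝓝 (G.curve e t)) := by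
    have : Continuous fun δ : ℝ => G.curve e t + δ * (Complex.I * d) := by fun_prop
    simpa using (this.tendsto 0).mono_left nhdsWithin_le_nhds
  have hz : G.curve e t ∉ G.trace c := G.notMem_trace.2 fun e' he' =>
    G.curve_interior_notMem ht (fun h => he' (h ▸ hce))
  obtain ⟨δ, h1, h2⟩ := (hX.and (hlim.eventually (winding_eventually_eq hc hz))).exists
  rw [← h2, winding_eq_faceWinding hc h1]

/-- The open arc of an edge that `c` does not use is a connected set off the trace, so the winding
number is constant on it. -/
theorem faceWinding_eq_along (hc : IsCirc c) {e : Quiver.Total V} (hce : c e = 0) {t t' : ℝ}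
    (ht : t ∈ Set.Ioo (0 : ℝ) 1) (ht' : t' ∈ Set.Ioo (0 : ℝ) 1) {d d' : ℂ}
    {X X' : Option G.InteriorFace} (hX : G.LeftAt e t d X) (hX' : G.LeftAt e t' d' X') :
    G.faceWinding c X = G.faceWinding c X' := by
  have h : G.winding c (G.curve e t) = G.winding c (G.curve e t') := by
    refine winding_eq_of_isPreconnected hc (isPreconnected_Ioo.image (G.curve e)
      ((G.curve_continuous e).mono Set.Ioo_subset_Icc_self)) ?_ ⟨t, ht, rfl⟩ ⟨t', ht', rfl⟩
    rw [Set.disjoint_left]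
    rintro _ ⟨s, hs, rfl⟩
    exact G.notMem_trace.2 fun e' he' =>
      G.curve_interior_notMem hs (fun h => he' (h ▸ hce))
  rw [winding_curve_eq hc hce ht hX, winding_curve_eq hc hce ht' hX'] at h
  exact_mod_cast h

/-- At a vertex outside a circulation, all adjacent faces have the same winding number. -/
theorem winding_pos_eq (hc : IsCirc c) {a : V} (ha : ∀ e : Quiver.Total V,
    e.left = a ∨ e.right = a → c e = 0) {e : Quiver.Total V} (he : e.left = a ∨ e.right = a) {t : ℝ}
    (ht : t ∈ Set.Ioo (0 : ℝ) 1) {d : ℂ} {X : Option G.InteriorFace} (hX : G.LeftAt e t d X) :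
    G.winding c (G.pos a) = G.faceWinding c X := by
  rw [← winding_curve_eq hc (ha e he) ht hX]
  have hpos : G.pos a ∉ G.trace c := by
    refine G.notMem_trace.2 ?_
    rintro e' he' ⟨s, hs, h⟩
    rcases G.curve_cases e' hs with h' | ⟨-, h'⟩ | ⟨-, h'⟩
    · exact G.curve_ne_pos e' s h' a h
    · exact he' (ha e' (Or.inl (G.pos_injective (h'.symm.trans h))))
    · exact he' (ha e' (Or.inr (G.pos_injective (h'.symm.trans h))))
  have hint : ∀ s ∈ Set.Ioo (0 : ℝ) 1, G.curve e s ∉ G.trace c := fun s hs =>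
    G.notMem_trace.2 fun e' he' => G.curve_interior_notMem hs (fun h => he' (h ▸ ha e he))
  rcases he with he | he
  · have h0 : G.curve e 0 = G.pos a := by rw [G.curve_zero, he]
    refine winding_eq_of_isPreconnected hc (isPreconnected_Ico.image (G.curve e)
      ((G.curve_continuous e).mono Set.Ico_subset_Icc_self)) ?_
      ⟨0, ⟨le_rfl, one_pos⟩, h0⟩ ⟨t, ⟨ht.1.le, ht.2⟩, rfl⟩
    rw [Set.disjoint_left]
    rintro _ ⟨s, hs, rfl⟩
    rcases hs.1.eq_or_lt with rfl | hs0
    · rwa [h0]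
    · exact hint s ⟨hs0, hs.2⟩
  · have h1 : G.curve e 1 = G.pos a := by rw [G.curve_one, he]
    refine winding_eq_of_isPreconnected hc (isPreconnected_Ioc.image (G.curve e)
      ((G.curve_continuous e).mono Set.Ioc_subset_Icc_self)) ?_
      ⟨1, ⟨one_pos, le_rfl⟩, h1⟩ ⟨t, ⟨ht.1, ht.2.le⟩, rfl⟩
    rw [Set.disjoint_left]
    rintro _ ⟨s, hs, rfl⟩
    rcases hs.2.eq_or_lt with rfl | hs1
    · rwa [h1]
    · exact hint s ⟨hs.1, hs1⟩

end PlaneGraph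

/-! ### Independence of the winding numbers around the bounded faces -/

/-- A function that has a continuous logarithm on the boundary of a bounded open set does not wind
around any point of that set. -/
theorem order_eq_zero_of_log_on_frontier {U : Set ℂ} (hU : IsOpen U) (hb : Bornology.IsBounded U)
    {p : ℂ} (hp : p ∈ U) {n : ℤ} {h : ℂ → ℂ} (hc : ContinuousOn h (closure U))
    (h0 : ∀ z ∈ U, h z ≠ 0) (l : C(ℂ, ℂ))
    (hl : ∀ z ∈ frontier U, Complex.exp (l z) = (z - p) ^ n * h z) : n = 0 := by
  classical
  -- Pulling back along `κ` unwinds the punctured plane at `p`. The function `(z - p) ^ n * h z`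
  -- inside `U` is glued to `exp ∘ l` outside; the result has a logarithm `L` on the plane, whose
  -- increment under the period `2πI` is a constant. It is 0 far to the right, where `l ∘ κ` is a
  -- logarithm too, and `n * 2πI` far to the left, where `κ` is close to `p`.
  set κ : ℂ → ℂ := fun ζ => p + Complex.exp ζ with hκ
  have hκc : Continuous κ := by fun_prop
  have hpow : ∀ ζ, (κ ζ - p) ^ n = Complex.exp (n * ζ) := fun ζ => by
    simp only [hκ, add_sub_cancel_left]
    rw [Complex.exp_int_mul]
  have hcl : closure {ζ | κ ζ ∈ U} ⊆ κ ⁻¹' closure U := hκc.closure_preimage_subset U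
  let H : C(ℂ, ℂ) := ⟨fun ζ => if κ ζ ∈ U then Complex.exp (n * ζ) * h (κ ζ) else
    Complex.exp (l (κ ζ)), by
      refine continuous_if (fun ζ hζ => ?_) ?_ (by fun_prop)
      · rw [hl _ (hκc.frontier_preimage_subset U hζ), hpow]
      · refine ContinuousOn.mul (by fun_prop) ?_
        exact (hc.comp hκc.continuousOn (Set.mapsTo_preimage _ _)).mono hcl⟩
  have hH : ∀ ζ, H ζ = if κ ζ ∈ U then Complex.exp (n * ζ) * h (κ ζ) else
    Complex.exp (l (κ ζ)) := fun _ => rfl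
  obtain ⟨L, hL⟩ := exists_continuous_log H (fun ζ => by
    rw [hH]
    split_ifs with hζ
    · exact mul_ne_zero (Complex.exp_ne_zero _) (h0 _ hζ)
    · exact Complex.exp_ne_zero _)
  have hκp : ∀ ζ, κ (ζ + 2 * Real.pi * Complex.I) = κ ζ := fun ζ => by
    simp only [hκ, Complex.exp_periodic ζ]
  have hper : ∀ ζ, H (ζ + 2 * Real.pi * Complex.I) = H ζ := fun ζ => by
    rw [hH, hH, hκp]
    have : Complex.exp (n * (ζ + 2 * Real.pi * Complex.I)) = Complex.exp (n * ζ) := by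
      rw [mul_add, Complex.exp_add, Complex.exp_int_mul_two_pi_mul_I, mul_one]
    rw [this]
  -- the monodromy of the logarithm does not depend on the circle
  have hmono : ∀ ζ ζ', L (ζ + 2 * Real.pi * Complex.I) - L ζ =
      L (ζ' + 2 * Real.pi * Complex.I) - L ζ' := fun ζ ζ' =>
    sub_eq_sub_of_exp_eq isPreconnected_univ (f := fun ζ => L (ζ + 2 * Real.pi * Complex.I))
      (by fun_prop) (by fun_prop) (fun x _ => by rw [hL, hL, hper]) (Set.mem_univ ζ)
      (Set.mem_univ ζ')
  obtain ⟨R, hR⟩ := hb.exists_norm_le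
  have hR0 : 0 ≤ R := (norm_nonneg p).trans (hR p hp)
  -- far away
  have hre : ∀ ζ : ℂ, (ζ + 2 * Real.pi * Complex.I).re = ζ.re := fun ζ => by simp
  obtain ⟨ζ₁, hζ₁⟩ : ∃ ζ₁ : ℂ, L (ζ₁ + 2 * Real.pi * Complex.I) - L ζ₁ = 0 := by
    set s : Set ℂ := {ζ | Real.log (R + ‖p‖ + 1) < ζ.re} with hs
    have hconv : IsPreconnected s := (convex_halfSpace_re_gt _).isPreconnected
    have hout : ∀ ζ ∈ s, κ ζ ∉ U := by
      intro ζ hζ hmem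
      have h1 := hR _ hmem
      have h2 : R + ‖p‖ + 1 < ‖Complex.exp ζ‖ := by
        rw [Complex.norm_exp]
        exact (Real.log_lt_iff_lt_exp (by positivity)).1 hζ
      have h3 : ‖Complex.exp ζ‖ ≤ ‖κ ζ‖ + ‖p‖ := by
        have : Complex.exp ζ = κ ζ - p := by simp [hκ]
        rw [this]
        exact norm_sub_le _ _
      linarith
    let ζ₁ : ℂ := ((Real.log (R + ‖p‖ + 1) + 1 : ℝ) : ℂ)
    have hm : ζ₁ ∈ s := by
      change _ < ζ₁.re
      simp [ζ₁]
    have hm' : ζ₁ + 2 * Real.pi * Complex.I ∈ s := by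
      change _ < (ζ₁ + 2 * Real.pi * Complex.I).re
      rw [hre]
      exact hm
    have := sub_eq_sub_of_exp_eq hconv (f := L) (g := fun ζ => l (κ ζ)) (by fun_prop)
      (by fun_prop) (fun ζ hζ => by rw [hL, hH, if_neg (hout ζ hζ)]) hm' hm
    rw [hκp] at this
    exact ⟨ζ₁, by linear_combination this⟩
  -- close to the point
  obtain ⟨ζ₂, hζ₂⟩ : ∃ ζ₂ : ℂ, L (ζ₂ + 2 * Real.pi * Complex.I) - L ζ₂ =
      n * (2 * Real.pi * Complex.I) := by
    have hca : ContinuousAt h p := hc.continuousAt (Filter.mem_of_superset (hU.mem_nhds hp)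
      subset_closure)
    have hq : ∀ᶠ z in 𝓝 p, z ∈ U ∧ h z / h p ∈ Complex.slitPlane := by
      refine (hU.eventually_mem hp).and ((hca.div_const (h p)).eventually_mem ?_)
      rw [div_self (h0 p hp)]
      exact Complex.isOpen_slitPlane.mem_nhds Complex.one_mem_slitPlane
    obtain ⟨ε, hε, hball⟩ := Metric.eventually_nhds_iff.1 hq
    set s : Set ℂ := {ζ | ζ.re < Real.log ε} with hs
    have hconv : IsPreconnected s := (convex_halfSpace_re_lt _).isPreconnected
    have hin : ∀ ζ ∈ s, κ ζ ∈ U ∧ h (κ ζ) / h p ∈ Complex.slitPlane := by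
      intro ζ hζ
      refine hball ?_
      rw [dist_eq_norm]
      simp only [hκ, add_sub_cancel_left]
      rw [Complex.norm_exp]
      exact (Real.lt_log_iff_exp_lt hε).1 hζ
    let ζ₂ : ℂ := ((Real.log ε - 1 : ℝ) : ℂ)
    have hm : ζ₂ ∈ s := by
      change ζ₂.re < _
      simp [ζ₂]
    have hm' : ζ₂ + 2 * Real.pi * Complex.I ∈ s := by
      change (ζ₂ + 2 * Real.pi * Complex.I).re < _
      rw [hre]
      exact hm
    have := sub_eq_sub_of_exp_eq hconv (f := L)
      (g := fun ζ => n * ζ + (Complex.log (h (κ ζ) / h p) + Complex.log (h p))) (by fun_prop)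
      (by
        refine ContinuousOn.add (by fun_prop) (ContinuousOn.add (ContinuousOn.clog ?_
          fun ζ hζ => (hin ζ hζ).2) continuousOn_const)
        refine ContinuousOn.div_const (hc.comp hκc.continuousOn fun ζ hζ => ?_) _
        exact subset_closure (hin ζ hζ).1)
      (fun ζ hζ => by
        rw [hL, hH, if_pos (hin ζ hζ).1, Complex.exp_add, Complex.exp_add,
          Complex.exp_log (Complex.slitPlane_ne_zero (hin ζ hζ).2), Complex.exp_log (h0 p hp),
          div_mul_cancel₀ _ (h0 p hp)]) hm' hm
    simp only [hκp] at this
    exact ⟨ζ₂, by linear_combination this⟩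
  rw [hmono ζ₂ ζ₁, hζ₁] at hζ₂
  have := (mul_eq_zero.1 hζ₂.symm).resolve_right Complex.two_pi_I_ne_zero
  exact_mod_cast this

namespace PlaneGraph

variable {V : Type u} [Quiver.{v} V] (G : PlaneGraph V)

/-- Functions on the vertices and on the edges that fit together form a continuous function on the
graph. -/
theorem exists_continuous_on_carrier (y : V → ℂ) (l : Quiver.Total V → ℝ → ℂ)
    (hc : ∀ e, ContinuousOn (l e) (Set.Icc 0 1)) (h0 : ∀ e, l e 0 = y e.left)
    (h1 : ∀ e, l e 1 = y e.right) :
    ∃ f : C(G.carrier, ℂ), (∀ a, f ⟨G.pos a, G.pos_mem_carrier a⟩ = y a) ∧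
      ∀ e t (ht : t ∈ Set.Icc (0 : ℝ) 1), f ⟨G.curve e t, G.curve_mem_carrier e ht⟩ = l e t := by
  have := G.finite_vertices
  have := G.finite_edges
  let : TopologicalSpace V := ⊥
  have : DiscreteTopology V := ⟨rfl⟩
  let q : C((Σ _ : Quiver.Total V, Set.Icc (0 : ℝ) 1) ⊕ V, G.carrier) :=
    ⟨Sum.elim (fun x => ⟨G.curve x.1 x.2, G.curve_mem_carrier x.1 x.2.2⟩)
      (fun a => ⟨G.pos a, G.pos_mem_carrier a⟩), by
      refine Continuous.sumElim (continuous_sigma fun e => Continuous.subtype_mk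
        ((G.curve_continuous e).comp_continuous continuous_subtype_val fun t => t.2) _)
        continuous_of_discreteTopology⟩
  let g : C((Σ _ : Quiver.Total V, Set.Icc (0 : ℝ) 1) ⊕ V, ℂ) :=
    ⟨Sum.elim (fun x => l x.1 x.2) y, by
      refine Continuous.sumElim (continuous_sigma fun e =>
        ((hc e).comp_continuous continuous_subtype_val fun t => t.2))
        continuous_of_discreteTopology⟩
  -- A continuous surjection from a compact space (finitely many intervals and points) to a
  -- Hausdorff space is closed, hence a quotient map.
  have hq : IsQuotientMap q := by
    refine q.continuous.isClosedMap.isQuotientMap q.continuous ?_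
    rintro ⟨z, ⟨a, rfl⟩ | hz⟩
    · exact ⟨Sum.inr a, rfl⟩
    · obtain ⟨e, t, ht, rfl⟩ := Set.mem_iUnion.1 hz
      exact ⟨Sum.inl ⟨e, t, ht⟩, rfl⟩
  have hcase : ∀ x, (∃ a, (q x : ℂ) = G.pos a ∧ g x = y a) ∨
      ∃ e, ∃ t : Set.Icc (0 : ℝ) 1, (t : ℝ) ∈ Set.Ioo (0 : ℝ) 1 ∧ x = Sum.inl ⟨e, t⟩ := by
    rintro (⟨e, t, ht⟩ | a)
    · rcases G.curve_cases e ht with h | ⟨rfl, h⟩ | ⟨rfl, h⟩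
      · exact Or.inr ⟨e, ⟨t, ht⟩, h, rfl⟩
      · exact Or.inl ⟨e.left, h, h0 e⟩
      · exact Or.inl ⟨e.right, h, h1 e⟩
    · exact Or.inl ⟨a, rfl, rfl⟩
  have hfac : Function.FactorsThrough g q := by
    intro x x' hxx
    have hxx' : (q x : ℂ) = q x' := congrArg _ hxx
    rcases hcase x with ⟨a, ha, ha'⟩ | ⟨e, t, ht, rfl⟩
    · rcases hcase x' with ⟨b, hb, hb'⟩ | ⟨e', t', ht', rfl⟩
      · rw [ha', hb', G.pos_injective (ha.symm.trans (hxx'.trans hb))]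
      · exact absurd (hxx'.symm.trans ha) (G.curve_ne_pos e' t' ht' a)
    · rcases hcase x' with ⟨b, hb, hb'⟩ | ⟨e', t', ht', rfl⟩
      · exact absurd (hxx'.trans hb) (G.curve_ne_pos e t ht b)
      · obtain ⟨rfl, h⟩ := G.curve_inj e e' t ht t' ht' hxx'
        rw [Subtype.ext h]
  have hlift : ∀ x, hq.lift g hfac (q x) = g x := fun x =>
    congrArg (fun k : C(_, ℂ) => k x) (hq.lift_comp g hfac)
  exact ⟨hq.lift g hfac, fun a => hlift (Sum.inr a), fun e t ht => hlift (Sum.inl ⟨e, t, ht⟩)⟩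

variable {G} [Fintype (Quiver.Total V)]

open Classical in
/-- In a connected graph, any two vertices are joined by a 1-chain. -/
theorem exists_chain (hG : ∀ a b : V, Relation.EqvGen (fun a b : V => Nonempty (a ⟶ b)) a b)
    (a b : V) : ∃ k : Quiver.Total V → ℤ, ∀ φ : V → ℂ,
      ∑ e, (k e : ℂ) * (φ e.right - φ e.left) = φ b - φ a := by
  induction hG a b with
  | rel a b h =>
    obtain ⟨e⟩ := h
    refine ⟨Pi.single ⟨a, b, e⟩ 1, fun φ => ?_⟩
    rw [Finset.sum_eq_single_of_mem (⟨a, b, e⟩ : Quiver.Total V) (Finset.mem_univ _)]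
    · simp
    · intro e' _ he'
      simp [he']
  | refl a => exact ⟨0, fun φ => by simp⟩
  | symm a b _ ih =>
    obtain ⟨k, hk⟩ := ih
    refine ⟨-k, fun φ => ?_⟩
    simp [hk, Finset.sum_neg_distrib]
  | trans a b c _ _ ih ih' =>
    obtain ⟨k, hk⟩ := ih
    obtain ⟨k', hk'⟩ := ih'
    refine ⟨k + k', fun φ => ?_⟩
    simp [add_mul, Finset.sum_add_distrib, hk, hk']

open Classical in
/-- A function on the edges of a connected graph that vanishes on circulations is a coboundary. -/
theorem exists_potential (hG : ∀ a b : V, Relation.EqvGen (fun a b : V => Nonempty (a ⟶ b)) a b)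
    (x : Quiver.Total V → ℂ) (hx : ∀ c, IsCirc c → ∑ e, (c e : ℂ) * x e = 0) :
    ∃ y : V → ℂ, ∀ e, x e = y e.right - y e.left := by
  rcases isEmpty_or_nonempty V with hV | ⟨⟨v₀⟩⟩
  · exact ⟨fun _ => 0, fun e => hV.elim e.left⟩
  choose k hk using fun b => exists_chain hG v₀ b
  refine ⟨fun a => ∑ e, (k a e : ℂ) * x e, fun e => ?_⟩
  have hs : ∀ z : Quiver.Total V → ℂ,
      ∑ e', ((Pi.single e 1 : Quiver.Total V → ℤ) e' : ℂ) * z e' = z e := by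
    intro z
    rw [Finset.sum_eq_single_of_mem e (Finset.mem_univ _)]
    · simp
    · intro e' _ he'
      simp [he']
  -- The closed chain that goes from `v₀` to the start of `e`, along `e`, and back to `v₀`.
  have := hx (k e.left + Pi.single e 1 - k e.right) (fun φ => by
    simp only [Pi.add_apply, Pi.sub_apply, Int.cast_add, Int.cast_sub, add_mul, sub_mul,
      Finset.sum_add_distrib, Finset.sum_sub_distrib]
    rw [hk, hk, hs fun e => φ e.right - φ e.left]
    ring)
  simp only [Pi.add_apply, Pi.sub_apply, Int.cast_add, Int.cast_sub, add_mul, sub_mul,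
    Finset.sum_add_distrib, Finset.sum_sub_distrib] at this
  rw [hs] at this
  linear_combination this

open Classical in
/-- The winding numbers around the bounded faces of a connected plane graph are linearly
independent as functions of the circulation. -/
theorem faceWinding_independent
    (hG : ∀ a b : V, Relation.EqvGen (fun a b : V => Nonempty (a ⟶ b)) a b) [Nonempty V]
    (n : G.InteriorFace →₀ ℤ)
    (h : ∀ c, IsCirc c → ∑ F ∈ n.support, n F * G.faceWinding c (some F) = 0) : n = 0 := by
  have hp : ∀ F e, ∀ t ∈ Set.Icc (0 : ℝ) 1, G.curve e t - G.facePt F ≠ 0 := fun F e t ht h0 =>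
    G.facePt_notMem F (sub_eq_zero.1 h0 ▸ G.curve_mem_carrier e ht)
  have hpv : ∀ F a, G.pos a - G.facePt F ≠ 0 := fun F a h0 =>
    G.facePt_notMem F (sub_eq_zero.1 h0 ▸ G.pos_mem_carrier a)
  -- Paired with a circulation, this edge function gives `2πI` times the assumed relation between
  -- the winding numbers, so it is a coboundary.
  obtain ⟨y, hy⟩ := exists_potential hG (fun e => ∑ F ∈ n.support, n F * G.edgeVar e (G.facePt F))
    (by
      intro c hc
      have h1 : ∀ F, ∑ e, (c e : ℂ) * G.edgeVar e (G.facePt F) =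
          (2 * Real.pi * Complex.I) * G.faceWinding c (some F) := by
        intro F
        rw [← winding_facePt hc, winding, mul_div_cancel₀ _ Complex.two_pi_I_ne_zero]
      have h2 : ((∑ F ∈ n.support, n F * G.faceWinding c (some F) : ℤ) : ℂ) = 0 := by
        rw [h c hc, Int.cast_zero]
      push_cast at h2
      calc ∑ e, (c e : ℂ) * ∑ F ∈ n.support, (n F : ℂ) * G.edgeVar e (G.facePt F)
          = ∑ F ∈ n.support, (n F : ℂ) * ∑ e, (c e : ℂ) * G.edgeVar e (G.facePt F) := by
            simp only [Finset.mul_sum]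
            rw [Finset.sum_comm]
            refine Finset.sum_congr rfl fun F _ => Finset.sum_congr rfl fun e _ => by ring
        _ = (2 * Real.pi * Complex.I) *
              ∑ F ∈ n.support, (n F : ℂ) * G.faceWinding c (some F) := by
            rw [Finset.mul_sum]
            exact Finset.sum_congr rfl fun F _ => by rw [h1]; ring
        _ = 0 := by rw [h2, mul_zero])
  -- Along `e` a logarithm of `g` varies by `∑ n F * edgeVar e p_F`, which is the coboundary of `y`.
  -- Hence the logarithms on the edges, shifted to match `y` up to one global constant, fit together
  -- at the vertices.
  let g : ℂ → ℂ := fun z => ∏ F ∈ n.support, (z - G.facePt F) ^ n F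
  have hg0 : ∀ z ∈ G.carrier, g z ≠ 0 := fun z hz => Finset.prod_ne_zero_iff.2 fun F _ =>
    zpow_ne_zero _ fun h0 => G.facePt_notMem F (sub_eq_zero.1 h0 ▸ hz)
  have hexp : ∀ e : Quiver.Total V, Complex.exp (y e.right - y e.left) = g (G.pos e.right) / g (G.pos e.left) := by
    intro e
    rw [← hy, Complex.exp_sum]
    simp only [g, ← Finset.prod_div_distrib]
    refine Finset.prod_congr rfl fun F _ => ?_
    rw [Complex.exp_int_mul, edgeVar, exp_logVar (γ := fun t => G.curve e t - G.facePt F)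
      ((G.curve_continuous e).sub continuousOn_const) (hp F e), G.curve_one, G.curve_zero,
      div_zpow]
  -- adjust the potential by a constant
  obtain ⟨y', hy', hy'g⟩ : ∃ y' : V → ℂ, (∀ e : Quiver.Total V,
      y' e.right - y' e.left = y e.right - y e.left) ∧
      ∀ a, Complex.exp (y' a) = g (G.pos a) := by
    obtain ⟨v₀⟩ := ‹Nonempty V›
    have hgp : ∀ a, g (G.pos a) ≠ 0 := fun a => hg0 _ (G.pos_mem_carrier a)
    have hconst : ∀ a b, Complex.exp (y a) / g (G.pos a) = Complex.exp (y b) / g (G.pos b) := by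
      intro a b
      induction hG a b with
      | rel a b h =>
        obtain ⟨e⟩ := h
        have := hexp ⟨a, b, e⟩
        simp only [Complex.exp_sub] at this
        rw [div_eq_div_iff (Complex.exp_ne_zero _) (hgp _)] at this
        rw [div_eq_div_iff (hgp _) (hgp _)]
        linear_combination -this
      | refl => rfl
      | symm _ _ _ ih => exact ih.symm
      | trans _ _ _ _ _ ih ih' => exact ih.trans ih'
    refine ⟨fun a => y a - Complex.log (Complex.exp (y v₀) / g (G.pos v₀)), fun e => by ring,
      fun a => ?_⟩
    rw [Complex.exp_sub, Complex.exp_log (div_ne_zero (Complex.exp_ne_zero _) (hgp _)),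
      hconst v₀ a, div_div_cancel₀ (Complex.exp_ne_zero _)]
  choose k hk using fun (F : G.InteriorFace) (e : Quiver.Total V) => exists_isLogLift
    (γ := fun t => G.curve e t - G.facePt F) ((G.curve_continuous e).sub continuousOn_const)
    (hp F e)
  obtain ⟨f, hf, hf'⟩ := G.exists_continuous_on_carrier y'
    (fun e t => y' e.left + ∑ F ∈ n.support, n F * (k F e t - k F e 0))
    (fun e => continuousOn_const.add (continuousOn_finsetSum _ fun F _ =>
      continuousOn_const.mul ((hk F e).1.sub continuousOn_const)))
    (fun e => by simp)
    (fun e => by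
      have : ∀ F, k F e 1 - k F e 0 = G.edgeVar e (G.facePt F) := fun F => (hk F e).logVar_eq.symm
      simp only [this]
      rw [hy e, ← hy' e]
      ring)
  have hfg : ∀ z : G.carrier, Complex.exp (f z) = g z := by
    rintro ⟨z, ⟨a, rfl⟩ | hz⟩
    · exact (congrArg _ (hf a)).trans (hy'g a)
    · obtain ⟨e, t, ht, rfl⟩ := Set.mem_iUnion.1 hz
      refine (congrArg _ (hf' e t ht)).trans ?_
      rw [Complex.exp_add, hy'g, Complex.exp_sum]
      simp only [g]
      rw [← Finset.prod_mul_distrib]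
      refine Finset.prod_congr rfl fun F _ => ?_
      rw [Complex.exp_int_mul, Complex.exp_sub, (hk F e).2 t ht, (hk F e).2 0 (by simp)]
      simp only
      rw [G.curve_zero, div_zpow, mul_div_cancel₀ _ (zpow_ne_zero _ (hpv F _))]
  -- Tietze extension of the logarithm of `g` from the graph to the plane.
  obtain ⟨l, hl⟩ := f.exists_restrict_eq G.isCompact_carrier.isClosed
  by_contra hn
  obtain ⟨F₀, hF₀⟩ := Finsupp.support_nonempty_iff.2 hn
  have hdis : ∀ F, F ≠ F₀ → G.facePt F ∉ closure F₀.1 := by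
    intro F hF hmem
    obtain ⟨z, hz, hz'⟩ := mem_closure_iff.1 hmem F.1 (G.isOpen_face F) (G.facePt_mem F)
    exact hF (Option.some_injective _ (G.eq_of_mem_faceSet (X := some F) (Y := some F₀) hz hz'))
  refine Finsupp.mem_support_iff.1 hF₀ (order_eq_zero_of_log_on_frontier (G.isOpen_face F₀) F₀.2.2
    (G.facePt_mem F₀) (h := fun z => ∏ F ∈ n.support.erase F₀, (z - G.facePt F) ^ n F)
    ?_ ?_ l ?_)
  · refine continuousOn_finsetProd _ fun F hF => ContinuousOn.zpow₀ (by fun_prop) _ fun z hz => ?_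
    left
    intro h0
    exact hdis F (Finset.ne_of_mem_erase hF) (sub_eq_zero.1 h0 ▸ hz)
  · intro z hz
    refine Finset.prod_ne_zero_iff.2 fun F hF => zpow_ne_zero _ fun h0 => ?_
    exact hdis F (Finset.ne_of_mem_erase hF) (sub_eq_zero.1 h0 ▸ subset_closure hz)
  · intro z hz
    have hzG : z ∈ G.carrier := by
      by_contra hzG
      obtain ⟨X, hX⟩ := G.exists_mem_faceSet hzG
      have hopen : IsOpen (connectedComponentIn G.carrierᶜ z) :=
        G.isCompact_carrier.isClosed.isOpen_compl.connectedComponentIn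
      have hzc := mem_connectedComponentIn (F := G.carrierᶜ) (x := z) hzG
      rw [frontier, (G.isOpen_face F₀).interior_eq] at hz
      obtain ⟨w, hw, hw'⟩ := mem_closure_iff.1 hz.1 _ hopen hzc
      have h1 := (G.mem_faceSet_some hw').2
      rw [← connectedComponentIn_eq hw] at h1
      exact hz.2 (h1 ▸ hzc)
    have h1 : l z = f ⟨z, hzG⟩ := congrArg (fun m : C(G.carrier, ℂ) => m ⟨z, hzG⟩) hl
    rw [h1, hfg]
    exact (Finset.mul_prod_erase _ _ hF₀).symm

end PlaneGraph

/-! ### Functions on the faces and circulations -/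

namespace PlaneGraph

variable {V : Type u} [Quiver.{v} V] {G : PlaneGraph V} [Fintype (Quiver.Total V)]

theorem faceWinding_add {c c' : Quiver.Total V → ℤ} (hc : IsCirc c) (hc' : IsCirc c')
    (hcc : IsCirc (c + c')) (X : Option G.InteriorFace) :
    G.faceWinding (c + c') X = G.faceWinding c X + G.faceWinding c' X := by
  cases X with
  | none => rfl
  | some F =>
    have h : G.winding (c + c') (G.facePt F) =
        G.winding c (G.facePt F) + G.winding c' (G.facePt F) := by
      simp [winding, add_mul, Finset.sum_add_distrib, add_div]
    rw [winding_facePt hc, winding_facePt hc', winding_facePt hcc] at h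
    exact_mod_cast h

variable (V) in
/-- The lattice of circulations. -/
def circSubgroup : AddSubgroup (Quiver.Total V → ℤ) where
  carrier := {c | IsCirc c}
  add_mem' {c c'} hc hc' φ := by simp [add_mul, Finset.sum_add_distrib, hc φ, hc' φ]
  zero_mem' φ := by simp
  neg_mem' {c} hc φ := by simp [Finset.sum_neg_distrib, hc φ]

variable (V) in
/-- The lattice of circulations, as a `ℤ`-module. -/
abbrev circModule : Submodule ℤ (Quiver.Total V → ℤ) := AddSubgroup.toIntSubmodule (circSubgroup V)

variable (G) in
/-- The winding number around a bounded face as a linear form. -/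
noncomputable def windingForm (F : G.InteriorFace) : circModule V →ₗ[ℤ] ℤ :=
  AddMonoidHom.toIntLinearMap
    { toFun := fun c => G.faceWinding c.1 (some F)
      map_zero' := by
        have h := faceWinding_add (G := G) (circModule V).zero_mem (circModule V).zero_mem
          (add_zero (0 : Quiver.Total V → ℤ) ▸ (circModule V).zero_mem) (some F)
        rw [add_zero] at h
        exact left_eq_add.1 h
      map_add' := fun c c' => faceWinding_add c.2 c'.2 (c + c').2 _ }

theorem windingForm_apply (F : G.InteriorFace) (c : circModule V) :
    G.windingForm F c = G.faceWinding c.1 (some F) := rfl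

theorem linearIndependent_windingForm
    (hG : ∀ a b : V, Relation.EqvGen (fun a b : V => Nonempty (a ⟶ b)) a b) [Nonempty V] :
    LinearIndependent ℤ G.windingForm := by
  rw [linearIndependent_iff]
  intro n hn
  refine faceWinding_independent hG n fun c hc => ?_
  have := LinearMap.congr_fun hn ⟨c, hc⟩
  simpa [Finsupp.linearCombination_apply, Finsupp.sum, LinearMap.sum_apply,
    windingForm_apply] using this

/-- The dual of a finitely generated lattice is Noetherian, so it has no infinite independent
family. -/
theorem finite_interiorFace
    (hG : ∀ a b : V, Relation.EqvGen (fun a b : V => Nonempty (a ⟶ b)) a b) [Nonempty V] :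
    Finite G.InteriorFace :=
  (linearIndependent_windingForm hG).finite_of_isNoetherian

/-- Every function on the faces of a connected plane graph that vanishes on the exterior face is
a rational multiple of the winding number of a circulation. -/
theorem exists_circ_of_faceFunction
    (hG : ∀ a b : V, Relation.EqvGen (fun a b : V => Nonempty (a ⟶ b)) a b) [Nonempty V]
    (f : Option G.InteriorFace → ℤ) (hf : f none = 0) :
    ∃ m : ℤ, m ≠ 0 ∧ ∃ c, IsCirc c ∧ ∀ X, m * f X = G.faceWinding c X := by
  have := finite_interiorFace (G := G) hG
  have := Fintype.ofFinite G.InteriorFace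
  -- `w` is injective since `c e` is the jump across `e`, and the independence of the forms bounds
  -- the number of faces by the rank of its domain. So its image has full rank, the cokernel is
  -- torsion, and some `m ≠ 0` moves `f` into the image.
  let w : circModule V →ₗ[ℤ] (G.InteriorFace → ℤ) := LinearMap.pi G.windingForm
  have hw : Function.Injective w := by
    refine (injective_iff_map_eq_zero w).2 fun c hc => ?_
    ext e
    obtain ⟨t, ht, d, hd0, hd⟩ := G.exists_tangent e
    obtain ⟨X, hX⟩ := exists_leftAt e ht hd0 hd
    obtain ⟨Y, hY⟩ := exists_rightAt e ht hd0 hd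
    have h0 : ∀ X, G.faceWinding c.1 X = 0 := by
      rintro (_ | F)
      · rfl
      · exact congrFun hc F
    have := faceWinding_jump c.2 ht hd0 hd hX hY
    rw [h0, h0, zero_add] at this
    exact this.symm
  have hcard : Fintype.card G.InteriorFace ≤ Module.finrank ℤ (circModule V) := by
    have := (linearIndependent_windingForm (G := G) hG).fintype_card_le_finrank
    rwa [Module.finrank_linearMap_self] at this
  have hq : Module.finrank ℤ ((G.InteriorFace → ℤ) ⧸ LinearMap.range w) = 0 := by
    have h1 := Submodule.finrank_quotient_add_finrank (LinearMap.range w)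
    rw [Module.finrank_fintype_fun_eq_card, LinearMap.finrank_range_of_inj hw] at h1
    omega
  rw [Module.finrank_eq_zero_iff_isTorsion] at hq
  obtain ⟨⟨m, hm⟩, hmf⟩ := @hq (Submodule.Quotient.mk fun F => f (some F))
  have hmf' : (Submodule.Quotient.mk (m • fun F => f (some F)) :
      (G.InteriorFace → ℤ) ⧸ LinearMap.range w) = 0 := hmf
  rw [Submodule.Quotient.mk_eq_zero] at hmf'
  obtain ⟨c, hc⟩ := hmf'
  refine ⟨m, nonZeroDivisors.ne_zero hm, c.1, c.2, ?_⟩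
  rintro (_ | F)
  · rw [hf, mul_zero, faceWinding_none]
  · exact (congrFun hc F).symm

/-- The faces on the two sides of an edge do not depend on the tangent used to find them. -/
theorem sides_eq
    (hG : ∀ a b : V, Relation.EqvGen (fun a b : V => Nonempty (a ⟶ b)) a b) [Nonempty V]
    {e : Quiver.Total V} {t t' : ℝ} (ht : t ∈ Set.Ioo (0 : ℝ) 1) (ht' : t' ∈ Set.Ioo (0 : ℝ) 1)
    {d d' : ℂ} (hd0 : d ≠ 0) (hd : HasDerivAt (G.curve e) d t)
    (hd0' : d' ≠ 0) (hd' : HasDerivAt (G.curve e) d' t') {X Y X' Y' : Option G.InteriorFace}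
    (hX : G.LeftAt e t d X) (hY : G.RightAt e t d Y) (hX' : G.LeftAt e t' d' X')
    (hY' : G.RightAt e t' d' Y') : X = X' ∧ Y = Y' := by
  classical
  -- A multiple of `f`, normalised at `none`, is a winding function, and its jump across `e` is the
  -- multiplicity of `e` at whichever tangent it is read off.
  have key : ∀ f : Option G.InteriorFace → ℤ, f X - f Y = f X' - f Y' := by
    intro f
    obtain ⟨m, hm, c, hc, h⟩ := exists_circ_of_faceFunction hG (fun X => f X - f none)
      (sub_self _)
    have h1 := faceWinding_jump hc ht hd0 hd hX hY
    have h2 := faceWinding_jump hc ht' hd0' hd' hX' hY'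
    rw [← h, ← h] at h1 h2
    exact mul_left_cancel₀ hm (by linear_combination h1 - h2)
  have hdelta : ∀ Z : Option G.InteriorFace, (if X = Z then (1 : ℤ) else 0) -
      (if Y = Z then 1 else 0) = (if X' = Z then 1 else 0) - (if Y' = Z then 1 else 0) :=
    fun Z => key fun F => if F = Z then 1 else 0
  -- Jumps of indicator functions recover `X` and `Y` when they differ. When they coincide, jumps
  -- see nothing; then a circulation winding around `X` alone (up to a multiple and a constant) does
  -- not use `e`, and its winding number is constant along `e`.
  by_cases hXY : X = Y
  · subst hXY
    have hXY' : X' = Y' := by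
      by_contra hne
      have := hdelta X'
      rw [sub_self, if_pos rfl, if_neg (Ne.symm hne)] at this
      exact absurd this (by norm_num)
    subst hXY'
    suffices X = X' from ⟨this, this⟩
    by_contra hne
    obtain ⟨m, hm, c, hc, h⟩ := exists_circ_of_faceFunction hG
      (fun F => (if F = X then (1 : ℤ) else 0) - if none = X then 1 else 0) (by simp)
    have hce : c e = 0 := by
      have := faceWinding_jump hc ht hd0 hd hX hY
      linarith
    have h1 := faceWinding_eq_along hc hce ht ht' hX hX'
    rw [← h, ← h] at h1
    have := mul_left_cancel₀ hm h1
    rw [if_pos rfl, if_neg (Ne.symm hne)] at this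
    linarith
  · have h1 := hdelta X
    have h2 := hdelta Y
    rw [if_pos rfl, if_neg (Ne.symm hXY)] at h1
    rw [if_neg hXY, if_pos rfl] at h2
    constructor
    · by_contra hne
      rw [if_neg (Ne.symm hne)] at h1
      split_ifs at h1 <;> simp at h1
    · by_contra hne
      rw [if_neg (Ne.symm hne)] at h2
      split_ifs at h2 <;> simp at h2

/-- The faces on the left and on the right of an edge. -/
theorem exists_sides
    (hG : ∀ a b : V, Relation.EqvGen (fun a b : V => Nonempty (a ⟶ b)) a b) [Nonempty V]
    (e : Quiver.Total V) : ∃ X Y : Option G.InteriorFace,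
      ∀ t ∈ Set.Ioo (0 : ℝ) 1, ∀ d : ℂ, d ≠ 0 → HasDerivAt (G.curve e) d t →
        G.LeftAt e t d X ∧ G.RightAt e t d Y := by
  obtain ⟨t, ht, d, hd0, hd⟩ := G.exists_tangent e
  obtain ⟨X, hX⟩ := exists_leftAt e ht hd0 hd
  obtain ⟨Y, hY⟩ := exists_rightAt e ht hd0 hd
  refine ⟨X, Y, fun t' ht' d' hd0' hd' => ?_⟩
  obtain ⟨X', hX'⟩ := exists_leftAt e ht' hd0' hd'
  obtain ⟨Y', hY'⟩ := exists_rightAt e ht' hd0' hd'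
  obtain ⟨rfl, rfl⟩ := sides_eq hG ht ht' hd0 hd hd0' hd' hX hY hX' hY'
  exact ⟨hX', hY'⟩

/-- The assignment of faces to the two sides of the edges of a connected plane graph, and its
relation with circulations. -/
theorem exists_side_functions
    (hG : ∀ a b : V, Relation.EqvGen (fun a b : V => Nonempty (a ⟶ b)) a b) [Nonempty V] :
    ∃ L R : Quiver.Total V → Option G.InteriorFace,
      (∀ e X, G.OnLeft e (G.faceSet X) ↔ L e = X) ∧
      (∀ e X, G.OnRight e (G.faceSet X) ↔ R e = X) ∧
      (∀ c, IsCirc c → ∃ w : Option G.InteriorFace → ℤ, w none = 0 ∧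
        (∀ e, w (L e) - w (R e) = c e) ∧
        ∀ a : V, (∀ e : Quiver.Total V, e.left = a ∨ e.right = a → c e = 0) →
          ∀ e e' : Quiver.Total V, (e.left = a ∨ e.right = a) → (e'.left = a ∨ e'.right = a) →
            w (L e) = w (L e')) ∧
      (∀ f : Option G.InteriorFace → ℤ, IsCirc fun e => f (L e) - f (R e)) ∧
      ∀ f : Option G.InteriorFace → ℤ, (∀ e, f (L e) = f (R e)) → ∀ X, f X = f none := by
  choose L R hLR using fun e => exists_sides (G := G) hG e
  have hjump : ∀ c, IsCirc c → ∀ e, G.faceWinding c (L e) - G.faceWinding c (R e) = c e := by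
    intro c hc e
    obtain ⟨t, ht, d, hd0, hd⟩ := G.exists_tangent e
    obtain ⟨hX, hY⟩ := hLR e t ht d hd0 hd
    linarith [faceWinding_jump hc ht hd0 hd hX hY]
  have hcirc : ∀ f : Option G.InteriorFace → ℤ, ∃ m : ℤ, m ≠ 0 ∧ ∃ c, IsCirc c ∧
      (∀ e, m * (f (L e) - f (R e)) = c e) ∧ ∀ X, m * (f X - f none) = G.faceWinding c X := by
    intro f
    obtain ⟨m, hm, c, hc, h⟩ := exists_circ_of_faceFunction hG (fun X => f X - f none)
      (sub_self _)
    refine ⟨m, hm, c, hc, fun e => ?_, h⟩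
    have h1 := hjump c hc e
    rw [← h, ← h] at h1
    linear_combination h1
  refine ⟨L, R, fun e X => ⟨fun h => ?_, ?_⟩, fun e X => ⟨fun h => ?_, ?_⟩, ?_, ?_, ?_⟩
  · obtain ⟨t, ht, d, hd0, hd⟩ := G.exists_tangent e
    exact LeftAt.unique (hLR e t ht d hd0 hd).1 (h t ht d hd0 hd)
  · rintro rfl t ht d hd0 hd
    exact (hLR e t ht d hd0 hd).1
  · obtain ⟨t, ht, d, hd0, hd⟩ := G.exists_tangent e
    exact RightAt.unique (hLR e t ht d hd0 hd).2 (h t ht d hd0 hd)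
  · rintro rfl t ht d hd0 hd
    exact (hLR e t ht d hd0 hd).2
  · intro c hc
    refine ⟨G.faceWinding c, rfl, hjump c hc, fun a ha e e' he he' => ?_⟩
    have h : ∀ e : Quiver.Total V, e.left = a ∨ e.right = a →
        G.winding c (G.pos a) = G.faceWinding c (L e) := by
      intro e he
      obtain ⟨t, ht, d, hd0, hd⟩ := G.exists_tangent e
      exact winding_pos_eq hc ha he ht (hLR e t ht d hd0 hd).1
    have := (h e he).symm.trans (h e' he')
    exact_mod_cast this
  -- Some non-zero multiple of this edge function is a circulation, and the multiplier can be
  -- cancelled.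
  · intro f φ
    obtain ⟨m, hm, c, hc, h, -⟩ := hcirc f
    have h1 := hc φ
    simp only [← h] at h1
    have hm' : (m : ℂ) ≠ 0 := by exact_mod_cast hm
    refine (mul_eq_zero.1 ?_).resolve_left hm'
    rw [← h1, Finset.mul_sum]
    refine Finset.sum_congr rfl fun e _ => ?_
    push_cast
    ring
  · intro f hf X
    obtain ⟨m, hm, c, hc, h, h'⟩ := hcirc f
    have hc0 : c = 0 := by
      ext e
      rw [← h, hf, sub_self, mul_zero]
      rfl
    have h0 : G.faceWinding c X = 0 := by
      cases X with
      | none => rfl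
      | some F =>
        have : (⟨c, hc⟩ : circModule V) = 0 := Subtype.ext hc0
        rw [← windingForm_apply F ⟨c, hc⟩, this, map_zero]
    have := h' X
    rw [h0] at this
    linarith [(mul_eq_zero.1 this).resolve_left hm]

end PlaneGraph

/-! ## Acyclicity -/

section Acyclicity

variable {E V O : Type*}

theorem IsCirculation.swap [Fintype E] {l r : E → V} {c : E → ℤ} (h : IsCirculation l r c) :
    IsCirculation r l c := fun φ => by
  rw [← neg_eq_zero, ← Finset.sum_neg_distrib, ← h φ]
  exact Finset.sum_congr rfl fun e _ => by ring

/-- A non-negative flow from `a` to `b` that uses only edges from `E'`. -/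
def EdgeFlow [Fintype E] (l r : E → V) (E' : Set E) (a b : V) : Prop :=
  ∃ c : E → ℤ, (∀ e, 0 ≤ c e) ∧ (∀ e, c e ≠ 0 → e ∈ E') ∧
    ∀ φ : V → ℂ, ∑ e, (c e : ℂ) * (φ (r e) - φ (l e)) = φ b - φ a

theorem EdgeFlow.refl [Fintype E] (l r : E → V) (E' : Set E) (a : V) : EdgeFlow l r E' a a :=
  ⟨0, fun _ => le_rfl, fun _ h => absurd rfl h, fun φ => by simp⟩

theorem EdgeFlow.trans [Fintype E] {l r : E → V} {E' : Set E} {a b c : V} :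
    EdgeFlow l r E' a b → EdgeFlow l r E' b c → EdgeFlow l r E' a c := by
  rintro ⟨x, hx, hx', hxφ⟩ ⟨y, hy, hy', hyφ⟩
  refine ⟨x + y, fun e => add_nonneg (hx e) (hy e), fun e he => ?_, fun φ => ?_⟩
  · by_cases h : x e = 0
    · exact hy' e fun h' => he (by simp [h, h'])
    · exact hx' e h
  · simp [add_mul, Finset.sum_add_distrib, hxφ, hyφ]

open Classical in
theorem sum_single_mul [Fintype E] (e : E) (z : E → ℂ) :
    ∑ e', ((Pi.single e 1 : E → ℤ) e' : ℂ) * z e' = z e := by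
  rw [Finset.sum_eq_single_of_mem e (Finset.mem_univ _)]
  · simp
  · intro e' _ he'
    simp [he']

open Classical in
theorem single_nonneg (e e' : E) : 0 ≤ (Pi.single e 1 : E → ℤ) e' := by
  by_cases h : e' = e
  · subst h
    simp
  · simp [h]

open Classical in
theorem EdgeFlow.edge [Fintype E] {l r : E → V} {E' : Set E} {e : E} (he : e ∈ E') :
    EdgeFlow l r E' (l e) (r e) := by
  refine ⟨Pi.single e 1, single_nonneg e, fun e' h => ?_,
    fun φ => sum_single_mul e fun e => φ (r e) - φ (l e)⟩
  by_contra h'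
  refine h (Pi.single_eq_of_ne (fun h'' => h' ?_) _)
  rwa [h'']

theorem EdgeFlow.swap [Fintype E] {l r : E → V} {E' : Set E} {a b : V} (h : EdgeFlow r l E' a b) :
    EdgeFlow l r E' b a := by
  obtain ⟨c, h1, h2, h3⟩ := h
  refine ⟨c, h1, h2, fun φ => ?_⟩
  rw [← neg_sub, ← h3 φ, ← Finset.sum_neg_distrib]
  exact Finset.sum_congr rfl fun e _ => by ring

open Classical in
/-- Walking forward along edges from `E'`, one ends up in a cycle. -/
theorem exists_cycle_of_next [Fintype E] {l r : E → V} {E' : Set E}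
    (next : ∀ e ∈ E', ∃ e' ∈ E', l e' = r e) {f : E} (hf : f ∈ E') :
    ∃ c : E → ℤ, IsCirculation l r c ∧ (∀ e, 0 ≤ c e) ∧ c ≠ 0 ∧ (∀ e, c e ≠ 0 → e ∈ E') ∧
      ∀ e, c e ≠ 0 → EdgeFlow l r E' (r f) (l e) := by
  choose! nx hnx hnx' using next
  -- The walk starts with the successor of `f`, so that its flow begins at `r f` and need not
  -- contain `f` itself.
  let s : ℕ → E := fun n => nx^[n + 1] f
  have hs : ∀ n, s (n + 1) = nx (s n) := fun n => Function.iterate_succ_apply' nx (n + 1) f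
  have hsE : ∀ n, s n ∈ E' := by
    intro n
    induction n with
    | zero => exact hnx f hf
    | succ n ih => rw [hs]; exact hnx _ ih
  have hsl : ∀ n, l (s (n + 1)) = r (s n) := fun n => by rw [hs]; exact hnx' _ (hsE n)
  have hflow : ∀ n, EdgeFlow l r E' (r f) (l (s n)) := by
    intro n
    induction n with
    | zero =>
      rw [show l (s 0) = r f from hnx' f hf]
      exact EdgeFlow.refl _ _ _ _
    | succ n ih =>
      rw [hsl]
      exact ih.trans (EdgeFlow.edge (hsE n))
  obtain ⟨i, j, hij, hsij⟩ : ∃ i j, i < j ∧ s i = s j := by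
    obtain ⟨i, j, hne, h⟩ := Finite.exists_ne_map_eq_of_infinite s
    rcases lt_or_gt_of_ne hne with h' | h'
    · exact ⟨i, j, h', h⟩
    · exact ⟨j, i, h', h.symm⟩
  let c : E → ℤ := fun e => ∑ n ∈ Finset.Ico i j, (Pi.single (s n) 1 : E → ℤ) e
  have hc0 : ∀ e, 0 ≤ c e := fun e => Finset.sum_nonneg fun n _ => single_nonneg _ _
  have hcs : ∀ e, c e ≠ 0 → ∃ n, e = s n := by
    intro e he
    obtain ⟨n, -, hn⟩ := Finset.exists_ne_zero_of_sum_ne_zero he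
    exact ⟨n, by_contra fun h => hn (Pi.single_eq_of_ne h _)⟩
  refine ⟨c, fun φ => ?_, hc0, fun h0 => ?_, ?_, ?_⟩
  · have h1 : ∀ e, (c e : ℂ) * (φ (r e) - φ (l e)) = ∑ n ∈ Finset.Ico i j,
        ((Pi.single (s n) 1 : E → ℤ) e : ℂ) * (φ (r e) - φ (l e)) := fun e => by
      simp only [c]
      push_cast
      rw [Finset.sum_mul]
    rw [Finset.sum_congr rfl fun e _ => h1 e, Finset.sum_comm]
    have h2 : ∀ n, ∑ e, ((Pi.single (s n) 1 : E → ℤ) e : ℂ) * (φ (r e) - φ (l e)) =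
        φ (l (s (n + 1))) - φ (l (s n)) := fun n => by
      rw [sum_single_mul (s n) fun e => φ (r e) - φ (l e), hsl]
    rw [Finset.sum_congr rfl fun n _ => h2 n, Finset.sum_Ico_sub (fun n => φ (l (s n))) hij.le,
      hsij, sub_self]
  · have h1 : c (s i) = 0 := congrFun h0 _
    have := (Finset.sum_eq_zero_iff_of_nonneg fun n _ => single_nonneg _ _).1 h1 i
      (Finset.mem_Ico.2 ⟨le_rfl, hij⟩)
    simp at this
  · intro e he
    obtain ⟨n, rfl⟩ := hcs e he
    exact hsE n
  · intro e he
    obtain ⟨n, rfl⟩ := hcs e he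
    exact hflow n

/-- At a vertex with an incoming edge of a non-negative circulation there is also an outgoing one. -/
theorem exists_out_of_circulation [Fintype E] {l r : E → V} {k : E → ℤ} (hk : IsCirculation l r k)
    (hk0 : ∀ e, 0 ≤ k e) {e : E} (he : k e ≠ 0) : ∃ e', l e' = r e ∧ k e' ≠ 0 := by
  classical
  by_contra! hcon
  -- The balance at the vertex `r e`: without outgoing flow it is a vanishing sum of non-negative
  -- terms, one of which is at least `k e`.
  have h := hk fun a => if a = r e then 1 else 0
  have h1 : ∀ e', (k e' : ℂ) * ((if r e' = r e then 1 else 0) - if l e' = r e then 1 else 0) =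
      ((k e' * if r e' = r e then 1 else 0 : ℤ) : ℂ) := by
    intro e'
    by_cases h' : l e' = r e
    · simp [hcon e' h']
    · simp [h']
  rw [Finset.sum_congr rfl fun e' _ => h1 e', ← Int.cast_sum, Int.cast_eq_zero,
    Finset.sum_eq_zero_iff_of_nonneg fun e' _ => mul_nonneg (hk0 e') (by split_ifs <;> simp)] at h
  simpa [he] using h e (Finset.mem_univ e)

/-! ### Regions of faces and their fillings. -/

variable (L R : E → O) (o : O)

/-- The face `F` is connected to the face `o` by crossing edges outside `S`. -/
def Outside (S : Set O) (F : O) : Prop :=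
  ∀ X : O → Prop, X o → (∀ e, L e ∉ S → R e ∉ S → (X (L e) ↔ X (R e))) → X F

/-- A set of faces is monotone if its boundary edges all have it on the same side. -/
def MonotoneFaces (S : Set O) : Prop :=
  (∀ e, R e ∈ S → L e ∈ S) ∨ (∀ e, L e ∈ S → R e ∈ S)

/-- A non-empty monotone set of faces whose complement is connected and contains `o`. -/
structure IsFilledRegion (S : Set O) : Prop where
  nonempty : S.Nonempty
  notMem : o ∉ S
  monotone : MonotoneFaces L R S
  filled : ∀ F, F ∉ S → Outside L R o S F

variable {L R o}

/-- Add to `S` every face that cannot be reached from `o` without entering `S`. An edge outside `S`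
never separates reachable from unreachable faces, so no boundary edge is created and monotonicity
persists. If `T` is filled and contains `S`, the complement of `T` is reachable outside `T`, hence
outside `S`. -/
theorem exists_fill {S : Set O} (hS : S.Nonempty) (ho : o ∉ S) (hm : MonotoneFaces L R S) :
    ∃ S', IsFilledRegion L R o S' ∧ (∀ e, ¬ (L e ∈ S' ↔ R e ∈ S') → ¬ (L e ∈ S ↔ R e ∈ S)) ∧
      ∀ T, S ⊆ T → IsFilledRegion L R o T → S' ⊆ T := by
  have hsub : ∀ F, Outside L R o S F → F ∉ S := fun F hF =>
    hF (fun F => F ∉ S) ho fun e h1 h2 => by simp [h1, h2]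
  have ho' : Outside L R o S o := fun X hX _ => hX
  have hstep : ∀ e, L e ∉ S → R e ∉ S → (Outside L R o S (L e) ↔ Outside L R o S (R e)) :=
    fun e h1 h2 => ⟨fun h X hX hX' => (hX' e h1 h2).1 (h X hX hX'),
      fun h X hX hX' => (hX' e h1 h2).2 (h X hX hX')⟩
  refine ⟨{F | ¬ Outside L R o S F}, ⟨?_, not_not.2 ho', ?_, ?_⟩, ?_, ?_⟩
  · obtain ⟨F, hF⟩ := hS
    exact ⟨F, fun h => hsub F h hF⟩
  · refine hm.imp (fun hm e hR hL => ?_) (fun hm e hL hR => ?_)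
    · by_cases h : R e ∈ S
      · exact hsub _ hL (hm e h)
      · exact hR ((hstep e (hsub _ hL) h).1 hL)
    · by_cases h : L e ∈ S
      · exact hsub _ hR (hm e h)
      · exact hL ((hstep e h (hsub _ hR)).2 hR)
  · intro F hF X hX hX'
    refine (not_not.1 hF (fun F => Outside L R o S F ∧ X F) ⟨ho', hX⟩ fun e h1 h2 => ?_).2
    constructor
    · rintro ⟨h3, h4⟩
      have h5 := (hstep e h1 h2).1 h3
      exact ⟨h5, (hX' e (not_not.2 h3) (not_not.2 h5)).1 h4⟩
    · rintro ⟨h3, h4⟩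
      have h5 := (hstep e h1 h2).2 h3
      exact ⟨h5, (hX' e (not_not.2 h5) (not_not.2 h3)).2 h4⟩
  · intro e h1 h2
    refine h1 (not_congr ?_)
    by_cases h : L e ∈ S
    · exact ⟨fun h' => absurd h (hsub _ h'), fun h' => absurd (h2.1 h) (hsub _ h')⟩
    · exact hstep e h (fun h' => h (h2.2 h'))
  · intro T hST hT F hF
    by_contra hFT
    refine hF fun X hX hX' => hT.filled F hFT X hX fun e h1 h2 => ?_
    exact hX' e (fun h => h1 (hST h)) (fun h => h2 (hST h))

/-- The winding numbers of a non-negative circulation have a monotone level set. -/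
theorem exists_level {c : E → ℤ} (hc0 : ∀ e, 0 ≤ c e) (hc : c ≠ 0) {f : O → ℤ} (hf : f o = 0)
    (hfc : ∀ e, f (L e) - f (R e) = c e) :
    ∃ S : Set O, S.Nonempty ∧ o ∉ S ∧ MonotoneFaces L R S ∧ (∀ F ∈ S, f F ≠ 0) ∧
      ∀ e, ¬ (L e ∈ S ↔ R e ∈ S) → c e ≠ 0 := by
  have hce : ∀ S : ℤ → Prop, ∀ e, ¬ (S (f (L e)) ↔ S (f (R e))) → c e ≠ 0 := by
    intro S e h h0
    have := hfc e
    rw [h0, sub_eq_zero] at this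
    exact h (by rw [this])
  -- Since `c` is non-negative, `f` does not decrease from right to left: `f > 0` is inherited by
  -- left faces and `f < 0` by right ones.
  by_cases hpos : ∃ F, 0 < f F
  · refine ⟨{F | 0 < f F}, hpos, by simp [hf], Or.inl fun e he => ?_, fun F hF => ne_of_gt hF,
      hce (fun n => 0 < n)⟩
    have h1 := hfc e
    have h2 := hc0 e
    have h3 : 0 < f (R e) := he
    exact (show 0 < f (L e) by omega)
  · push Not at hpos
    have hneg : ∃ F, f F < 0 := by
      by_contra! hneg
      refine hc (funext fun e => ?_)
      have h1 := hfc e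
      have h2 := hpos (L e)
      have h3 := hpos (R e)
      have h4 := hneg (L e)
      have h5 := hneg (R e)
      change c e = 0
      omega
    refine ⟨{F | f F < 0}, hneg, by simp [hf], Or.inr fun e he => ?_, fun F hF => ne_of_lt hF,
      hce (fun n => n < 0)⟩
    have h1 := hfc e
    have h2 := hc0 e
    have h3 : f (L e) < 0 := he
    exact (show f (R e) < 0 by omega)

/-- Every edge that touches a region is followed by another one. -/
theorem exists_next [Fintype E] {l r : E → V} {S : Set O} (ho : o ∉ S) {k : E → ℤ}
    (hk : IsCirculation l r k) (hk0 : ∀ e, 0 ≤ k e)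
    (hkS : ∀ e, k e ≠ 0 ↔ ¬ (L e ∈ S ↔ R e ∈ S))
    (hloc : ∀ a, (∀ e, l e = a ∨ r e = a → k e = 0) → ∀ e e', (l e = a ∨ r e = a) →
      (l e' = a ∨ r e' = a) → L e ∈ S → L e' ∈ S)
    (hsink : ∀ a, (∀ e, l e ≠ a) → ∃ e, r e = a ∧ (L e = o ∨ R e = o)) {e : E}
    (he : L e ∈ S ∨ R e ∈ S) : ∃ e', (L e' ∈ S ∨ R e' ∈ S) ∧ l e' = r e := by
  have htouch : ∀ e, k e ≠ 0 → L e ∈ S ∨ R e ∈ S := by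
    intro e he
    have := (hkS e).1 he
    tauto
  have hzero : ∀ e, k e = 0 → (L e ∈ S ↔ R e ∈ S) := fun e h => by
    by_contra h'
    exact (hkS e).2 h' h
  -- If the boundary passes through the vertex, conservation of `k` supplies an outgoing boundary
  -- edge. Otherwise every edge at the vertex has both of its faces in `S`; the vertex is no sink
  -- then, since a sink has an edge on the face `o`.
  by_cases hex : ∃ e', (l e' = r e ∨ r e' = r e) ∧ k e' ≠ 0
  · obtain ⟨e', he' | he', hke'⟩ := hex
    · exact ⟨e', htouch _ hke', he'⟩
    · obtain ⟨e'', h1, h2⟩ := exists_out_of_circulation hk hk0 hke'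
      exact ⟨e'', htouch _ h2, h1.trans he'⟩
  · push Not at hex
    have hLe : L e ∈ S := he.elim id fun h => (hzero e (hex e (Or.inr rfl))).2 h
    have hall : ∀ e', (l e' = r e ∨ r e' = r e) → L e' ∈ S := fun e' he' =>
      hloc (r e) hex e e' (Or.inr rfl) he' hLe
    by_cases hout : ∃ e', l e' = r e
    · obtain ⟨e', he'⟩ := hout
      exact ⟨e', Or.inl (hall e' (Or.inl he')), he'⟩
    · push Not at hout
      obtain ⟨e', he', h⟩ := hsink _ hout
      have h1 := hall e' (Or.inr he')
      have h2 := (hzero e' (hex e' (Or.inr he'))).1 h1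
      rcases h with h | h
      · exact absurd (h ▸ h1) ho
      · exact absurd (h ▸ h2) ho

open Classical in
/-- A plane graph all of whose interior faces have edges on both sides and all of whose sources and
sinks lie on the exterior face has no directed cycles. -/
theorem eq_zero_of_nonneg_circulation [Fintype E] [Finite O] {l r : E → V}
    (hw : ∀ c, IsCirculation l r c → ∃ w : O → ℤ, w o = 0 ∧ (∀ e, w (L e) - w (R e) = c e) ∧
      ∀ a, (∀ e, l e = a ∨ r e = a → c e = 0) → ∀ e e', (l e = a ∨ r e = a) →
        (l e' = a ∨ r e' = a) → w (L e) = w (L e'))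
    (hbd : ∀ f : O → ℤ, IsCirculation l r fun e => f (L e) - f (R e))
    (hconn : ∀ f : O → ℤ, (∀ e, f (L e) = f (R e)) → ∀ X, f X = f o)
    (hdom : ∀ X, X ≠ o → ∃ e, R e = X) (hcod : ∀ X, X ≠ o → ∃ e, L e = X)
    (hsink : ∀ a, (∀ e, l e ≠ a) → ∃ e, r e = a ∧ (L e = o ∨ R e = o))
    (hsource : ∀ a, (∀ e, r e ≠ a) → ∃ e, l e = a ∧ (L e = o ∨ R e = o))
    {c : E → ℤ} (hc : IsCirculation l r c) (hc0 : ∀ e, 0 ≤ c e) : c = 0 := by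
  by_contra hne
  obtain ⟨S, hS, hmin⟩ : ∃ S, IsFilledRegion L R o S ∧
      ∀ T, IsFilledRegion L R o T → T ⊆ S → T = S := by
    obtain ⟨f, hf, hfc, -⟩ := hw c hc
    obtain ⟨S₁, h1, h2, h3, -, -⟩ := exists_level (L := L) (R := R) hc0 hne hf hfc
    obtain ⟨S₂, hS₂, -⟩ := exists_fill h1 h2 h3
    obtain ⟨S, hS, hm⟩ := (Set.toFinite {S | IsFilledRegion L R o S}).exists_minimal ⟨S₂, hS₂⟩
    exact ⟨S, hS, fun T hT hTS => hTS.antisymm (hm hT hTS)⟩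
  -- the boundary of `S` as a non-negative circulation
  let ind : O → ℤ := fun F => if F ∈ S then 1 else 0
  have hind : ∀ F, ind F = if F ∈ S then 1 else 0 := fun F => rfl
  obtain ⟨k, hk, hkv⟩ : ∃ k : E → ℤ, IsCirculation l r k ∧
      ∀ e, k e = if (L e ∈ S ↔ R e ∈ S) then 0 else 1 := by
    rcases hS.monotone with hm | hm
    · refine ⟨_, hbd ind, fun e => ?_⟩
      have := hm e
      simp only [hind]
      by_cases h1 : L e ∈ S <;> by_cases h2 : R e ∈ S <;> simp_all
    · refine ⟨_, hbd fun F => - ind F, fun e => ?_⟩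
      have := hm e
      simp only [hind]
      by_cases h1 : L e ∈ S <;> by_cases h2 : R e ∈ S <;> simp_all
  have hk0 : ∀ e, 0 ≤ k e := fun e => by rw [hkv]; split_ifs <;> simp
  have hkS : ∀ e, k e ≠ 0 ↔ ¬ (L e ∈ S ↔ R e ∈ S) := fun e => by
    rw [hkv]
    split_ifs with h <;> simp [h]
  have hloc : ∀ a, (∀ e, l e = a ∨ r e = a → k e = 0) → ∀ e e', (l e = a ∨ r e = a) →
      (l e' = a ∨ r e' = a) → L e ∈ S → L e' ∈ S := by
    intro a ha e e' he he' heS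
    obtain ⟨f, hf, hfc, hfl⟩ := hw _ (hbd ind)
    -- Both functions have the same jumps and vanish at `o`.
    have hfi : ∀ X, f X = ind X := fun X => by
      have h1 := hconn (fun X => f X - ind X) (fun e => by linarith [hfc e]) X
      have h2 : ind o = 0 := if_neg hS.notMem
      rw [hf, h2] at h1
      linarith
    have := hfl a (fun e he => ?_) e e' he he'
    · rw [hfi, hfi, hind, hind, if_pos heS] at this
      by_contra h
      rw [if_neg h] at this
      exact one_ne_zero this
    · have h1 : (L e ∈ S ↔ R e ∈ S) := by
        by_contra h'
        exact (hkS e).2 h' (ha e he)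
      simp [hind, h1]
  -- A circulation that lives on edges touching `S` does not wind around faces outside `S`, which
  -- are joined to `o` across edges it avoids. Its level set thus lies in `S`, and the filling is
  -- all of `S` by minimality; so the circulation uses every boundary edge.
  have hmeet : ∀ c : E → ℤ, IsCirculation l r c → (∀ e, 0 ≤ c e) → c ≠ 0 →
      (∀ e, c e ≠ 0 → L e ∈ S ∨ R e ∈ S) → ∀ e, ¬ (L e ∈ S ↔ R e ∈ S) → c e ≠ 0 := by
    intro c hc hc0 hne hcS e he
    obtain ⟨f, hf, hfc, -⟩ := hw c hc
    have hfS : ∀ F, F ∉ S → f F = 0 := fun F hF =>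
      hS.filled F hF (fun F => f F = 0) hf fun e h1 h2 => by
        have h3 : c e = 0 := by
          by_contra h3
          exact (hcS e h3).elim h1 h2
        have h4 := hfc e
        rw [h3, sub_eq_zero] at h4
        rw [h4]
    obtain ⟨S₁, h1, h2, h3, h4, h5⟩ := exists_level (L := L) (R := R) hc0 hne hf hfc
    obtain ⟨S₂, hS₂, h6, h7⟩ := exists_fill h1 h2 h3
    have h8 : S₂ = S := hmin S₂ hS₂ (h7 S (fun F hF => by
      by_contra hFS
      exact h4 F hF (hfS F hFS)) hS)
    subst h8
    exact h5 e (h6 e he)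
  obtain ⟨g, hg⟩ : ∃ g, ¬ (L g ∈ S ↔ R g ∈ S) := by
    by_contra! hall
    obtain ⟨F, hF⟩ := hS.nonempty
    have := hconn ind (fun e => by simp [hind, hall e]) F
    rw [hind, hind, if_pos hF, if_neg hS.notMem] at this
    exact one_ne_zero this
  set E' : Set E := {e | L e ∈ S ∨ R e ∈ S} with hE'
  have hgE : g ∈ E' := by
    change L g ∈ S ∨ R g ∈ S
    tauto
  -- no edge has the region on both sides
  have hbdry : ∀ e ∈ E', ¬ (L e ∈ S ↔ R e ∈ S) := by
    intro f hf hfS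
    -- Walking forward from `f` closes up in a cycle, which uses `g` by `hmeet`: this is a flow from
    -- `f` to `g`. Reversing all edges yields the flow back.
    obtain ⟨c₁, h1, h2, h3, h4, h5⟩ := exists_cycle_of_next (l := l) (r := r) (E' := E')
      (fun e he => exists_next hS.notMem hk hk0 hkS hloc hsink he) hf
    have hfg := h5 g (hmeet c₁ h1 h2 h3 h4 g hg)
    obtain ⟨c₂, h1, h2, h3, h4, h5⟩ := exists_cycle_of_next (l := r) (r := l) (E' := E')
      (fun e he => exists_next hS.notMem hk.swap hk0 hkS
        (fun a ha e e' he he' => hloc a (fun e he => ha e he.symm) e e' he.symm he'.symm)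
        hsource he) hf
    have hgf := (h5 g (hmeet c₂ h1.swap h2 h3 h4 g hg)).swap
    obtain ⟨x, hx0, hxE, hxφ⟩ := (hfg.trans (EdgeFlow.edge hgE)).trans hgf
    -- the closed walk through `f` and `g`
    let y : E → ℤ := x + Pi.single f 1
    have hy : IsCirculation l r y := fun φ => by
      simp only [y, Pi.add_apply, Int.cast_add, add_mul, Finset.sum_add_distrib]
      rw [hxφ, sum_single_mul f fun e => φ (r e) - φ (l e)]
      ring
    have hy0 : ∀ e, 0 ≤ y e := fun e => add_nonneg (hx0 e) (single_nonneg f e)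
    have hyE : ∀ e, y e ≠ 0 → e ∈ E' := by
      intro e he
      by_cases h : x e = 0
      · by_cases h' : e = f
        · exact h' ▸ hf
        · exact absurd (by simp [y, h, h']) he
      · exact hxE e h
    have hyf : 0 < y f := by
      have := hx0 f
      simp only [y, Pi.add_apply, Pi.single_eq_same]
      omega
    -- Removing from `y` the boundary `k`, as often as its least value on boundary edges allows,
    -- empties `g'` but keeps `f`, which is not on the boundary. The remainder contradicts `hmeet`.
    obtain ⟨g', hg', hg'min⟩ := (Set.toFinite {e | ¬ (L e ∈ S ↔ R e ∈ S)}).exists_minimalFor y _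
      ⟨g, hg⟩
    have hmin' : ∀ e, ¬ (L e ∈ S ↔ R e ∈ S) → y g' ≤ y e := fun e he =>
      (le_total (y g') (y e)).elim id (fun h => hg'min he h)
    have hkf : k f = 0 := by rw [hkv, if_pos hfS]
    refine hmeet (fun e => y e - y g' * k e) (fun φ => ?_) (fun e => ?_) (fun h0 => ?_)
      (fun e he => ?_) g' hg' ?_
    · have h1 := hy φ
      have h2 := hk φ
      push_cast
      simp only [sub_mul, Finset.sum_sub_distrib]
      rw [h1, zero_sub, neg_eq_zero]
      simp only [mul_assoc]
      rw [← Finset.mul_sum, h2, mul_zero]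
    · rw [hkv]
      split_ifs with h
      · rw [mul_zero, sub_zero]
        exact hy0 e
      · rw [mul_one]
        exact sub_nonneg.2 (hmin' e h)
    · have := congrFun h0 f
      simp only [hkf, mul_zero, sub_zero, Pi.zero_apply] at this
      omega
    · by_cases h : k e = 0
      · rw [h, mul_zero, sub_zero] at he
        exact hyE e he
      · have := (hkS e).1 h
        tauto
    · rw [hkv, if_neg hg', mul_one, sub_self]
  obtain ⟨F, hF⟩ := hS.nonempty
  have hFo : F ≠ o := fun h => hS.notMem (h ▸ hF)
  rcases hS.monotone with hm | hm
  · obtain ⟨e, he⟩ := hdom F hFo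
    have h1 : R e ∈ S := he ▸ hF
    exact hbdry e (Or.inr h1) ⟨fun _ => h1, fun _ => hm e h1⟩
  · obtain ⟨e, he⟩ := hcod F hFo
    have h1 : L e ∈ S := he ▸ hF
    exact hbdry e (Or.inl h1) ⟨fun _ => hm e h1, fun _ => h1⟩

end Acyclicity

/-! ## Paths and their edges -/

namespace Quiver.Path

variable {V : Type u} [Quiver.{v} V]

theorem edgeSet_cons {a b c : V} (p : Path a b) (e : b ⟶ c) :
    (p.cons e).edgeSet = insert ⟨_, _, e⟩ p.edgeSet := rfl

theorem edgeSet_comp {a b c : V} (p : Path a b) (q : Path b c) :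
    (p.comp q).edgeSet = p.edgeSet ∪ q.edgeSet := by
  induction q with
  | nil => simp [edgeSet]
  | cons q e ih => rw [comp_cons, edgeSet_cons, edgeSet_cons, ih, Set.union_insert]

theorem edgeSet_nonempty {a b : V} {p : Path a b} (hp : p.length ≠ 0) : p.edgeSet.Nonempty := by
  cases p with
  | nil => exact absurd rfl hp
  | cons p e => exact ⟨_, Set.mem_insert _ _⟩

theorem right_mem_vertices {a b : V} {p : Path a b} {e : Total V} (he : e ∈ p.edgeSet) :
    e.right ∈ p.vertices := by
  induction p with
  | nil => exact he.elim
  | cons p f ih =>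
    rw [mem_vertices_cons]
    rcases he with rfl | he
    · exact Or.inr rfl
    · exact Or.inl (ih he)

theorem left_mem_vertices {a b : V} {p : Path a b} {e : Total V} (he : e ∈ p.edgeSet) :
    e.left ∈ p.vertices := by
  induction p with
  | nil => exact he.elim
  | cons p f ih =>
    rw [mem_vertices_cons]
    rcases he with rfl | he
    · exact Or.inl p.end_mem_vertices
    · exact Or.inl (ih he)

open Classical in
/-- The number of times that a path traverses an edge. -/
noncomputable def edgeCount {a : V} : ∀ {b : V}, Path a b → Total V → ℤ
  | _, .nil => 0
  | _, .cons p e => p.edgeCount + Pi.single ⟨_, _, e⟩ 1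

open Classical in
theorem edgeCount_cons {a b c : V} (p : Path a b) (e : b ⟶ c) :
    (p.cons e).edgeCount = p.edgeCount + Pi.single ⟨_, _, e⟩ 1 := rfl

theorem edgeCount_comp {a b c : V} (p : Path a b) (q : Path b c) :
    (p.comp q).edgeCount = p.edgeCount + q.edgeCount := by
  induction q with
  | nil => simp [edgeCount]
  | cons q e ih => rw [comp_cons, edgeCount_cons, edgeCount_cons, ih, add_assoc]

theorem edgeCount_nonneg {a b : V} (p : Path a b) (e : Total V) : 0 ≤ p.edgeCount e := by
  classical
  induction p with
  | nil => exact le_rfl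
  | cons p f ih => exact add_nonneg ih (single_nonneg _ _)

theorem edgeCount_of_notMem {a b : V} {p : Path a b} {e : Total V} (he : e ∉ p.edgeSet) :
    p.edgeCount e = 0 := by
  classical
  induction p with
  | nil => rfl
  | cons p f ih =>
    rw [edgeSet_cons, Set.mem_insert_iff, not_or] at he
    rw [edgeCount_cons, Pi.add_apply, ih he.2, Pi.single_eq_of_ne he.1, add_zero]

theorem edgeCount_of_nodup {a b : V} {p : Path a b} (hp : p.vertices.Nodup) {e : Total V}
    (he : e ∈ p.edgeSet) : p.edgeCount e = 1 := by
  classical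
  induction p with
  | nil => exact he.elim
  | cons p f ih =>
    rw [vertices_cons, List.concat_eq_append, List.nodup_append] at hp
    rw [edgeCount_cons, Pi.add_apply]
    rcases he with rfl | he
    · rw [Pi.single_eq_same, edgeCount_of_notMem, zero_add]
      intro h
      exact hp.2.2 _ (right_mem_vertices h) _ (List.mem_singleton_self _) rfl
    · rw [ih hp.1 he, Pi.single_eq_of_ne, add_zero]
      rintro rfl
      exact hp.2.2 _ (right_mem_vertices he) _ (List.mem_singleton_self _) rfl

theorem sum_edgeCount [Fintype (Total V)] {a b : V} (p : Path a b) (φ : V → ℂ) :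
    ∑ e, (p.edgeCount e : ℂ) * (φ e.right - φ e.left) = φ b - φ a := by
  classical
  induction p with
  | nil => simp [edgeCount]
  | cons p f ih =>
    simp only [edgeCount_cons, Pi.add_apply, Int.cast_add, add_mul, Finset.sum_add_distrib]
    rw [ih, sum_single_mul _ fun e : Total V => φ e.right - φ e.left]
    ring

/-- Two factorizations of the same path have a common refinement. -/
theorem comp_eq_comp {a b b' c : V} {p : Path a b} {q : Path b c} {p' : Path a b'}
    {q' : Path b' c} (h : p.comp q = p'.comp q') :
    (∃ m : Path b b', p' = p.comp m ∧ q = m.comp q') ∨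
      ∃ m : Path b' b, p = p'.comp m ∧ q' = m.comp q := by
  induction q with
  | nil => exact Or.inr ⟨q', h, rfl⟩
  | cons q e ih =>
    cases q' with
    | nil => exact Or.inl ⟨q.cons e, h.symm, rfl⟩
    | cons q' e' =>
      rw [comp_cons, comp_cons] at h
      obtain rfl := obj_eq_of_cons_eq_cons h
      obtain rfl := eq_of_heq (hom_heq_of_cons_eq_cons h)
      rcases ih (eq_of_heq (heq_of_cons_eq_cons h)) with ⟨m, h1, h2⟩ | ⟨m, h1, h2⟩
      · exact Or.inl ⟨m, h1, by rw [h2, comp_cons]⟩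
      · exact Or.inr ⟨m, h1, by rw [h2, comp_cons]⟩

/-- Two edge-disjoint subpaths of a path come one after the other. -/
theorem disjoint_subpaths {a b s t s' t' : V} {r : Path a s} {d : Path s t} {q : Path t b}
    {r' : Path a s'} {d' : Path s' t'} {q' : Path t' b}
    (h : r.comp (d.comp q) = r'.comp (d'.comp q')) (hdd : Disjoint d.edgeSet d'.edgeSet)
    (hd : d.length ≠ 0) (hd' : d'.length ≠ 0) :
    (∃ m : Path t s', r' = r.comp (d.comp m) ∧ q = m.comp (d'.comp q')) ∨
      ∃ m : Path t' s, r = r'.comp (d'.comp m) ∧ q' = m.comp (d.comp q) := by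
  have key : ∀ {s t s' t' : V} {r : Path a s} {d : Path s t} {q : Path t b}
      {d' : Path s' t'} {q' : Path t' b}, Disjoint d.edgeSet d'.edgeSet → d'.length ≠ 0 →
      ∀ m₀ : Path s s', d.comp q = m₀.comp (d'.comp q') →
      ∃ m : Path t s', r.comp m₀ = r.comp (d.comp m) ∧ q = m.comp (d'.comp q') := by
    intro s t s' t' r d q d' q' hdd hd' m₀ h
    rcases comp_eq_comp h with ⟨m, rfl, h2⟩ | ⟨m, rfl, h2⟩
    · exact ⟨m, rfl, h2⟩
    -- Here `d'` begins before `d` ends. Either `d'` lies inside `d`, or the overlap `m` is a common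
    -- part of both; disjointness rules out the former and makes `m` trivial.
    · rw [edgeSet_comp] at hdd
      rcases comp_eq_comp h2 with ⟨x, rfl, -⟩ | ⟨x, rfl, h3⟩
      · rw [edgeSet_comp] at hdd
        obtain ⟨e, he⟩ := edgeSet_nonempty hd'
        exact absurd (Set.disjoint_left.1 hdd (Or.inr (Or.inl he)) he) not_false
      · rw [edgeSet_comp] at hdd
        have hm : m.length = 0 := by
          by_contra hm
          obtain ⟨e, he⟩ := edgeSet_nonempty hm
          exact Set.disjoint_left.1 hdd (Or.inr he) (Or.inl he)
        cases m with
        | nil => exact ⟨nil, rfl, by simpa using h2.symm⟩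
        | cons m e => exact absurd hm (Nat.succ_ne_zero _)
  rcases comp_eq_comp h with ⟨m, rfl, h2⟩ | ⟨m, rfl, h2⟩
  · exact Or.inl (key hdd hd' m h2)
  · exact Or.inr (key hdd.symm hd m h2)

end Quiver.Path

/-- A quiver without directed cycles. -/
def AcyclicQuiver (V : Type u) [Quiver.{v} V] : Prop :=
  ∀ (a : V) (p : Quiver.Path a a), p = Quiver.Path.nil

/-- The piece between the two cuts is a closed path at `b`, hence trivial. -/
theorem AcyclicQuiver.comp_inj {V : Type u} [Quiver.{v} V] (hV : AcyclicQuiver V) {a b c : V}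
    {p p' : Quiver.Path a b} {q q' : Quiver.Path b c} (h : p.comp q = p'.comp q') :
    p = p' ∧ q = q' := by
  rcases Quiver.Path.comp_eq_comp h with ⟨m, h1, h2⟩ | ⟨m, h1, h2⟩
  · rw [hV _ m] at h1 h2
    exact ⟨by simpa using h1.symm, by simpa using h2⟩
  · rw [hV _ m] at h1 h2
    exact ⟨by simpa using h1, by simpa using h2.symm⟩

/-! ## Computads of pasting schemes -/

/-- The combinatorial properties of the computad of a pasting scheme: there are no directed cycles,
the source paths are non-empty and edge-disjoint, and the boundaries of the atomic 2-cells are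
linearly independent. -/
structure Computad.IsPlanar {V : Type u} [Quiver.{v} V] (K : Computad.{u, v, w} V) : Prop where
  acyclic : AcyclicQuiver V
  dom_length : ∀ F, (K.bd F).dom.length ≠ 0
  dom_disjoint : ∀ F G, F ≠ G → Disjoint (K.bd F).dom.edgeSet (K.bd G).dom.edgeSet
  independent : ∀ n : K.Cell →₀ ℤ, (∀ e, n.sum (fun F m =>
    m * ((K.bd F).cod.edgeCount e - (K.bd F).dom.edgeCount e)) = 0) → n = 0

namespace PastingScheme

variable {V : Type u} [Quiver.{v} V] (P : PastingScheme V)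

-- The edge count of a closed path is a non-negative circulation, hence zero. Source paths are
-- disjoint because an edge has only one face on its right. A relation `∑ n F * ∂F = 0` says that
-- `n`, extended by 0 to the exterior face, has no jumps, so it is constantly 0.
open Classical in
theorem isPlanar : P.computad.IsPlanar := by
  have := P.finite_vertices
  have := P.finite_edges
  have := Fintype.ofFinite (Quiver.Total V)
  have hne : Nonempty V := ⟨P.exterior.src⟩
  have hfin := PlaneGraph.finite_interiorFace (G := P.toPlaneGraph) P.connected
  obtain ⟨L, R, hL, hR, hw, hbd, hconn⟩ :=
    PlaneGraph.exists_side_functions (G := P.toPlaneGraph) P.connected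
  obtain ⟨L', hL'⟩ : ∃ L' : Quiver.Total V → Option P.computad.Cell, L' = L := ⟨L, rfl⟩
  obtain ⟨R', hR'⟩ : ∃ R' : Quiver.Total V → Option P.computad.Cell, R' = R := ⟨R, rfl⟩
  have hdom : ∀ (F : P.computad.Cell) e, e ∈ (P.interior F).dom.edgeSet ↔ R' e = some F := by
    intro F e
    rw [← (P.anchors_interior F).dom.1]
    exact hR' ▸ hR e (some F)
  have hcod : ∀ (F : P.computad.Cell) e, e ∈ (P.interior F).cod.edgeSet ↔ L' e = some F := by
    intro F e
    rw [← (P.anchors_interior F).cod.1]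
    exact hL' ▸ hL e (some F)
  refine ⟨fun a p => ?_, fun F => (P.anchors_interior F).dom.2.1, fun F G hFG => ?_,
    fun n hn => ?_⟩
  · by_contra hp
    have hlen : p.length ≠ 0 := fun h => hp (p.eq_nil_of_length_zero h)
    have h0 : p.edgeCount = 0 := by
      refine eq_zero_of_nonneg_circulation (o := none) hw hbd hconn (fun X hX => ?_)
        (fun X hX => ?_) (fun b hb => ?_) (fun b hb => ?_)
        (fun φ => by rw [p.sum_edgeCount, sub_self]) p.edgeCount_nonneg
      · obtain ⟨F, rfl⟩ := Option.ne_none_iff_exists'.1 hX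
        obtain ⟨e, he⟩ := Quiver.Path.edgeSet_nonempty (P.anchors_interior F).dom.2.1
        exact ⟨e, hR' ▸ (hdom F e).1 he⟩
      · obtain ⟨F, rfl⟩ := Option.ne_none_iff_exists'.1 hX
        obtain ⟨e, he⟩ := Quiver.Path.edgeSet_nonempty (P.anchors_interior F).cod.2.1
        exact ⟨e, hL' ▸ (hcod F e).1 he⟩
      -- The only sink is the exterior target, where the last edge of the exterior source path has
      -- the exterior face on its left.
      · obtain rfl := (P.local_sink b).1 fun c => ⟨fun e => hb ⟨b, c, e⟩ rfl⟩
        have hd := P.anchors_exterior.dom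
        obtain ⟨c, q, e, he⟩ := (Quiver.Path.length_ne_zero_iff_eq_cons _).1 hd.2.1
        refine ⟨⟨c, _, e⟩, rfl, Or.inl ((hL _ none).1 ?_)⟩
        have : (⟨c, _, e⟩ : Quiver.Total V) ∈ P.exterior.dom.edgeSet := by
          rw [he]
          exact Set.mem_insert _ _
        rw [← hd.1] at this
        exact this
      · obtain rfl := (P.local_source b).1 fun c => ⟨fun e => hb ⟨c, b, e⟩ rfl⟩
        have hd := P.anchors_exterior.dom
        obtain ⟨c, e, q, he, -⟩ := (Quiver.Path.length_ne_zero_iff_eq_comp _).1 hd.2.1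
        refine ⟨⟨_, c, e⟩, rfl, Or.inl ((hL _ none).1 ?_)⟩
        have : (⟨_, c, e⟩ : Quiver.Total V) ∈ P.exterior.dom.edgeSet := by
          rw [he, Quiver.Path.edgeSet_comp]
          exact Or.inl (Set.mem_insert _ _)
        rw [← hd.1] at this
        exact this
    cases p with
    | nil => exact hp rfl
    | cons p e =>
      have h1 := congrFun h0 ⟨_, _, e⟩
      rw [Quiver.Path.edgeCount_cons, Pi.add_apply, Pi.single_eq_same, Pi.zero_apply] at h1
      have := p.edgeCount_nonneg ⟨_, _, e⟩
      omega
  · rw [Set.disjoint_left]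
    intro e he he'
    exact hFG (Option.some_injective _ (((hdom F e).1 he).symm.trans ((hdom G e).1 he')))
  · have hcount : ∀ {a b : V} (S : Set (Quiver.Total V)) (p : Quiver.Path a b),
        PlaneGraph.Forms S p → ∀ e, p.edgeCount e = if e ∈ p.edgeSet then 1 else 0 := by
      intro a b S p hp e
      split_ifs with h
      · exact Quiver.Path.edgeCount_of_nodup hp.2.2 h
      · exact Quiver.Path.edgeCount_of_notMem h
    let f : Option P.computad.Cell → ℤ := fun X => X.elim 0 n
    have hsum : ∀ X : Option P.computad.Cell,
        n.sum (fun F m => m * if X = some F then 1 else 0) = f X := by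
      rintro (_ | G)
      · simp [f]
      · have h1 : ∀ F m, m * (if (some G : Option P.computad.Cell) = some F then (1 : ℤ) else 0) =
            if G = F then m else 0 := fun F m => by
          by_cases h : G = F <;> simp [h]
        simp only [h1, f, Option.elim_some]
        exact Finsupp.sum_ite_self_eq n G
    have hf : ∀ e, f (L' e) = f (R' e) := fun e => by
      have h1 := hn e
      simp only [mul_sub, Finsupp.sum_sub] at h1
      refine (hsum (L' e)).symm.trans (Eq.trans ?_ (hsum (R' e)))
      refine sub_eq_zero.1 (Eq.trans ?_ h1)
      congr 1
      · refine Finsupp.sum_congr fun F _ => ?_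
        congr 1
        rw [show (P.computad.bd F).cod.edgeCount e = _ from
          hcount _ _ (P.anchors_interior F).cod e]
        by_cases h : L' e = some F
        · rw [if_pos h, if_pos ((hcod F e).2 h)]
        · rw [if_neg h, if_neg fun h' => h ((hcod F e).1 h')]
      · refine Finsupp.sum_congr fun F _ => ?_
        congr 1
        rw [show (P.computad.bd F).dom.edgeCount e = _ from
          hcount _ _ (P.anchors_interior F).dom e]
        by_cases h : R' e = some F
        · rw [if_pos h, if_pos ((hdom F e).2 h)]
        · rw [if_neg h, if_neg fun h' => h ((hdom F e).1 h')]
    subst hL' hR'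
    exact Finsupp.ext fun F => hconn f hf (some F)

end PastingScheme

/-! ## The hom-categories are posets -/

namespace Computad

variable {V : Type u} [Quiver.{v} V] {K : Computad.{u, v, w} V} {a b : V}

/-- The number of times that a formal vertical composite uses each atomic 2-cell. -/
noncomputable def Derivation.count : ∀ {p q : Quiver.Path a b}, K.Derivation p q → K.Cell →₀ ℤ
  | _, _, .nil _ => 0
  | _, _, .cons s d => Finsupp.single s.cell 1 + d.count

theorem Derivation.count_nonneg {p q : Quiver.Path a b} (d : K.Derivation p q) (F : K.Cell) :
    0 ≤ d.count F := by
  classical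
  induction d with
  | nil => exact le_rfl
  | cons s d ih =>
    rw [count, Finsupp.add_apply, Finsupp.single_apply]
    split_ifs <;> omega

theorem Derivation.count_append {p q r : Quiver.Path a b} (d : K.Derivation p q)
    (d' : K.Derivation q r) : (d.append d').count = d.count + d'.count := by
  induction d with
  | nil => exact (zero_add _).symm
  | cons s d ih => rw [append, count, count, ih, add_assoc]

theorem Derivation.count_cons_self {p q r : Quiver.Path a b} (s : K.Step p q)
    (d : K.Derivation q r) : 0 < (Derivation.cons s d).count s.cell := by
  have := d.count_nonneg s.cell
  rw [count, Finsupp.add_apply, Finsupp.single_eq_same]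
  omega

theorem Derivation.eq_of_count_eq_zero {p q : Quiver.Path a b} (d : K.Derivation p q)
    (hd : d.count = 0) : p = q := by
  cases d with
  | nil => rfl
  | cons s d =>
    have := d.count_cons_self s
    rw [hd] at this
    exact absurd this (lt_irrefl _)

/-- The whiskering paths cancel in each step, and the steps telescope. -/
theorem Derivation.sum_count {p q : Quiver.Path a b} (d : K.Derivation p q)
    (e : Quiver.Total V) :
    d.count.sum (fun F m => m * ((K.bd F).cod.edgeCount e - (K.bd F).dom.edgeCount e)) =
      q.edgeCount e - p.edgeCount e := by
  induction d with
  | nil => simp [count]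
  | cons s d ih =>
    rw [count, Finsupp.sum_add_index' (fun _ => zero_mul _) (fun _ _ _ => add_mul _ _ _), ih,
      Finsupp.sum_single_index (zero_mul _), one_mul]
    have h1 := congrArg (Quiver.Path.edgeCount · e) s.src_eq
    have h2 := congrArg (Quiver.Path.edgeCount · e) s.tgt_eq
    simp only [Quiver.Path.edgeCount_comp, Pi.add_apply] at h1 h2
    rw [h1, h2]
    ring

theorem eqvGen_cons {p q r : Quiver.Path a b} (s : K.Step p q) {d d' : K.Derivation q r}
    (h : Relation.EqvGen K.Rel d d') : Relation.EqvGen K.Rel (.cons s d) (.cons s d') := by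
  induction h with
  | rel _ _ h => exact .rel _ _ (Rel.cons s h)
  | refl => exact .refl _
  | symm _ _ _ ih => exact .symm _ _ ih
  | trans _ _ _ _ _ ih ih' => exact .trans _ _ _ ih ih'

/-! ### Uniqueness of 2-cells up to interchange. -/

namespace IsPlanar

theorem count_eq (hK : K.IsPlanar) {p q : Quiver.Path a b} (d d' : K.Derivation p q) : d.count = d'.count := by
  rw [← sub_eq_zero]
  refine hK.independent _ fun e => ?_
  rw [Finsupp.sum_sub_index fun _ _ _ => sub_mul _ _ _, d.sum_count, d'.sum_count, sub_self]

theorem antisymm (hK : K.IsPlanar) {p q : Quiver.Path a b} (d : K.Derivation p q) (d' : K.Derivation q p) :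
    p = q := by
  refine d.eq_of_count_eq_zero (Finsupp.ext fun F => ?_)
  have h := DFunLike.congr_fun (hK.count_eq (d.append d') (.nil p)) F
  rw [d.count_append, Finsupp.add_apply] at h
  have h1 := d.count_nonneg F
  have h2 := d'.count_nonneg F
  change _ = (0 : ℤ) at h
  change _ = (0 : ℤ)
  omega

/-- A first step with another atomic 2-cell `G` rewrites edges disjoint from the source path of `F`,
so `F` stays applicable. By induction it comes directly after `G`, and then the two are
interchanged. -/
theorem exists_front (hK : K.IsPlanar) {p q : Quiver.Path a b} (d : K.Derivation p q) (F : K.Cell)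
    (hF : 0 < d.count F) (r : Quiver.Path a (K.bd F).src) (t : Quiver.Path (K.bd F).tgt b)
    (hp : p = r.comp ((K.bd F).dom.comp t)) :
    ∃ d' : K.Derivation (r.comp ((K.bd F).cod.comp t)) q,
      Relation.EqvGen K.Rel d (.cons ⟨F, r, t, hp, rfl⟩ d') := by
  induction d generalizing r t with
  | nil => exact absurd hF (lt_irrefl _)
  | @cons p p₁ q s d ih =>
    obtain ⟨G, r', t', h1, h2⟩ := s
    by_cases hGF : G = F
    · subst hGF
      -- By acyclicity the source path of `F` occurs at only one place in `p`, so the first step is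
      -- already the required one.
      obtain ⟨rfl, h3⟩ := hK.acyclic.comp_inj (h1.symm.trans hp)
      obtain ⟨-, rfl⟩ := hK.acyclic.comp_inj h3
      subst h2
      exact ⟨d, .refl _⟩
    · have hF' : 0 < d.count F := by
        rw [Derivation.count, Finsupp.add_apply, Finsupp.single_eq_of_ne' hGF, zero_add] at hF
        exact hF
      rcases Quiver.Path.disjoint_subpaths (h1.symm.trans hp) (hK.dom_disjoint G F hGF)
        (hK.dom_length G) (hK.dom_length F) with ⟨m, h3, h4⟩ | ⟨m, h3, h4⟩
      · have h5 : p₁ = (r'.comp ((K.bd G).cod.comp m)).comp ((K.bd F).dom.comp t) := by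
          simp [h2, h4]
        obtain ⟨d', hd'⟩ := ih hF' _ t h5
        refine ⟨.cons ⟨G, r', m.comp ((K.bd F).cod.comp t), by simp [h3], by simp⟩ d', ?_⟩
        refine .trans _ _ _ (eqvGen_cons _ hd') (.rel _ _ (Rel.swap ?_ d'))
        exact Interchange.of_eq K G F r' m t _ _ _ _ _ _ _ _ rfl h4 rfl rfl h3 rfl rfl rfl
      · have h5 : p₁ = r.comp ((K.bd F).dom.comp (m.comp ((K.bd G).cod.comp t'))) := by
          simp [h2, h3]
        obtain ⟨d', hd'⟩ := ih hF' r _ h5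
        refine ⟨.cons ⟨G, r.comp ((K.bd F).cod.comp m), t', by simp [h4], by simp⟩ d', ?_⟩
        refine .trans _ _ _ (eqvGen_cons _ hd') (.symm _ _ (.rel _ _ (Rel.swap ?_ d')))
        exact Interchange.of_eq K F G r m t' _ _ _ _ _ _ _ _ rfl h4 rfl rfl h3 rfl rfl rfl

/-- Both composites use the same atomic 2-cells. The first one used by `d` also occurs in `d'` and
applies to the common source, so it can be pulled to the front of `d'` and split off. -/
theorem eqvGen (hK : K.IsPlanar) {p q : Quiver.Path a b} (d d' : K.Derivation p q) :
    Relation.EqvGen K.Rel d d' := by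
  induction d with
  | nil p =>
    cases d' with
    | nil => exact .refl _
    | cons s d' =>
      have := d'.count_cons_self s
      rw [hK.count_eq (d'.cons s) (.nil _)] at this
      exact absurd this (lt_irrefl _)
  | cons s d ih =>
    obtain ⟨F, r, t, h1, rfl⟩ := s
    have hF := d.count_cons_self ⟨F, r, t, h1, rfl⟩
    rw [hK.count_eq _ d'] at hF
    obtain ⟨d'', hd⟩ := hK.exists_front d' F hF r t h1
    exact .trans _ _ _ (eqvGen_cons _ (ih d'')) (.symm _ _ hd)

theorem isThin (hK : K.IsPlanar) (a b : V) : Quiver.IsThin (K.FreeHom a b) := by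
  refine fun p q => ⟨?_⟩
  rintro ⟨d⟩ ⟨d'⟩
  exact Quot.eqvGen_sound (hK.eqvGen d d')

theorem isPosetCategory (hK : K.IsPlanar) (a b : V) : IsPosetCategory (K.FreeHom a b) := by
  refine ⟨hK.isThin a b, ?_⟩
  rintro ⟨p⟩ ⟨q⟩ ⟨i⟩
  obtain ⟨d, -⟩ := Quot.exists_rep i.hom
  obtain ⟨d', -⟩ := Quot.exists_rep i.inv
  exact congrArg _ (hK.antisymm d d')

end IsPlanar

end Computad

/-! ## Paths after attaching an atomic 2-cell -/

theorem Quiver.Path.exists_eq_comp_of_mem_edgeSet {V : Type u} [Quiver.{v} V] {a b : V}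
    {p : Path a b} {e : Total V} (he : e ∈ p.edgeSet) :
    ∃ (p₁ : Path a e.left) (p₂ : Path e.right b), p = (p₁.cons e.hom).comp p₂ := by
  induction p with
  | nil => exact he.elim
  | cons p f ih =>
    rcases he with rfl | he
    · exact ⟨p, nil, rfl⟩
    · obtain ⟨p₁, p₂, rfl⟩ := ih he
      exact ⟨p₁, p₂.cons f, rfl⟩

theorem Prefunctor.length_mapPath {V W : Type u} [Quiver.{v} V] [Quiver.{v} W] (φ : V ⥤q W)
    {a b : V} (p : Quiver.Path a b) : (φ.mapPath p).length = p.length := by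
  induction p with
  | nil => rfl
  | cons p e ih => exact congrArg (· + 1) ih

theorem Computad.Step.exists_of_bd_eq {V : Type u} [Quiver.{v} V] {K : Computad.{u, v, w} V}
    {a b : V} {p q : Quiver.Path a b} (s : K.Step p q) {g : Globe V} (hg : K.bd s.cell = g) :
    ∃ (pre : Quiver.Path a g.src) (post : Quiver.Path g.tgt b),
      p = pre.comp (g.dom.comp post) ∧ q = pre.comp (g.cod.comp post) := by
  subst hg
  exact ⟨_, _, s.src_eq, s.tgt_eq⟩

namespace PastingScheme.BottomAttachment

variable {V W : Type u} [Quiver.{v} V] [Quiver.{v} W] {P : PastingScheme V} {Q : PastingScheme W}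
  {x y : V} (A : P.BottomAttachment Q x y)

theorem isInteriorFace_face : Q.IsInteriorFace A.face := (A.interior_iff _).2 (Or.inr rfl)

/-- The new atomic 2-cell. -/
def newCell : Q.computad.Cell := ⟨A.face, A.isInteriorFace_face⟩

theorem bd_newCell : Q.computad.bd A.newCell =
    ⟨A.incl.obj x, A.incl.obj y, A.incl.mapPath A.bottom, A.newPath⟩ :=
  A.interior_new _

theorem newPath_length : A.newPath.length ≠ 0 := by
  have h := (Q.anchors_interior A.newCell).cod.2.1
  rwa [show Q.interior A.newCell = _ from A.bd_newCell] at h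

/-- The edges of `P`. -/
def oldEdges : Set (Quiver.Total W) :=
  Set.range fun e : Quiver.Total V => (⟨_, _, A.incl.map e.hom⟩ : Quiver.Total W)

theorem edgeSet_mapPath {a b : V} (p : Quiver.Path a b) :
    (A.incl.mapPath p).edgeSet ⊆ A.oldEdges := by
  induction p with
  | nil => exact Set.empty_subset _
  | cons p e ih => exact Set.insert_subset ⟨⟨_, _, e⟩, rfl⟩ ih

theorem disjoint_mapPath {a b : V} (p : Quiver.Path a b) :
    Disjoint (A.incl.mapPath p).edgeSet A.newPath.edgeSet := by
  rw [A.new_edges]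
  exact Set.disjoint_compl_right_iff_subset.2 (A.edgeSet_mapPath p)

theorem mapPath_injective {a b : V} {p q : Quiver.Path a b}
    (h : A.incl.mapPath p = A.incl.mapPath q) : p = q := by
  induction p with
  | nil => exact (P.isPlanar.acyclic _ q).symm
  | @cons b c p e ih =>
    cases q with
    | nil => exact P.isPlanar.acyclic _ _
    | @cons b' _ q e' =>
      obtain rfl := A.obj_injective (Quiver.Path.obj_eq_of_cons_eq_cons h)
      rw [ih (eq_of_heq (Quiver.Path.heq_of_cons_eq_cons h)),
        A.map_injective _ _ (eq_of_heq (Quiver.Path.hom_heq_of_cons_eq_cons h))]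

theorem eq_or_eq_of_mem_newPath {b : V} (hb : A.incl.obj b ∈ A.newPath.vertices) :
    b = x ∨ b = y := by
  by_contra h
  rw [not_or] at h
  have h1 : A.incl.obj b ∈ (Set.range A.incl.obj)ᶜ := by
    rw [← A.new_vertices]
    refine ⟨hb, ?_⟩
    rintro (h2 | h2)
    · exact h.1 (A.obj_injective h2)
    · exact h.2 (A.obj_injective h2)
  exact h1 ⟨b, rfl⟩

/-- The paths of `P ∪ α` which start in `P`. -/
inductive Shape (a : V) : ∀ {c : W}, Quiver.Path (A.incl.obj a) c → Prop
  | old {b : V} (p : Quiver.Path a b) : Shape a (A.incl.mapPath p)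
  | part {c : W} (r : Quiver.Path a x) (c₁ : Quiver.Path (A.incl.obj x) c)
      (c₂ : Quiver.Path c (A.incl.obj y)) (h : A.newPath = c₁.comp c₂) (h₁ : c₁.length ≠ 0)
      (h₂ : c₂.length ≠ 0) : Shape a ((A.incl.mapPath r).comp c₁)
  | through {b : V} (r : Quiver.Path a x) (t : Quiver.Path y b) :
      Shape a ((A.incl.mapPath r).comp (A.newPath.comp (A.incl.mapPath t)))

/-- Old vertices on the new path are `x` or `y`; stopping there would make `c₁` or `c₂` a closed
path, hence trivial. -/
theorem notMem_range_of_part {c : W} {c₁ : Quiver.Path (A.incl.obj x) c}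
    {c₂ : Quiver.Path c (A.incl.obj y)} (h : A.newPath = c₁.comp c₂) (h₁ : c₁.length ≠ 0)
    (h₂ : c₂.length ≠ 0) (b : V) : A.incl.obj b ≠ c := by
  rintro rfl
  have hb : A.incl.obj b ∈ A.newPath.vertices := by
    rw [h, Quiver.Path.vertices_comp]
    exact List.mem_append_right _ c₂.start_mem_vertices
  rcases A.eq_or_eq_of_mem_newPath hb with rfl | rfl
  · exact h₁ (by rw [Q.isPlanar.acyclic _ c₁]; rfl)
  · exact h₂ (by rw [Q.isPlanar.acyclic _ c₂]; rfl)

theorem shape_of_prefix {a : V} (r : Quiver.Path a x) {c : W}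
    {c₁ : Quiver.Path (A.incl.obj x) c} {c₂ : Quiver.Path c (A.incl.obj y)}
    (h : A.newPath = c₁.comp c₂) (h₁ : c₁.length ≠ 0) :
    A.Shape a ((A.incl.mapPath r).comp c₁) := by
  by_cases h₂ : c₂.length = 0
  · obtain rfl := Quiver.Path.eq_of_length_zero _ h₂
    have := Shape.through (A := A) r (Quiver.Path.nil : Quiver.Path y y)
    rw [h, Q.isPlanar.acyclic _ c₂] at this
    simpa using this
  · exact .part r c₁ c₂ h h₁ h₂

theorem Shape.cons_old {A : P.BottomAttachment Q x y} {a : V} {c c' : W}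
    {p : Quiver.Path (A.incl.obj a) c} (hp : A.Shape a p) {f : c ⟶ c'}
    (hf : (⟨c, c', f⟩ : Quiver.Total W) ∈ A.oldEdges) : A.Shape a (p.cons f) := by
  obtain ⟨⟨b, b', e⟩, he⟩ := hf
  cases hp with
  | @old b₁ p =>
    obtain ⟨h, rfl, he⟩ : A.incl.obj b = A.incl.obj b₁ ∧ A.incl.obj b' = c' ∧
        HEq (A.incl.map e) f := by simpa using he
    obtain rfl := A.obj_injective h
    obtain rfl := eq_of_heq he
    exact .old (p.cons e)
  | part r c₁ c₂ h h₁ h₂ =>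
    exact absurd (congrArg Quiver.Total.left he) (A.notMem_range_of_part h h₁ h₂ b)
  | @through b₁ r t =>
    obtain ⟨h, rfl, he⟩ : A.incl.obj b = A.incl.obj b₁ ∧ A.incl.obj b' = c' ∧
        HEq (A.incl.map e) f := by simpa using he
    obtain rfl := A.obj_injective h
    obtain rfl := eq_of_heq he
    exact .through r (t.cons e)

/-- Acyclicity forces the new edges to be traversed in order and only once: the path so far either
arrives at `x`, or stands on the new path exactly where `f` starts. A path that has already passed
through `y` could meet the start of `f` only by closing a cycle. -/
theorem Shape.cons_new {A : P.BottomAttachment Q x y} {a : V} {c c' : W}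
    {p : Quiver.Path (A.incl.obj a) c} (hp : A.Shape a p) {f : c ⟶ c'}
    {c₁ : Quiver.Path (A.incl.obj x) c} {c₂ : Quiver.Path c' (A.incl.obj y)}
    (h : A.newPath = (c₁.cons f).comp c₂) : A.Shape a (p.cons f) := by
  have hc : c ∈ A.newPath.vertices := by
    have he : (⟨c, c', f⟩ : Quiver.Total W) ∈ A.newPath.edgeSet := by
      rw [h, Quiver.Path.edgeSet_comp]
      exact Or.inl (Set.mem_insert _ _)
    exact Quiver.Path.left_mem_vertices he
  have hy : c ≠ A.incl.obj y := by
    rintro rfl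
    have := congrArg Quiver.Path.length (Q.isPlanar.acyclic _ ((f.toPath).comp c₂))
    simp at this
  cases hp with
  | @old b p =>
    rcases A.eq_or_eq_of_mem_newPath hc with rfl | rfl
    · rw [Q.isPlanar.acyclic _ c₁] at h
      simpa using A.shape_of_prefix p h (by simp)
    · exact absurd rfl hy
  | part r c₃ c₄ h' h₁ h₂ =>
    obtain rfl : c₁ = c₃ := by
      have h3 : (c₁.comp f.toPath).comp c₂ = c₃.comp c₄ := h.symm.trans h'
      rw [Quiver.Path.comp_assoc] at h3
      exact (Q.isPlanar.acyclic.comp_inj h3).1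
    simpa using A.shape_of_prefix r h (by simp)
  | @through b r t =>
    rcases A.eq_or_eq_of_mem_newPath hc with rfl | rfl
    · have h1 := congrArg Quiver.Path.length
        (Q.isPlanar.acyclic _ (A.newPath.comp (A.incl.mapPath t)))
      rw [Quiver.Path.length_comp] at h1
      exact absurd (Nat.add_eq_zero_iff.1 h1).1 A.newPath_length
    · exact absurd rfl hy

theorem shape {a : V} {c : W} (p : Quiver.Path (A.incl.obj a) c) : A.Shape a p := by
  induction p with
  | nil => exact .old .nil
  | @cons c c' p e ih =>
    by_cases he : (⟨c, c', e⟩ : Quiver.Total W) ∈ A.oldEdges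
    · exact ih.cons_old he
    · have he' : (⟨c, c', e⟩ : Quiver.Total W) ∈ A.newPath.edgeSet := by
        rw [A.new_edges]
        exact he
      obtain ⟨c₁, c₂, hc⟩ := Quiver.Path.exists_eq_comp_of_mem_edgeSet he'
      exact ih.cons_new hc

/-- The path of `P ∪ α` that runs through the whole new path. -/
def through {a b : V} (r : Quiver.Path a x) (t : Quiver.Path y b) :
    Quiver.Path (A.incl.obj a) (A.incl.obj b) :=
  (A.incl.mapPath r).comp (A.newPath.comp (A.incl.mapPath t))

theorem eq_mapPath_or_eq_through {a b : V} (p : Quiver.Path (A.incl.obj a) (A.incl.obj b)) :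
    (∃ p', p = A.incl.mapPath p') ∨ ∃ r t, p = A.through r t := by
  -- The end vertex is generalised for the case analysis on the shape; being old, it excludes paths
  -- that stop inside the new path.
  have key : ∀ {c : W} {p : Quiver.Path (A.incl.obj a) c}, A.Shape a p → c = A.incl.obj b →
      (∃ p' : Quiver.Path a b, HEq p (A.incl.mapPath p')) ∨
        ∃ (r : Quiver.Path a x) (t : Quiver.Path y b), HEq p (A.through r t) := by
    intro c p hp hc
    cases hp with
    | @old b₁ p₁ =>
      obtain rfl := A.obj_injective hc
      exact Or.inl ⟨p₁, HEq.rfl⟩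
    | part r c₁ c₂ h h₁ h₂ => exact absurd hc.symm (A.notMem_range_of_part h h₁ h₂ b)
    | through r t =>
      obtain rfl := A.obj_injective hc
      exact Or.inr ⟨r, t, HEq.rfl⟩
  rcases key (A.shape p) rfl with ⟨p', h⟩ | ⟨r, t, h⟩
  · exact Or.inl ⟨p', eq_of_heq h⟩
  · exact Or.inr ⟨r, t, eq_of_heq h⟩

theorem newPath_edgeSet_subset_through {a b : V} (r : Quiver.Path a x) (t : Quiver.Path y b) :
    A.newPath.edgeSet ⊆ (A.through r t).edgeSet := by
  rw [through, Quiver.Path.edgeSet_comp, Quiver.Path.edgeSet_comp]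
  exact fun e he => Or.inr (Or.inl he)

theorem exists_eq_mapPath {a b : V} {p : Quiver.Path (A.incl.obj a) (A.incl.obj b)}
    (hp : p.edgeSet ⊆ A.oldEdges) : ∃ p', p = A.incl.mapPath p' := by
  rcases A.eq_mapPath_or_eq_through p with h | ⟨r, t, rfl⟩
  · exact h
  · obtain ⟨e, he⟩ := Quiver.Path.edgeSet_nonempty A.newPath_length
    have h1 := hp (A.newPath_edgeSet_subset_through r t he)
    rw [A.new_edges] at he
    exact absurd h1 he

theorem mapPath_ne_through {a b : V} (p : Quiver.Path a b) (r : Quiver.Path a x)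
    (t : Quiver.Path y b) : A.incl.mapPath p ≠ A.through r t := by
  intro h
  obtain ⟨e, he⟩ := Quiver.Path.edgeSet_nonempty A.newPath_length
  have h1 := A.newPath_edgeSet_subset_through r t he
  rw [← h] at h1
  exact Set.disjoint_left.1 (A.disjoint_mapPath p) h1 he

theorem through_inj {a b : V} {r r' : Quiver.Path a x} {t t' : Quiver.Path y b}
    (h : A.through r t = A.through r' t') : r = r' ∧ t = t' := by
  obtain ⟨h1, h2⟩ := Q.isPlanar.acyclic.comp_inj h
  exact ⟨A.mapPath_injective h1, A.mapPath_injective (Q.isPlanar.acyclic.comp_inj h2).2⟩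

/-- Every factorization of a path of `P` over a vertex of `P` lies in `P`. -/
theorem exists_of_mapPath_eq_comp {a b c : V} {s : Quiver.Path a b}
    {p : Quiver.Path (A.incl.obj a) (A.incl.obj c)} {q : Quiver.Path (A.incl.obj c) (A.incl.obj b)}
    (h : A.incl.mapPath s = p.comp q) :
    ∃ p' q', p = A.incl.mapPath p' ∧ q = A.incl.mapPath q' ∧ s = p'.comp q' := by
  have h1 := A.edgeSet_mapPath s
  rw [h, Quiver.Path.edgeSet_comp] at h1
  obtain ⟨p', rfl⟩ := A.exists_eq_mapPath (Set.subset_union_left.trans h1)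
  obtain ⟨q', rfl⟩ := A.exists_eq_mapPath (Set.subset_union_right.trans h1)
  exact ⟨p', q', rfl, rfl, A.mapPath_injective (by rw [h, Prefunctor.mapPath_comp])⟩

/-! ### Rewriting of old paths and of paths through the new one. -/

theorem cell_cases (c : Q.computad.Cell) :
    (∃ F : P.computad.Cell, Q.computad.bd c = (P.computad.bd F).map A.incl) ∨ c = A.newCell := by
  obtain ⟨F, hF⟩ := c
  rcases (A.interior_iff F).1 hF with h | rfl
  · exact Or.inl ⟨⟨F, h⟩, A.interior_old F h hF⟩
  · exact Or.inr rfl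

theorem step_mapPath {a b : V} {X Y : Quiver.Path (A.incl.obj a) (A.incl.obj b)}
    (s : Q.computad.Step X Y) {p : Quiver.Path a b} (hX : X = A.incl.mapPath p) :
    (∃ p', Y = A.incl.mapPath p' ∧ Nonempty (P.computad.Step p p')) ∨
      ∃ r t, p = r.comp (A.bottom.comp t) ∧ Y = A.through r t := by
  rcases A.cell_cases s.cell with ⟨F, hF⟩ | hF
  · obtain ⟨pre, post, h1, h2⟩ := s.exists_of_bd_eq hF
    rw [hX] at h1
    obtain ⟨pre, q, rfl, h3, rfl⟩ := A.exists_of_mapPath_eq_comp h1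
    obtain ⟨d, post, h4, rfl, rfl⟩ := A.exists_of_mapPath_eq_comp h3.symm
    obtain rfl := A.mapPath_injective h4
    exact Or.inl ⟨pre.comp ((P.computad.bd F).cod.comp post), by simpa using h2,
      ⟨⟨F, pre, post, rfl, rfl⟩⟩⟩
  · have hF' := A.bd_newCell
    rw [← hF] at hF'
    obtain ⟨pre, post, h1, h2⟩ := s.exists_of_bd_eq hF'
    rw [hX] at h1
    obtain ⟨pre, q, rfl, h3, rfl⟩ := A.exists_of_mapPath_eq_comp h1
    obtain ⟨d, post, h4, rfl, rfl⟩ := A.exists_of_mapPath_eq_comp h3.symm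
    obtain rfl := A.mapPath_injective h4
    exact Or.inr ⟨pre, post, rfl, h2⟩

/-- The source path of an old atomic 2-cell is non-empty and shares no edge with the new path, so it
lies before or after it. The new 2-cell does not apply: by unique factorization the new path would
equal the old path `bottom`. -/
theorem step_through {a b : V} {X Y : Quiver.Path (A.incl.obj a) (A.incl.obj b)}
    (s : Q.computad.Step X Y) {r : Quiver.Path a x} {t : Quiver.Path y b}
    (hX : X = A.through r t) :
    (∃ r', Y = A.through r' t ∧ Nonempty (P.computad.Step r r')) ∨
      ∃ t', Y = A.through r t' ∧ Nonempty (P.computad.Step t t') := by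
  rcases A.cell_cases s.cell with ⟨F, hF⟩ | hF
  · obtain ⟨pre, post, h1, h2⟩ := s.exists_of_bd_eq hF
    rw [hX] at h1
    have hdom : (A.incl.mapPath (P.computad.bd F).dom).length ≠ 0 := by
      rw [Prefunctor.length_mapPath]
      exact P.isPlanar.dom_length F
    rcases Quiver.Path.disjoint_subpaths h1 (A.disjoint_mapPath _).symm A.newPath_length hdom with
      ⟨m, rfl, h3⟩ | ⟨m, h3, rfl⟩
    · obtain ⟨m, q, rfl, h4, rfl⟩ := A.exists_of_mapPath_eq_comp h3
      obtain ⟨d, post, h5, rfl, rfl⟩ := A.exists_of_mapPath_eq_comp h4.symm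
      obtain rfl := A.mapPath_injective h5
      exact Or.inr ⟨m.comp ((P.computad.bd F).cod.comp post), by simp [h2, through],
        ⟨⟨F, m, post, rfl, rfl⟩⟩⟩
    · obtain ⟨pre, q, rfl, h4, rfl⟩ := A.exists_of_mapPath_eq_comp h3
      obtain ⟨d, m, h5, rfl, rfl⟩ := A.exists_of_mapPath_eq_comp h4.symm
      obtain rfl := A.mapPath_injective h5
      exact Or.inl ⟨pre.comp ((P.computad.bd F).cod.comp m), by simp [h2, through],
        ⟨⟨F, pre, m, rfl, rfl⟩⟩⟩
  · have hF' := A.bd_newCell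
    rw [← hF] at hF'
    obtain ⟨pre, post, h1, h2⟩ := s.exists_of_bd_eq hF'
    rw [hX] at h1
    obtain ⟨-, h3⟩ := Q.isPlanar.acyclic.comp_inj h1
    obtain ⟨h4, -⟩ := Q.isPlanar.acyclic.comp_inj h3
    obtain ⟨e, he⟩ := Quiver.Path.edgeSet_nonempty A.newPath_length
    have he' : e ∈ (A.incl.mapPath A.bottom).edgeSet := by
      have h5 : A.newPath = A.incl.mapPath A.bottom := h4
      rwa [h5] at he
    exact absurd he (Set.disjoint_left.1 (A.disjoint_mapPath A.bottom) he')

theorem derivation_through {a b : V} {X Y : Quiver.Path (A.incl.obj a) (A.incl.obj b)}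
    (d : Q.computad.Derivation X Y) {r : Quiver.Path a x} {t : Quiver.Path y b}
    (hX : X = A.through r t) :
    ∃ r' t', Y = A.through r' t' ∧ Nonempty (P.computad.Derivation r r') ∧
      Nonempty (P.computad.Derivation t t') := by
  induction d generalizing r t with
  | nil => exact ⟨r, t, hX, ⟨.nil _⟩, ⟨.nil _⟩⟩
  | cons s d ih =>
    rcases A.step_through s hX with ⟨r', h, ⟨s'⟩⟩ | ⟨t', h, ⟨s'⟩⟩
    · obtain ⟨r'', t', h', ⟨d₁⟩, hd₂⟩ := ih h
      exact ⟨r'', t', h', ⟨.cons s' d₁⟩, hd₂⟩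
    · obtain ⟨r', t'', h', hd₁, ⟨d₂⟩⟩ := ih h
      exact ⟨r', t'', h', hd₁, ⟨.cons s' d₂⟩⟩

/-- Once `α` has been applied, the later steps act on `r` and `t` only. They can be carried out
beside `bottom` instead, that is, before `α` and inside `P`. -/
theorem derivation_mapPath {a b : V} {X Y : Quiver.Path (A.incl.obj a) (A.incl.obj b)}
    (d : Q.computad.Derivation X Y) {p : Quiver.Path a b} (hX : X = A.incl.mapPath p) :
    (∃ p', Y = A.incl.mapPath p' ∧ Nonempty (P.computad.Derivation p p')) ∨
      ∃ r t, Y = A.through r t ∧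
        Nonempty (P.computad.Derivation p (r.comp (A.bottom.comp t))) := by
  induction d generalizing p with
  | nil => exact Or.inl ⟨p, hX, ⟨.nil _⟩⟩
  | cons s d ih =>
    rcases A.step_mapPath s hX with ⟨p', h, ⟨s'⟩⟩ | ⟨r, t, rfl, h⟩
    · rcases ih h with ⟨p'', h', ⟨d'⟩⟩ | ⟨r, t, h', ⟨d'⟩⟩
      · exact Or.inl ⟨p'', h', ⟨.cons s' d'⟩⟩
      · exact Or.inr ⟨r, t, h', ⟨.cons s' d'⟩⟩
    · obtain ⟨r', t', h', ⟨d₁⟩, ⟨d₂⟩⟩ := A.derivation_through d h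
      refine Or.inr ⟨r', t', h', ?_⟩
      have f : (⟨r.comp (A.bottom.comp t)⟩ : P.FreeHom a b) ⟶ ⟨r'.comp (A.bottom.comp t')⟩ :=
        P.computad.mapR (p := ⟨r⟩) (p' := ⟨r'⟩) (Quot.mk _ d₁) ⟨A.bottom.comp t⟩ ≫
          P.computad.mapL ⟨r'⟩ (P.computad.mapL (q := ⟨t⟩) (q' := ⟨t'⟩) ⟨A.bottom⟩ (Quot.mk _ d₂))
      obtain ⟨d', -⟩ := Quot.exists_rep f
      exact ⟨d'⟩

end PastingScheme.BottomAttachment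

/-! ## Collages of posets -/

/-- The collage of a functor `J : D ⥤ A`: the disjoint union of `A` and `D`, together with the
morphisms from objects `a` of `A` to objects `d` of `D` given by the morphisms `a ⟶ J.obj d`. -/
inductive Collage {A D : Type*} [Category* A] [Category* D] (J : D ⥤ A)
  | inl (a : A) : Collage J
  | inr (d : D) : Collage J

namespace Collage

variable {A : Type*} {D : Type*} [Category.{w} A] [Category.{w} D] {J : D ⥤ A}

/-- The morphisms of the collage. -/
def Hom : Collage J → Collage J → Type w
  | inl a, inl a' => a ⟶ a'
  | inl a, inr d => a ⟶ J.obj d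
  | inr _, inl _ => PEmpty
  | inr d, inr d' => d ⟶ d'

instance : Category.{w} (Collage J) where
  Hom := Hom
  id
    | inl a => 𝟙 a
    | inr d => 𝟙 d
  comp {X Y Z} f g := match X, Y, Z, f, g with
    | inl _, inl _, inl _, f, g => CategoryStruct.comp (obj := A) f g
    | inl _, inl _, inr _, f, g => CategoryStruct.comp (obj := A) f g
    | inl _, inr _, inr _, f, g => CategoryStruct.comp (obj := A) f (J.map g)
    | inr _, inr _, inr _, f, g => CategoryStruct.comp (obj := D) f g
    | inr _, inl _, _, f, _ => f.elim
    | _, inr _, inl _, _, g => g.elim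
  id_comp {X Y} f := match X, Y, f with
    | inl _, inl _, f => Category.id_comp (obj := A) f
    | inl _, inr _, f => Category.id_comp (obj := A) f
    | inr _, inr _, f => Category.id_comp (obj := D) f
    | inr _, inl _, f => f.elim
  comp_id {X Y} f := match X, Y, f with
    | inl _, inl _, f => Category.comp_id (obj := A) f
    | inl _, inr _, f => (congrArg _ (J.map_id _)).trans (Category.comp_id (obj := A) f)
    | inr _, inr _, f => Category.comp_id (obj := D) f
    | inr _, inl _, f => f.elim
  assoc {X Y Z T} f g h := match X, Y, Z, T, f, g, h with
    | inl _, inl _, inl _, inl _, f, g, h => Category.assoc (obj := A) f g h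
    | inl _, inl _, inl _, inr _, f, g, h => Category.assoc (obj := A) f g h
    | inl _, inl _, inr _, inr _, f, g, h => Category.assoc (obj := A) f g (J.map h)
    | inl _, inr _, inr _, inr _, f, g, h =>
      (Category.assoc (obj := A) f (J.map g) (J.map h)).trans (congrArg _ (J.map_comp g h).symm)
    | inr _, inr _, inr _, inr _, f, g, h => Category.assoc (obj := D) f g h
    | inr _, inl _, _, _, f, _, _ => f.elim
    | _, inr _, inl _, _, _, g, _ => g.elim
    | _, _, inr _, inl _, _, _, h => h.elim

variable (J) in
/-- The inclusion of the target into the collage. -/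
def inclTarget : A ⥤ Collage J where
  obj := inl
  map f := f
  map_id _ := rfl
  map_comp _ _ := rfl

variable (J) in
/-- The inclusion of the source into the collage. -/
def inclSource : D ⥤ Collage J where
  obj := inr
  map f := f
  map_id _ := rfl
  map_comp _ _ := rfl

/-- The functor out of a collage given by a lax cocone. -/
def desc {C : Type*} [Category* C] (G : A ⥤ C) (H : D ⥤ C) (β : J ⋙ G ⟶ H) : Collage J ⥤ C where
  obj
    | inl a => G.obj a
    | inr d => H.obj d
  map {X Y} f := match X, Y, f with
    | inl _, inl _, f => G.map f
    | inl _, inr d, f => G.map (Y := J.obj d) f ≫ β.app d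
    | inr _, inr _, f => H.map f
    | inr _, inl _, f => f.elim
  map_id
    | inl a => G.map_id a
    | inr d => H.map_id d
  map_comp {X Y Z} f g := match X, Y, Z, f, g with
    | inl _, inl _, inl _, f, g => G.map_comp f g
    | inl _, inl _, inr d, f, g =>
      (congrArg (· ≫ β.app d) (G.map_comp (Z := J.obj d) f g)).trans (Category.assoc _ _ _)
    | inl a, inr d, inr d', f, g => by
      change G.map ((show a ⟶ J.obj d from f) ≫ J.map g) ≫ β.app d' =
        (G.map (Y := J.obj d) f ≫ β.app d) ≫ H.map g
      rw [G.map_comp, Category.assoc, Category.assoc]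
      exact congrArg _ (β.naturality g)
    | inr _, inr _, inr _, f, g => H.map_comp f g
    | inr _, inl _, _, f, _ => f.elim
    | _, inr _, inl _, _, g => g.elim

theorem subsingleton_hom [Quiver.IsThin A] [Quiver.IsThin D] :
    ∀ X Y : Collage J, Subsingleton (X ⟶ Y)
  | inl a, inl a' => inferInstanceAs (Subsingleton (a ⟶ a'))
  | inl a, inr d => inferInstanceAs (Subsingleton (a ⟶ J.obj d))
  | inr _, inl _ => inferInstanceAs (Subsingleton PEmpty)
  | inr d, inr d' => inferInstanceAs (Subsingleton (d ⟶ d'))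

end Collage

/-- The preorder `B` is the collage of `J : D ⥤ A` along the inclusions `I` and `N`. -/
structure IsCollage {A B D : Type*} [Category.{w} A] [Category.{w} B] [Category.{w} D]
    (I : A ⥤ B) (N : D ⥤ B) (J : D ⥤ A) : Prop where
  thin_target : Quiver.IsThin A
  thin_source : Quiver.IsThin D
  thin : Quiver.IsThin B
  target_injective : Function.Injective I.obj
  source_injective : Function.Injective N.obj
  target_hom : ∀ a a', Nonempty (I.obj a ⟶ I.obj a') → Nonempty (a ⟶ a')
  source_hom : ∀ d d', Nonempty (N.obj d ⟶ N.obj d') → Nonempty (d ⟶ d')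
  hom_iff : ∀ a d, Nonempty (I.obj a ⟶ N.obj d) ↔ Nonempty (a ⟶ J.obj d)
  isEmpty_hom : ∀ d a, IsEmpty (N.obj d ⟶ I.obj a)
  cover : ∀ b, (∃ a, b = I.obj a) ∨ ∃ d, b = N.obj d

namespace IsCollage

variable {A B D : Type*} [Category.{w} A] [Category.{w} B] [Category.{w} D]
    {I : A ⥤ B} {N : D ⥤ B} {J : D ⥤ A}

/-- A morphism from `I.obj a` to `N.obj d` factors through `I.obj (J.obj d)`, so the universal
morphisms in `hJ` suffice. -/
theorem functor_ext (h : IsCollage I N J) {C : Type*} [Category* C] {F G : B ⥤ C}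
    (hI : I ⋙ F = I ⋙ G) (hN : N ⋙ F = N ⋙ G)
    (hJ : ∀ d (f : I.obj (J.obj d) ⟶ N.obj d), F.map f ≍ G.map f) : F = G := by
  have := h.thin
  have hobj : ∀ b, F.obj b = G.obj b := by
    intro b
    rcases h.cover b with ⟨a, rfl⟩ | ⟨d, rfl⟩
    · exact Functor.congr_obj hI a
    · exact Functor.congr_obj hN d
  refine Functor.hext hobj fun b b' f => ?_
  rcases h.cover b with ⟨a, rfl⟩ | ⟨d, rfl⟩ <;> rcases h.cover b' with ⟨a', rfl⟩ | ⟨d', rfl⟩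
  · obtain ⟨g⟩ := h.target_hom _ _ ⟨f⟩
    obtain rfl : f = I.map g := Subsingleton.elim _ _
    exact Functor.hcongr_hom hI g
  · obtain ⟨g⟩ := (h.hom_iff _ _).1 ⟨f⟩
    obtain ⟨k⟩ := (h.hom_iff _ d').2 ⟨𝟙 _⟩
    obtain rfl : f = I.map g ≫ k := Subsingleton.elim _ _
    exact Functor.map_comp_heq (hobj _) (hobj _) (hobj _) (Functor.hcongr_hom hI g) (hJ d' k)
  · exact ((h.isEmpty_hom _ _).false f).elim
  · obtain ⟨g⟩ := h.source_hom _ _ ⟨f⟩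
    obtain rfl : f = N.map g := Subsingleton.elim _ _
    exact Functor.hcongr_hom hN g

/-- `B` maps to the category `Collage J`, where functoriality is automatic by thinness; then
`Collage.desc` applies, with `C` arbitrary. -/
theorem exists_functor (h : IsCollage I N J) {C : Type*} [Category* C] (G : A ⥤ C) (H : D ⥤ C)
    (β : J ⋙ G ⟶ H) : ∃ F : B ⥤ C, I ⋙ F = G ∧ N ⋙ F = H ∧
      ∀ d (f : I.obj (J.obj d) ⟶ N.obj d), F.map f ≍ β.app d := by
  have := h.thin
  have := h.thin_target
  have := h.thin_source
  have hsub := Collage.subsingleton_hom (J := J)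
  have hcover : ∀ b, ∃ X : Collage J, b = Collage.rec (motive := fun _ => B) I.obj N.obj X := by
    intro b
    rcases h.cover b with ⟨a, rfl⟩ | ⟨d, rfl⟩
    · exact ⟨.inl a, rfl⟩
    · exact ⟨.inr d, rfl⟩
  choose e he using hcover
  have heI : ∀ a, e (I.obj a) = .inl a := by
    intro a
    have h1 := he (I.obj a)
    cases h2 : e (I.obj a) with
    | inl a' =>
      rw [h2] at h1
      rw [h.target_injective h1]
    | inr d =>
      rw [h2] at h1
      exact ((h.isEmpty_hom d a).false (eqToHom h1.symm)).elim
  have heN : ∀ d, e (N.obj d) = .inr d := by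
    intro d
    have h1 := he (N.obj d)
    cases h2 : e (N.obj d) with
    | inl a =>
      rw [h2] at h1
      exact ((h.isEmpty_hom d a).false (eqToHom h1)).elim
    | inr d' =>
      rw [h2] at h1
      rw [h.source_injective h1]
  have hmap : ∀ {b b' : B}, (b ⟶ b') → Nonempty (e b ⟶ e b') := by
    intro b b' f
    rcases h.cover b with ⟨a, rfl⟩ | ⟨d, rfl⟩ <;> rcases h.cover b' with ⟨a', rfl⟩ | ⟨d', rfl⟩
    · rw [heI, heI]
      exact h.target_hom _ _ ⟨f⟩
    · rw [heI, heN]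
      exact (h.hom_iff _ _).1 ⟨f⟩
    · exact ((h.isEmpty_hom _ _).false f).elim
    · rw [heN, heN]
      exact h.source_hom _ _ ⟨f⟩
  let E : B ⥤ Collage J :=
    { obj := e
      map f := (hmap f).some
      map_id _ := Subsingleton.elim _ _
      map_comp _ _ := Subsingleton.elim _ _ }
  have hEI : I ⋙ E = Collage.inclTarget J := CategoryTheory.Functor.ext heI fun _ _ _ => Subsingleton.elim _ _
  have hEN : N ⋙ E = Collage.inclSource J := CategoryTheory.Functor.ext heN fun _ _ _ => Subsingleton.elim _ _
  refine ⟨E ⋙ Collage.desc G H β, ?_, ?_, fun d f => ?_⟩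
  · rw [← Functor.assoc, hEI]
    rfl
  · rw [← Functor.assoc, hEN]
    rfl
  · have key : ∀ {X Y : Collage J} (g : X ⟶ Y), X = .inl (J.obj d) → Y = .inr d →
        (Collage.desc G H β).map g ≍ β.app d := by
      rintro _ _ g rfl rfl
      obtain rfl : g = (show Collage.Hom (.inl (J.obj d)) (.inr d) from 𝟙 (J.obj d)) :=
        Subsingleton.elim _ _
      refine heq_of_eq ?_
      change G.map (𝟙 (J.obj d)) ≫ β.app d = _
      rw [G.map_id]
      exact Category.id_comp _
    exact key (E.map f) (heI _) (heN _)

/-- The target of the collage goes to 0 and the source to 1. The retraction is the identity on `A`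
and `J` on `D`; `hom_iff` is its adjunction. -/
theorem isDwyerMap (h : IsCollage I N J) : IsDwyerMap I := by
  have := h.thin
  have := h.thin_target
  have hf : Nonempty I.FullyFaithful := by
    refine ⟨⟨fun f => (h.target_hom _ _ ⟨f⟩).some, fun _ => Subsingleton.elim _ _,
      fun _ => Subsingleton.elim _ _⟩⟩
  refine ⟨hf.some.full, hf.some.faithful, h.target_injective, ?_, ?_⟩
  · obtain ⟨χ, hI, hN, -⟩ := h.exists_functor ((Functor.const A).obj (0 : Fin 2))
      ((Functor.const D).obj (1 : Fin 2))
      { app := fun _ => homOfLE (Fin.zero_le _)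
        naturality := fun _ _ _ => Subsingleton.elim _ _ }
    refine ⟨χ, fun b => ⟨fun hb => ?_, ?_⟩⟩
    · rcases h.cover b with ⟨a, rfl⟩ | ⟨d, rfl⟩
      · exact ⟨a, rfl⟩
      · have := (Functor.congr_obj hN d).symm.trans hb
        exact absurd this (by decide : (1 : Fin 2) ≠ 0)
    · rintro ⟨a, rfl⟩
      exact Functor.congr_obj hI a
  · obtain ⟨K, hI, hN, -⟩ := h.exists_functor (𝟭 A) J (𝟙 J)
    -- The future counit. It also shows that every object of `B` lies in the cosieve.
    have hK : ∀ b, Nonempty (I.obj (K.obj b) ⟶ b) := by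
      intro b
      rcases h.cover b with ⟨a, rfl⟩ | ⟨d, rfl⟩
      · rw [show K.obj (I.obj a) = a from Functor.congr_obj hI a]
        exact ⟨𝟙 _⟩
      · rw [show K.obj (N.obj d) = J.obj d from Functor.congr_obj hN d]
        exact (h.hom_iff _ _).2 ⟨𝟙 _⟩
    refine ⟨(cosieveProperty I).ι ⋙ K, Adjunction.mkOfHomEquiv
      { homEquiv := fun a b =>
          { toFun := fun f => eqToHom (Functor.congr_obj hI a).symm ≫ K.map f.hom
            invFun := fun f => ⟨I.map f ≫ (hK _).some⟩
            left_inv := fun f => ObjectProperty.hom_ext _ (Subsingleton.elim _ _)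
            right_inv := fun f => Subsingleton.elim _ _ }
        homEquiv_naturality_left_symm := fun _ _ =>
          ObjectProperty.hom_ext _ (Subsingleton.elim _ _)
        homEquiv_naturality_right := fun _ _ => Subsingleton.elim _ _ }, hI.symm, ?_⟩
    ext a
    exact Subsingleton.elim _ _

/-- Pushing the collage of `J` out along `F` gives the collage of `J ⋙ F`: a cocone `G`, `H` carries
the universal morphisms `α` of `T` to a lax cocone from `J ⋙ F ⋙ G` to `N ⋙ H`, and this is exactly
what a functor out of `B` needs. -/
theorem isPushout {A B S T X : Type v} [Category.{w} A] [Category.{w} B] [Category.{w} S]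
    [Category.{w} T] [Category.{w} X] {F : S ⥤ A} {L : S ⥤ T} {I : A ⥤ B} {M : T ⥤ B}
    {N : X ⥤ T} {J : X ⥤ S} (comm : F ⋙ I = L ⋙ M) (hT : IsCollage L N J)
    (hB : IsCollage I (N ⋙ M) (J ⋙ F)) :
    IsPushout F.toCatHom L.toCatHom I.toCatHom M.toCatHom := by
  have := hT.thin
  choose α hα using fun d : X => exists_true_iff_nonempty.2 ((hT.hom_iff (J.obj d) d).2 ⟨𝟙 _⟩)
  let α' : J ⋙ L ⟶ N := { app := α, naturality := fun _ _ _ => Subsingleton.elim _ _ }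
  have key : ∀ {C : Type v} [Category.{w} C] (G : A ⥤ C) (H : T ⥤ C), F ⋙ G = L ⋙ H →
      ∃ K : B ⥤ C, I ⋙ K = G ∧ M ⋙ K = H ∧ ∀ K' : B ⥤ C, I ⋙ K' = G → M ⋙ K' = H → K' = K := by
    intro C _ G H hGH
    have e : (J ⋙ F) ⋙ G = (J ⋙ L) ⋙ H := congrArg (J ⋙ ·) hGH
    have happ : ∀ d, (eqToHom e ≫ Functor.whiskerRight α' H).app d ≍ H.map (α d) := by
      intro d
      rw [NatTrans.comp_app, eqToHom_app]
      exact eqToHom_comp_heq _ _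
    have hobj : ∀ d, I.obj (F.obj (J.obj d)) = M.obj (L.obj (J.obj d)) := fun d =>
      Functor.congr_obj comm (J.obj d)
    obtain ⟨K, hI, hN, hK⟩ := hB.exists_functor G (N ⋙ H)
      (eqToHom e ≫ Functor.whiskerRight α' H)
    have hM : M ⋙ K = H := by
      refine hT.functor_ext (N := N) (J := J) ?_ hN fun d f => ?_
      · rw [← Functor.assoc, ← comm, Functor.assoc, hI, hGH]
      · obtain rfl : f = α d := Subsingleton.elim _ _
        have h1 := (hK d (eqToHom (hobj d) ≫ M.map (α d))).trans (happ d)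
        rw [K.map_comp, eqToHom_map] at h1
        exact (eqToHom_comp_heq _ _).symm.trans h1
    refine ⟨K, hI, hM, fun K' hI' hM' => hB.functor_ext (hI'.trans hI.symm) ?_ fun d f => ?_⟩
    · rw [Functor.assoc, Functor.assoc, hM', hM]
    · have := hB.thin
      obtain rfl : f = eqToHom (hobj d) ≫ M.map (α d) := Subsingleton.elim _ _
      rw [K.map_comp, K'.map_comp, eqToHom_map, eqToHom_map]
      exact (eqToHom_comp_heq _ _).trans
        ((Functor.hcongr_hom (hM'.trans hM.symm) (α d)).trans (eqToHom_comp_heq _ _).symm)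
  refine ⟨⟨Cat.Hom.ext comm⟩, ⟨Limits.PushoutCocone.IsColimit.mk _
    (fun s => (key s.inl.toFunctor s.inr.toFunctor
      (congrArg Cat.Hom.toFunctor s.condition)).choose.toCatHom) (fun s => ?_) (fun s => ?_)
      fun s m hm₁ hm₂ => ?_⟩⟩
  · exact Cat.Hom.ext (key s.inl.toFunctor s.inr.toFunctor
      (congrArg Cat.Hom.toFunctor s.condition)).choose_spec.1
  · exact Cat.Hom.ext (key s.inl.toFunctor s.inr.toFunctor
      (congrArg Cat.Hom.toFunctor s.condition)).choose_spec.2.1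
  · exact Cat.Hom.ext ((key s.inl.toFunctor s.inr.toFunctor
      (congrArg Cat.Hom.toFunctor s.condition)).choose_spec.2.2 m.toFunctor
      (congrArg Cat.Hom.toFunctor hm₁) (congrArg Cat.Hom.toFunctor hm₂))

end IsCollage

/-! ## Attaching an atomic 2-cell at the bottom -/

/-- The functor that inserts a fixed object in the middle. -/
def insertMiddle (X Y : Type*) {C : Type*} [Category* X] [Category* Y] [Category* C] (m : C) :
    X × Y ⥤ X × (C × Y) where
  obj d := (d.1, (m, d.2))
  map f := (f.1, (𝟙 m, f.2))

namespace PastingScheme.BottomAttachment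

variable {V W : Type u} [Quiver.{v} V] [Quiver.{v} W] {P : PastingScheme V} {Q : PastingScheme W}
  {x y : V} (A : P.BottomAttachment Q x y)

theorem nonempty_hom_of_inclHom {a b : V} {p q : P.FreeHom a b}
    (h : Nonempty ((A.inclHom a b).obj p ⟶ (A.inclHom a b).obj q)) : Nonempty (p ⟶ q) := by
  obtain ⟨⟨d⟩⟩ := h
  rcases A.derivation_mapPath d rfl with ⟨q', h, ⟨d'⟩⟩ | ⟨r, t, h, -⟩
  · have hq : (⟨q'⟩ : P.FreeHom a b) = q := by
      ext1
      exact (A.mapPath_injective h).symm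
    subst hq
    exact ⟨Quot.mk _ d'⟩
  · exact absurd h (A.mapPath_ne_through _ _ _)

theorem nonempty_hom_through_iff {a b : V} (p : P.FreeHom a b) (r : Quiver.Path a x)
    (t : Quiver.Path y b) :
    Nonempty ((A.inclHom a b).obj p ⟶ ⟨A.through r t⟩) ↔
      Nonempty (p ⟶ ⟨r.comp (A.bottom.comp t)⟩) := by
  constructor
  · rintro ⟨⟨d⟩⟩
    rcases A.derivation_mapPath d rfl with ⟨q', h, -⟩ | ⟨r', t', h, ⟨d'⟩⟩
    · exact absurd h.symm (A.mapPath_ne_through _ _ _)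
    · obtain ⟨rfl, rfl⟩ := A.through_inj h
      exact ⟨Quot.mk _ d'⟩
  · rintro ⟨f⟩
    exact ⟨(A.inclHom a b).map f ≫ Q.computad.cell (Computad.Step.ofGlobe A.newCell _ A.bd_newCell
      (A.incl.mapPath r) (A.incl.mapPath t) (by simp [morphism]) rfl)⟩

theorem nonempty_hom_of_through {a b : V} {r r' : Quiver.Path a x} {t t' : Quiver.Path y b}
    (h : Nonempty ((⟨A.through r t⟩ : Q.FreeHom _ _) ⟶ ⟨A.through r' t'⟩)) :
    Nonempty ((⟨r⟩ : P.FreeHom a x) ⟶ ⟨r'⟩) ∧ Nonempty ((⟨t⟩ : P.FreeHom y b) ⟶ ⟨t'⟩) := by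
  obtain ⟨⟨d⟩⟩ := h
  obtain ⟨r₁, t₁, h, ⟨d₁⟩, ⟨d₂⟩⟩ := A.derivation_through d rfl
  obtain ⟨rfl, rfl⟩ := A.through_inj h
  exact ⟨⟨Quot.mk _ d₁⟩, ⟨Quot.mk _ d₂⟩⟩

theorem isEmpty_hom_of_through {a b : V} (r : Quiver.Path a x) (t : Quiver.Path y b)
    (p : P.FreeHom a b) :
    IsEmpty ((⟨A.through r t⟩ : Q.FreeHom _ _) ⟶ (A.inclHom a b).obj p) := by
  refine ⟨?_⟩
  rintro ⟨d⟩
  obtain ⟨r₁, t₁, h, -⟩ := A.derivation_through d rfl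
  exact A.mapPath_ne_through _ _ _ h

theorem inclHom_injective (a b : V) : Function.Injective (A.inclHom a b).obj := by
  rintro ⟨p⟩ ⟨q⟩ h
  exact congrArg _ (A.mapPath_injective (congrArg Computad.FreeHom.path h))

theorem through_nil_nil :
    A.through (Quiver.Path.nil : Quiver.Path x x) (Quiver.Path.nil : Quiver.Path y y) =
      A.newPath := by
  simp [through]

/-- The new path as a 1-cell. -/
def newHom : Q.FreeHom (A.incl.obj x) (A.incl.obj y) := ⟨A.newPath⟩

theorem newHom_eq : A.newHom = ⟨A.through .nil .nil⟩ := by rw [through_nil_nil, newHom]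

/-- The source path of the new atomic 2-cell as a 1-cell. -/
def bottomHom : P.FreeHom x y := ⟨A.bottom⟩

theorem nonempty_hom_newHom_iff (p : P.FreeHom x y) :
    Nonempty ((A.inclHom x y).obj p ⟶ A.newHom) ↔ Nonempty (p ⟶ A.bottomHom) := by
  rw [newHom_eq, nonempty_hom_through_iff]
  simp [bottomHom]

theorem eq_inclHom_or_eq_newHom (p : Q.FreeHom (A.incl.obj x) (A.incl.obj y)) :
    (∃ p', p = (A.inclHom x y).obj p') ∨ p = A.newHom := by
  obtain ⟨p⟩ := p
  rcases A.eq_mapPath_or_eq_through p with ⟨p', rfl⟩ | ⟨r, t, rfl⟩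
  · exact Or.inl ⟨⟨p'⟩, rfl⟩
  · rw [P.isPlanar.acyclic _ r, P.isPlanar.acyclic _ t, newHom_eq]
    exact Or.inr rfl

theorem composeNew_obj_insertMiddle {a z : V} (d : P.FreeHom y z × P.FreeHom a x) :
    (insertMiddle _ _ A.newHom ⋙ A.composeNew a z).obj d = ⟨A.through d.2.path d.1.path⟩ := by
  ext1
  exact (Quiver.Path.comp_assoc _ _ _)

theorem hcomp₃_obj_insertMiddle {a z : V} (d : P.FreeHom y z × P.FreeHom a x) :
    (insertMiddle _ _ A.bottomHom ⋙ P.computad.hcomp₃ a x y z).obj d =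
      ⟨d.2.path.comp (A.bottom.comp d.1.path)⟩ := by
  ext1
  exact (Quiver.Path.comp_assoc _ _ _)

/-- The objects of the source are the pairs `(t, r)` of paths after `y` and before `x`; such a pair
is sent to `r ⬝ c ⬝ t` in the new hom-category and to `r ⬝ q ⬝ t` in the old one. -/
theorem isCollage_inclHom (a z : V) :
    IsCollage (A.inclHom a z) (insertMiddle _ _ A.newHom ⋙ A.composeNew a z)
      (insertMiddle _ _ A.bottomHom ⋙ P.computad.hcomp₃ a x y z) where
  thin_target := P.isPlanar.isThin a z
  thin_source d d' := by
    have := P.isPlanar.isThin y z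
    have := P.isPlanar.isThin a x
    exact ⟨fun f g => Prod.ext (Subsingleton.elim _ _) (Subsingleton.elim _ _)⟩
  thin := Q.isPlanar.isThin _ _
  target_injective := A.inclHom_injective a z
  source_injective d d' h := by
    rw [composeNew_obj_insertMiddle, composeNew_obj_insertMiddle] at h
    obtain ⟨h1, h2⟩ := A.through_inj (congrArg Computad.FreeHom.path h)
    exact Prod.ext (Computad.FreeHom.ext h2) (Computad.FreeHom.ext h1)
  target_hom _ _ h := A.nonempty_hom_of_inclHom h
  source_hom d d' h := by
    rw [composeNew_obj_insertMiddle, composeNew_obj_insertMiddle] at h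
    obtain ⟨⟨f⟩, ⟨g⟩⟩ := A.nonempty_hom_of_through h
    exact ⟨(g, f)⟩
  hom_iff p d := by
    rw [composeNew_obj_insertMiddle, hcomp₃_obj_insertMiddle, nonempty_hom_through_iff]
  isEmpty_hom d p := by
    rw [composeNew_obj_insertMiddle]
    exact A.isEmpty_hom_of_through _ _ p
  cover p := by
    obtain ⟨p⟩ := p
    rcases A.eq_mapPath_or_eq_through p with ⟨p', rfl⟩ | ⟨r, t, rfl⟩
    · exact Or.inl ⟨⟨p'⟩, rfl⟩
    · exact Or.inr ⟨_, (A.composeNew_obj_insertMiddle (⟨t⟩, ⟨r⟩)).symm⟩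

/-- From `x` to `y` the attachment adds a single path, the new one, because closed paths at `x` and
`y` are trivial. So the middle factor gains one object, lying below exactly the old paths with a
2-cell to `bottom`, and the outer factors come along. -/
theorem isCollage_spanLeft (a z : V) :
    IsCollage (A.spanLeft a z) (insertMiddle _ _ A.newHom) (insertMiddle _ _ A.bottomHom) where
  thin_target _ _ := by
    have := P.isPlanar.isThin y z
    have := P.isPlanar.isThin x y
    have := P.isPlanar.isThin a x
    exact ⟨fun f g => Prod.ext (Subsingleton.elim _ _)
      (Prod.ext (Subsingleton.elim _ _) (Subsingleton.elim _ _))⟩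
  thin_source _ _ := by
    have := P.isPlanar.isThin y z
    have := P.isPlanar.isThin a x
    exact ⟨fun f g => Prod.ext (Subsingleton.elim _ _) (Subsingleton.elim _ _)⟩
  thin _ _ := by
    have := P.isPlanar.isThin y z
    have := Q.isPlanar.isThin (A.incl.obj x) (A.incl.obj y)
    have := P.isPlanar.isThin a x
    exact ⟨fun f g => Prod.ext (Subsingleton.elim _ _)
      (Prod.ext (Subsingleton.elim _ _) (Subsingleton.elim _ _))⟩
  target_injective p q h :=
    Prod.ext (congrArg (·.1) h)
      (Prod.ext (A.inclHom_injective x y (congrArg (·.2.1) h)) (congrArg (·.2.2) h))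
  source_injective p q h := Prod.ext (congrArg (·.1) h) (congrArg (·.2.2) h)
  target_hom p q := by
    rintro ⟨f⟩
    obtain ⟨g⟩ := A.nonempty_hom_of_inclHom ⟨f.2.1⟩
    exact ⟨(f.1, (g, f.2.2))⟩
  source_hom p q := by
    rintro ⟨f⟩
    exact ⟨(f.1, f.2.2)⟩
  hom_iff p d := by
    constructor
    · rintro ⟨f⟩
      obtain ⟨g⟩ := (A.nonempty_hom_newHom_iff _).1 ⟨f.2.1⟩
      exact ⟨(f.1, (g, f.2.2))⟩
    · rintro ⟨f⟩
      obtain ⟨g⟩ := (A.nonempty_hom_newHom_iff _).2 ⟨f.2.1⟩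
      exact ⟨(f.1, (g, f.2.2))⟩
  isEmpty_hom d p := by
    refine ⟨fun f => ?_⟩
    have h := A.isEmpty_hom_of_through .nil .nil p.2.1
    rw [← newHom_eq] at h
    exact h.false f.2.1
  cover := by
    rintro ⟨g, m, f⟩
    rcases A.eq_inclHom_or_eq_newHom m with ⟨m, rfl⟩ | rfl
    · exact Or.inl ⟨(g, (m, f)), rfl⟩
    · exact Or.inr ⟨(g, f), rfl⟩

theorem hcomp₃_comp_inclHom (a z : V) :
    P.computad.hcomp₃ a x y z ⋙ A.inclHom a z = A.spanLeft a z ⋙ A.composeNew a z := by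
  have := Q.isPlanar.isThin (A.incl.obj a) (A.incl.obj z)
  refine CategoryTheory.Functor.ext (fun p => ?_) fun _ _ _ => Subsingleton.elim _ _
  ext1
  exact (A.incl.mapPath_comp _ _).trans (congrArg (Quiver.Path.comp · _) (A.incl.mapPath_comp _ _))

theorem composeNew_injective (a z : V) : Function.Injective (A.composeNew a z).obj := by
  rintro ⟨⟨g⟩, ⟨m⟩, ⟨f⟩⟩ ⟨⟨g'⟩, ⟨m'⟩, ⟨f'⟩⟩ h
  obtain ⟨h1, h2⟩ := Q.isPlanar.acyclic.comp_inj (congrArg Computad.FreeHom.path h)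
  obtain ⟨h1, rfl⟩ := Q.isPlanar.acyclic.comp_inj h1
  obtain rfl := A.mapPath_injective h1
  obtain rfl := A.mapPath_injective h2
  rfl

end PastingScheme.BottomAttachment

theorem Computad.hcomp₃_injective {V : Type u} [Quiver.{v} V] (K : Computad.{u, v, w} V)
    (hV : AcyclicQuiver V) (a x y z : V) : Function.Injective (K.hcomp₃ a x y z).obj := by
  rintro ⟨⟨g⟩, ⟨m⟩, ⟨f⟩⟩ ⟨⟨g'⟩, ⟨m'⟩, ⟨f'⟩⟩ h
  obtain ⟨h1, rfl⟩ := hV.comp_inj (congrArg Computad.FreeHom.path h)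
  obtain ⟨rfl, rfl⟩ := hV.comp_inj h1
  rfl

theorem mainTheorem8 {V W : Type u} [Quiver.{v} V] [Quiver.{v} W]
    (P : PastingScheme V) (Q : PastingScheme W) (x y : V) (A : P.BottomAttachment Q x y)
    (a z : V) :
    IsPosetCategory (P.FreeHom a z) ∧
    IsPosetCategory (Q.FreeHom (A.incl.obj a) (A.incl.obj z)) ∧
    Function.Injective (P.computad.hcomp₃ a x y z).obj ∧
    Function.Injective (A.composeNew a z).obj ∧
    IsPushout
      (P.computad.hcomp₃ a x y z).toCatHom
      (A.spanLeft a z).toCatHom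
      (A.inclHom a z).toCatHom
      (A.composeNew a z).toCatHom ∧
    IsDwyerMap (A.inclHom a z) :=
  ⟨P.isPlanar.isPosetCategory a z, Q.isPlanar.isPosetCategory _ _,
    P.computad.hcomp₃_injective P.isPlanar.acyclic a x y z, A.composeNew_injective a z,
    (A.isCollage_spanLeft a z).isPushout (A.hcomp₃_comp_inclHom a z) (A.isCollage_inclHom a z),
    (A.isCollage_inclHom a z).isDwyerMap⟩
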